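/- Let $0\le d\le n$ be integers and $W=\mathrm{Sym}_n(\mathbb R)\oplus M_{n,d}(\mathbb R)$, with Lebesgue measure $dz\,dy$ (in the coordinates $z_{ij}$, $i\le j$, and $y_{kl}$). For $(z,y)\in W$ put $$P_1(z,y)=\det z,\qquad P_2(z,y)=(-1)^d\det\begin{pmatrix} z & y\\ {}^t y & 0\end{pmatrix},$$ and let $\widetilde\Omega\subset W$ be the set of $(z,y)$ with $z$ positive definite and $\operatorname{rank} y=d$; there $P_1,P_2>0$. For a Schwartz function $\varphi\in\mathscr S(W)$ and $s=(s_1,s_2)\in\mathbb C^2$ let $$Z_{\widetilde\Omega}(\varphi,s)=\int_{\widetilde\Omega}\varphi(z,y)\,P_1(z,y)^{s_1}P_2(z,y)^{s_2}\,dz\,dy$$ whenever this integral converges absolutely. Put $\Gamma_k(\alpha)=\prod_{j=1}^{k}\Gamma\bigl(\alpha-\tfrac{j-1}{2}\bigr)$ and $$\Gamma_{\widetilde\Omega}(s)=\Gamma_d\bigl(s_1+\tfrac{d+1}{2}\bigr)\,\Gamma_d\bigl(s_2+\tfrac{d+1}{2}\bigr)\,\Gamma_d\bigl(s_2+\tfrac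 n2\bigr)\,\Gamma_{n-d}\bigl(s_1+s_2+\tfrac{n+1}{2}\bigr).$$ **Theorem (Meromorphic Continuation).** For every $\varphi\in\mathscr S(W)$ the integral $Z_{\widetilde\Omega}(\varphi,s)$ converges absolutely if $\operatorname{Re}s_1\ge 0$ and $\operatorname{Re}s_2\ge0$, and there is an entire function $E$ on $\mathbb C^2$ with $$E(s)=\frac{1}{\Gamma_{\widetilde\Omega}(s)}\,Z_{\widetilde\Omega}(\varphi,s)$$ at every $s$ at which the integral converges absolutely (where $1/\Gamma_{\widetilde\Omega}$ is regarded as an entire function). Consequently $Z_{\widetilde\Omega}(\varphi,\cdot)$ extends to a meromorphic function $M$ on $\mathbb C^2$ that is holomorphic outside the union of the polar hyperplanes of the gamma functions in $\Gamma_{\widetilde\Omega}$; outside this union $M=\Gamma_{\widetilde\Omega}\,E$, and $M(s)=Z_{\widetilde\Omega}(\varphi,s)$ wherever the integral converges absolutely. -/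

import Mathlib

open MeasureTheory Filter Topology
open scoped SchwartzMap

/- The norm on matrices is only used to speak of Schwartz functions and does not matter for that,
all norms on a finite-dimensional space being equivalent. -/
attribute [local instance] Matrix.normedAddCommGroup Matrix.normedSpace

namespace EnhancedZeta

/-- The space `V = Sym_n(ℝ)` of real symmetric matrices. -/
def Sym (n : ℕ) : Submodule ℝ (Matrix (Fin n) (Fin n) ℝ) where
  carrier := {z | z.IsSymm}
  add_mem' := fun ha hb => Matrix.IsSymm.add ha hb
  zero_mem' := Matrix.isSymm_zero
  smul_mem' := fun c _ ha => Matrix.IsSymm.smul ha c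

/-- The space `W = Sym_n(ℝ) ⊕ M_{n,d}(ℝ)`. -/
abbrev W (n d : ℕ) : Type := Sym n × Matrix (Fin n) (Fin d) ℝ

/-- The relative invariant `P₁(z, y) = det z`. -/
noncomputable def P₁ {n d : ℕ} (w : W n d) : ℝ := (w.1 : Matrix (Fin n) (Fin n) ℝ).det

/-- The relative invariant `P₂(z, y) = (-1)^d det [[z, y], [yᵀ, 0]]`. -/
noncomputable def P₂ {n d : ℕ} (w : W n d) : ℝ :=
  (-1) ^ d * (Matrix.fromBlocks (w.1 : Matrix (Fin n) (Fin n) ℝ) w.2 w.2.transpose 0).det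

/-- The enhanced positive cone: pairs `(z, y)` with `z` positive definite and `y` of full rank
(which means rank `d`, as we shall have `d ≤ n`). -/
def cone (n d : ℕ) : Set (W n d) :=
  {w | (w.1 : Matrix (Fin n) (Fin n) ℝ).PosDef ∧ w.2.rank = d}

/-- Coordinates on `W`: the entries `z i j` with `i ≤ j`, and the entries of `y`. This type carries
the standard Lebesgue measure `volume`. -/
abbrev Coord (n d : ℕ) : Type :=
  ({p : Fin n × Fin n // p.1 ≤ p.2} → ℝ) × (Fin n → Fin d → ℝ)

/-- The symmetric matrix with prescribed entries on and above the diagonal. -/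
def symOfCoord {n : ℕ} (x : {p : Fin n × Fin n // p.1 ≤ p.2} → ℝ) : Sym n :=
  ⟨Matrix.of fun i j => x ⟨(min i j, max i j), min_le_max⟩, by
    change Matrix.IsSymm _
    ext i j
    simp [min_comm, max_comm]⟩

/-- The point of `W` with given coordinates. -/
def ofCoord {n d : ℕ} (c : Coord n d) : W n d := (symOfCoord c.1, Matrix.of c.2)

/-- The integrand `φ(z, y) P₁(z, y)^{s₁} P₂(z, y)^{s₂}`. On the cone `P₁` and `P₂` are positive, so
the complex powers are the usual ones. -/
noncomputable def integrand {n d : ℕ} (φ : 𝓢(W n d, ℂ)) (s : ℂ × ℂ) (w : W n d) : ℂ :=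
  φ w * (P₁ w : ℂ) ^ s.1 * (P₂ w : ℂ) ^ s.2

/-- The enhanced zeta integral converges (absolutely) at `s`. -/
def Converges {n d : ℕ} (φ : 𝓢(W n d, ℂ)) (s : ℂ × ℂ) : Prop :=
  IntegrableOn (fun c : Coord n d => integrand φ s (ofCoord c)) (ofCoord ⁻¹' cone n d) volume

/-- The enhanced zeta integral `∫ φ(z, y) P₁(z, y)^{s₁} P₂(z, y)^{s₂} dz dy` over the cone
(meaningful where it converges). -/
noncomputable def zetaIntegral {n d : ℕ} (φ : 𝓢(W n d, ℂ)) (s : ℂ × ℂ) : ℂ :=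
  ∫ c in ofCoord ⁻¹' cone n d, integrand φ s (ofCoord (n := n) (d := d) c)

/-- `Γ_k(α) = Γ(α) Γ(α - 1/2) ⋯ Γ(α - (k-1)/2)`. -/
noncomputable def multiGamma (k : ℕ) (α : ℂ) : ℂ :=
  ∏ j ∈ Finset.range k, Complex.Gamma (α - j / 2)

/-- `α` is a pole of `Γ_k`: one of the arguments `α - j/2`, `0 ≤ j < k`, is a non-positive
integer. (The gamma function has no zeros, so poles of the factors do not cancel.) -/
def IsMultiGammaPole (k : ℕ) (α : ℂ) : Prop :=
  ∃ j < k, ∃ m : ℕ, α - (j : ℂ) / 2 = -(m : ℂ)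

/-- The gamma factor of the enhanced positive cone. At a pole of one of its gamma functions Lean's
value is `0`, whose inverse `0` is the value there of the entire function `1 / gammaFactor`. -/
noncomputable def gammaFactor (n d : ℕ) (s : ℂ × ℂ) : ℂ :=
  multiGamma d (s.1 + (d + 1) / 2) * multiGamma d (s.2 + (d + 1) / 2) *
    multiGamma d (s.2 + n / 2) * multiGamma (n - d) (s.1 + s.2 + (n + 1) / 2)

/-- The set of poles of the gamma factor. -/
def gammaPoles (n d : ℕ) : Set (ℂ × ℂ) :=
  {s | IsMultiGammaPole d (s.1 + (d + 1) / 2) ∨ IsMultiGammaPole d (s.2 + (d + 1) / 2) ∨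
    IsMultiGammaPole d (s.2 + n / 2) ∨ IsMultiGammaPole (n - d) (s.1 + s.2 + (n + 1) / 2)}

/-- Meromorphy on `ℂ²`: near every point `f` is a quotient `g / h` of holomorphic functions with
`h` not identically zero. The values where `h` vanishes are irrelevant. -/
def IsMeromorphic (f : ℂ × ℂ → ℂ) : Prop :=
  ∀ s, ∃ g h : ℂ × ℂ → ℂ, AnalyticAt ℂ g s ∧ AnalyticAt ℂ h s ∧ ¬ (h =ᶠ[𝓝 s] 0) ∧
    ∀ᶠ t in 𝓝 s, h t ≠ 0 → f t = g t / h t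

end EnhancedZeta

/-!
The proof reduces the zeta integral to an integral of a Schwartz function against a product of
powers of absolute values of linear forms.

Write `y = k r` with `k` orthogonal and `r` upper triangular (`exists_lintegral_qr`), and then `kᵀ
z k = t tᵀ` with `t` upper triangular (`lintegral_posDef`). In these coordinates `P₁ = ∏ tᵢᵢ²` and
`P₂ = ∏_{j < d} rⱼⱼ² ∏_{i ≥ d} tᵢᵢ²` (`P₁_coords`, `P₂_coords`), and the Jacobian is a monomial in
the `|tᵢᵢ|` and `|rⱼⱼ|` as well. The diagonal entries are allowed to have either sign, so that the
triangular matrices form a vector space. Averaging `φ` over `k` and pulling it back along the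
proper polynomial map `(t, r) ↦ (t tᵀ, r)` gives a Schwartz function `f` on that space, and the
zeta integral becomes the integral of `f ∏ |ℓᵢ|^(2 aᵢ(s) - 1)`, where the `ℓᵢ` are the diagonal
entries and the `aᵢ(s)` are precisely the arguments of the gamma functions in three of the four
factors of `Γ_Ω̃` (`exists_zetaIntegral_eq_monomialIntegral`, `prod_inv_Gamma_exponent`). The
factor `Γ_d(s₂ + (d + 1) / 2)` is not needed, and its inverse is entire.

Such a monomial integral divided by `∏ Γ(aᵢ)` is entire: integrating by parts in the direction of
`ℓᵢ`, after symmetrizing in that direction, raises `aᵢ` by one and replaces `f` by another Schwartz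
function, and the factor `aᵢ` which comes up is absorbed by `Γ(aᵢ + 1) = aᵢ Γ(aᵢ)` (`exists_shift`,
`exists_normalized_shift`, `exists_entire_normalizedIntegral`).

This determines the entire function `E` far to the right. At a point `s` where the integral
converges, it also converges at `s + (t, t)` for `t ≥ 0`, as `P₁^t P₂^t` is at most `1 + P₁^T P₂^T`
for `t ≤ T`. The identity theorem in the variable `t`, and dominated convergence as `t → 0`, show
that the formula for `E` holds at `s` too (`eq_zetaIntegral_of_converges`). Meromorphy on `ℂ²` asks
for power series in two variables, which Osgood's lemma provides (`analyticAt_of_differentiable`).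
-/

namespace EnhancedZeta

/-! ### Holomorphic functions of two complex variables -/

/-- The unit circle as an element of the algebra of bounded continuous functions on `ℝ × ℝ`,
through a continuous real parameter `u`. -/
noncomputable def circleFun (u : C(ℝ × ℝ, ℝ)) : BoundedContinuousFunction (ℝ × ℝ) ℂ :=
  BoundedContinuousFunction.ofNormedAddCommGroup (fun θ => circleMap 0 1 (u θ))
    ((continuous_circleMap 0 1).comp u.continuous) 1 (fun θ => by simp [circleMap])

/-- The Cauchy kernel `1 / (e^{iu} - x)` depends analytically on `x`, as an element of the Banach
algebra of bounded continuous functions. -/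
lemma exists_analyticAt_cauchyKernel (u : C(ℝ × ℝ, ℝ)) :
    ∃ K : ℂ → BoundedContinuousFunction (ℝ × ℝ) ℂ, AnalyticAt ℂ K 0 ∧
      ∀ᶠ x in 𝓝 (0 : ℂ), ∀ θ, K x θ = (circleMap 0 1 (u θ) - x)⁻¹ := by
  set c := circleFun u
  have hc : IsUnit c := by
    refine IsUnit.of_mul_eq_one (circleFun (-u)) ?_
    ext θ
    change circleMap 0 1 (u θ) * circleMap 0 1 (-u θ) = 1
    simp [circleMap, ← Complex.exp_add]
  let g : ℂ → BoundedContinuousFunction (ℝ × ℝ) ℂ := fun x => c - algebraMap ℂ _ x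
  have hg : AnalyticAt ℂ g 0 := by
    let A := (Algebra.linearMap ℂ (BoundedContinuousFunction (ℝ × ℝ) ℂ)).mkContinuous 1
      (fun x => by simp)
    exact analyticAt_const.sub (A.analyticAt 0)
  have hg0 : g 0 = (hc.unit : BoundedContinuousFunction (ℝ × ℝ) ℂ) := by simp [g]
  refine ⟨fun x => Ring.inverse (g x), ?_, ?_⟩
  · have := analyticAt_inverse (𝕜 := ℂ) hc.unit
    rw [← hg0] at this
    exact this.comp hg
  · have h1 : ∀ᶠ x in 𝓝 (0 : ℂ), IsUnit (g x) := by
      refine hg.continuousAt.eventually (p := IsUnit) ?_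
      rw [hg0]
      exact Units.nhds hc.unit
    filter_upwards [h1] with x hx θ
    have := congrArg (fun f : BoundedContinuousFunction (ℝ × ℝ) ℂ => f θ)
      (Ring.inverse_mul_cancel _ hx)
    exact eq_inv_of_mul_eq_one_left this

/-- Cauchy's integral formula on the unit bidisc, as a double integral over the angles. -/
lemma cauchy_two (f : ℂ × ℂ → ℂ) (hf : Differentiable ℂ f) (x y : ℂ) (hx : ‖x‖ < 1)
    (hy : ‖y‖ < 1) :
    f (x, y) = (2 * Real.pi * Complex.I)⁻¹ ^ 2 * ∫ θ in (0 : ℝ)..2 * Real.pi,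
      ∫ η in (0 : ℝ)..2 * Real.pi, (circleMap 0 1 θ - x)⁻¹ * (circleMap 0 1 η - y)⁻¹ *
        (deriv (circleMap 0 1) θ * deriv (circleMap 0 1) η *
          f (circleMap 0 1 θ, circleMap 0 1 η)) := by
  have key (g : ℂ → ℂ) (hg : Differentiable ℂ g) (w : ℂ) (hw : ‖w‖ < 1) :
      g w = (2 * Real.pi * Complex.I)⁻¹ * ∫ θ in (0 : ℝ)..2 * Real.pi,
        deriv (circleMap 0 1) θ * ((circleMap 0 1 θ - w)⁻¹ * g (circleMap 0 1 θ)) := by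
    have := Complex.two_pi_I_inv_smul_circleIntegral_sub_inv_smul_of_differentiable_on_off_countable
      (R := 1) (c := 0) (w := w) (f := g) Set.countable_empty (by simpa using hw)
      hg.continuous.continuousOn (fun x _ => hg x)
    rw [← this]
    simp [circleIntegral]
  rw [key (fun x => f (x, y)) (hf.comp (differentiable_id.prodMk (differentiable_const y))) x hx,
    pow_two, mul_assoc ((2 * (Real.pi : ℂ) * Complex.I)⁻¹)]
  congr 1
  rw [← intervalIntegral.integral_const_mul]
  refine intervalIntegral.integral_congr fun θ _ => ?_
  rw [key (fun y => f (circleMap 0 1 θ, y))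
    (hf.comp ((differentiable_const _).prodMk differentiable_id)) y hy]
  simp only [← intervalIntegral.integral_const_mul]
  refine intervalIntegral.integral_congr fun η _ => ?_
  ring

/-- Osgood's lemma: an entire function of two variables is analytic. By the Cauchy formula for the
bidisc, its value at `(x, y)` is a continuous linear functional of the product of two Cauchy
kernels. -/
theorem analyticAt_of_differentiable {f : ℂ × ℂ → ℂ} (hf : Differentiable ℂ f) (s : ℂ × ℂ) :
    AnalyticAt ℂ f s := by
  suffices h : ∀ f : ℂ × ℂ → ℂ, Differentiable ℂ f → AnalyticAt ℂ f 0 by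
    have h1 := h (fun t => f (t + s)) (hf.comp (differentiable_id.add_const s))
    have h2 : AnalyticAt ℂ (fun t : ℂ × ℂ => t - s) s := analyticAt_id.sub analyticAt_const
    have h3 := h1.comp_of_eq h2 (by simp)
    simpa [Function.comp_def] using h3
  intro f hf
  obtain ⟨K₁, hK₁, hK₁'⟩ := exists_analyticAt_cauchyKernel ⟨Prod.fst, continuous_fst⟩
  obtain ⟨K₂, hK₂, hK₂'⟩ := exists_analyticAt_cauchyKernel ⟨Prod.snd, continuous_snd⟩
  set w : ℝ × ℝ → ℂ := fun p => deriv (circleMap 0 1) p.1 * deriv (circleMap 0 1) p.2 *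
          f (circleMap 0 1 p.1, circleMap 0 1 p.2) with hw
  have hwc : Continuous w := by
    have := hf.continuous
    simp only [hw, deriv_circleMap]
    have h1 := continuous_circleMap 0 1
    fun_prop
  set S : Set (ℝ × ℝ) := Set.Ioc 0 (2 * Real.pi) ×ˢ Set.Ioc 0 (2 * Real.pi)
  have hint (g : ℝ × ℝ → ℂ) (hg : Continuous g) : IntegrableOn g S := by
    refine (hg.continuousOn.integrableOn_compact
      (isCompact_Icc.prod isCompact_Icc : IsCompact (Set.Icc (0 : ℝ) (2 * Real.pi) ×ˢ
        Set.Icc (0 : ℝ) (2 * Real.pi)))).mono_set ?_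
    exact Set.prod_mono Set.Ioc_subset_Icc_self Set.Ioc_subset_Icc_self
  let Λ : BoundedContinuousFunction (ℝ × ℝ) ℂ →L[ℂ] ℂ :=
    LinearMap.mkContinuous
      { toFun := fun k => ∫ p in S, k p * w p
        map_add' := fun k l => by
          have := integral_add (hint (fun p => k p * w p) (k.continuous.mul hwc))
            (hint (fun p => l p * w p) (l.continuous.mul hwc))
          rw [← this]
          simp [add_mul]
        map_smul' := fun c k => by
          simp only [BoundedContinuousFunction.coe_smul, smul_eq_mul, mul_assoc, RingHom.id_apply]
          rw [integral_const_mul] }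
      (∫ p in S, ‖w p‖) (fun k => by
        change ‖∫ p in S, k p * w p‖ ≤ _
        rw [mul_comm, ← integral_const_mul]
        refine norm_integral_le_of_norm_le ((hint _ hwc).norm.const_mul _) ?_
        refine ae_of_all _ fun p => ?_
        rw [norm_mul]
        gcongr
        exact k.norm_coe_le_norm p)
  have hA : AnalyticAt ℂ (fun p : ℂ × ℂ =>
      (2 * Real.pi * Complex.I)⁻¹ ^ 2 * Λ (K₁ p.1 * K₂ p.2)) 0 := by
    refine analyticAt_const.mul ((Λ.analyticAt _).comp ?_)
    exact (hK₁.comp_of_eq analyticAt_fst rfl).mul (hK₂.comp_of_eq analyticAt_snd rfl)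
  refine hA.congr ?_
  have e1 : ∀ᶠ p : ℂ × ℂ in 𝓝 0, ∀ θ, K₁ p.1 θ = (circleMap 0 1 θ.1 - p.1)⁻¹ :=
    (continuous_fst.tendsto (0 : ℂ × ℂ)).eventually hK₁'
  have e2 : ∀ᶠ p : ℂ × ℂ in 𝓝 0, ∀ θ, K₂ p.2 θ = (circleMap 0 1 θ.2 - p.2)⁻¹ :=
    (continuous_snd.tendsto (0 : ℂ × ℂ)).eventually hK₂'
  have e3 : ∀ᶠ p : ℂ × ℂ in 𝓝 0, ‖p‖ < 1 := by
    filter_upwards [Metric.ball_mem_nhds (0 : ℂ × ℂ) one_pos] with p hp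
    simpa using hp
  filter_upwards [e1, e2, e3] with p h1 h2 h3
  rw [show f p = f (p.1, p.2) from rfl, cauchy_two f hf p.1 p.2
    ((norm_fst_le p).trans_lt h3) ((norm_snd_le p).trans_lt h3)]
  congr 1
  change ∫ q in S, (K₁ p.1 * K₂ p.2) q * w q = _
  rw [Measure.volume_eq_prod, setIntegral_prod _ (by
    rw [← Measure.volume_eq_prod]
    exact hint _ ((K₁ p.1 * K₂ p.2).continuous.mul hwc))]
  rw [intervalIntegral.integral_of_le (by positivity)]
  refine integral_congr_ae (ae_of_all _ fun θ => ?_)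
  simp only
  rw [intervalIntegral.integral_of_le (by positivity)]
  refine integral_congr_ae (ae_of_all _ fun η => ?_)
  simp [h1, h2, hw]

lemma differentiable_finset_prod {κ : Type*} (S : Finset κ) {f : κ → ℂ × ℂ → ℂ}
    (hf : ∀ i ∈ S, Differentiable ℂ (f i)) : Differentiable ℂ fun s => ∏ i ∈ S, f i s := by
  classical
  intro s
  exact (HasFDerivAt.finsetProd fun i hi => (hf i hi s).hasFDerivAt).differentiableAt

/-! ### Laplace integrals in two variables -/

/-- The derivative of the kernel `e^{ua + vb}` in `(u, v)` is dominated near `(u, v)` by the values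
of the kernel at the corners of a square, which are integrable if the Laplace integral converges
there. -/
lemma laplace_kernel_bound {ε a b x y u v : ℝ} (hε : 0 < ε) (hx : |x| ≤ ε / 2) (hy : |y| ≤ ε / 2) :
    Real.exp ((u + x) * a + (v + y) * b) * (|a| + |b|) ≤
      (2 / ε) * (Real.exp ((u + ε) * a + (v + ε) * b) + Real.exp ((u + ε) * a + (v - ε) * b) +
        Real.exp ((u - ε) * a + (v + ε) * b) + Real.exp ((u - ε) * a + (v - ε) * b)) := by
  have h1 : |a| + |b| ≤ (2 / ε) * Real.exp (ε / 2 * (|a| + |b|)) := by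
    have := Real.add_one_le_exp (ε / 2 * (|a| + |b|))
    rw [div_mul_eq_mul_div, le_div_iff₀ hε]
    nlinarith
  have h2 : (u + x) * a + (v + y) * b ≤ u * a + v * b + ε / 2 * (|a| + |b|) := by
    have h3 : x * a ≤ ε / 2 * |a| := (le_abs_self _).trans (by rw [abs_mul]; gcongr)
    have h4 : y * b ≤ ε / 2 * |b| := (le_abs_self _).trans (by rw [abs_mul]; gcongr)
    linarith
  calc _ ≤ Real.exp (u * a + v * b + ε / 2 * (|a| + |b|)) *
        ((2 / ε) * Real.exp (ε / 2 * (|a| + |b|))) := by gcongr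
    _ = (2 / ε) * Real.exp (u * a + v * b + ε * |a| + ε * |b|) := by
        rw [mul_left_comm, ← Real.exp_add]; ring_nf
    _ ≤ _ := by
        gcongr
        rcases abs_cases a with ⟨h, _⟩ | ⟨h, _⟩ <;> rcases abs_cases b with ⟨h', _⟩ | ⟨h', _⟩ <;>
          rw [h, h']
        · rw [show u * a + v * b + ε * a + ε * b = (u + ε) * a + (v + ε) * b by ring]
          linarith [Real.exp_pos ((u + ε) * a + (v - ε) * b),
            Real.exp_pos ((u - ε) * a + (v + ε) * b), Real.exp_pos ((u - ε) * a + (v - ε) * b)]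
        · rw [show u * a + v * b + ε * a + ε * -b = (u + ε) * a + (v - ε) * b by ring]
          linarith [Real.exp_pos ((u + ε) * a + (v + ε) * b),
            Real.exp_pos ((u - ε) * a + (v + ε) * b), Real.exp_pos ((u - ε) * a + (v - ε) * b)]
        · rw [show u * a + v * b + ε * -a + ε * b = (u - ε) * a + (v + ε) * b by ring]
          linarith [Real.exp_pos ((u + ε) * a + (v - ε) * b),
            Real.exp_pos ((u + ε) * a + (v + ε) * b), Real.exp_pos ((u - ε) * a + (v - ε) * b)]
        · rw [show u * a + v * b + ε * -a + ε * -b = (u - ε) * a + (v - ε) * b by ring]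
          linarith [Real.exp_pos ((u + ε) * a + (v - ε) * b),
            Real.exp_pos ((u - ε) * a + (v + ε) * b), Real.exp_pos ((u + ε) * a + (v + ε) * b)]

/-- A Laplace integral `∫ g e^{s₁ L₁ + s₂ L₂}` is holomorphic on any open set on which it converges
absolutely. -/
theorem differentiableOn_laplace {Ω : Type*} [MeasurableSpace Ω] {μ : Measure Ω} {g : Ω → ℂ}
    {L₁ L₂ : Ω → ℝ} (hL₁ : AEMeasurable L₁ μ) (hL₂ : AEMeasurable L₂ μ) {S : Set (ℂ × ℂ)}
    (hS : IsOpen S)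
    (hint : ∀ s ∈ S, Integrable (fun ω => g ω * Complex.exp (s.1 * L₁ ω + s.2 * L₂ ω)) μ) :
    DifferentiableOn ℂ
      (fun s : ℂ × ℂ => ∫ ω, g ω * Complex.exp (s.1 * L₁ ω + s.2 * L₂ ω) ∂μ) S := by
  intro s hs
  refine DifferentiableAt.differentiableWithinAt ?_
  obtain ⟨r, hr, hrS⟩ := Metric.isOpen_iff.1 hS s hs
  set ε := r / 2
  have hε : 0 < ε := by positivity
  have hcorner (x y : ℝ) (hx : |x| ≤ ε) (hy : |y| ≤ ε) :
      Integrable (fun ω => ‖g ω‖ * Real.exp ((s.1.re + x) * L₁ ω + (s.2.re + y) * L₂ ω)) μ := by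
    have hm : (s.1 + x, s.2 + y) ∈ S := by
      apply hrS
      rw [Metric.mem_ball, dist_eq_norm]
      have : ((s.1 + x, s.2 + y) : ℂ × ℂ) - s = (((x : ℝ) : ℂ), ((y : ℝ) : ℂ)) := by
        ext <;> simp
      rw [this, Prod.norm_def]
      simp only [Complex.norm_real, Real.norm_eq_abs]
      exact (max_le hx hy).trans_lt (half_lt_self hr)
    refine (hint _ hm).norm.congr (ae_of_all _ fun ω => ?_)
    simp [Complex.norm_exp]
  let F' : ℂ × ℂ → Ω → (ℂ × ℂ →L[ℂ] ℂ) := fun t ω =>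
    (g ω * Complex.exp (t.1 * L₁ ω + t.2 * L₂ ω)) •
      (((L₁ ω : ℂ)) • ContinuousLinearMap.fst ℂ ℂ ℂ + ((L₂ ω : ℂ)) • ContinuousLinearMap.snd ℂ ℂ ℂ)
  have hball : ∀ᶠ t in 𝓝 s, t ∈ S := hS.mem_nhds hs
  have hfinal := hasFDerivAt_integral_of_dominated_of_fderiv_le (𝕜 := ℂ) (μ := μ) (x₀ := s)
    (F := fun (t : ℂ × ℂ) ω => g ω * Complex.exp (t.1 * L₁ ω + t.2 * L₂ ω)) (F' := F')
    (bound := fun ω => (2 / ε) * (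
        ‖g ω‖ * Real.exp ((s.1.re + ε) * L₁ ω + (s.2.re + ε) * L₂ ω) +
        ‖g ω‖ * Real.exp ((s.1.re + ε) * L₁ ω + (s.2.re + -ε) * L₂ ω) +
        ‖g ω‖ * Real.exp ((s.1.re + -ε) * L₁ ω + (s.2.re + ε) * L₂ ω) +
        ‖g ω‖ * Real.exp ((s.1.re + -ε) * L₁ ω + (s.2.re + -ε) * L₂ ω)))
    (s := Metric.ball s (ε / 2))
    (Metric.ball_mem_nhds s (by positivity))
    (hball.mono fun t ht => (hint t ht).aestronglyMeasurable) (hint s hs) ?_ ?_ ?_ ?_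
  · exact hfinal.differentiableAt
  · refine (hint s hs).aestronglyMeasurable.smul ?_
    have h1 : AEStronglyMeasurable (fun ω => (L₁ ω : ℂ)) μ :=
      (Complex.measurable_ofReal.comp_aemeasurable hL₁).aestronglyMeasurable
    have h2 : AEStronglyMeasurable (fun ω => (L₂ ω : ℂ)) μ :=
      (Complex.measurable_ofReal.comp_aemeasurable hL₂).aestronglyMeasurable
    exact (h1.smul_const _).add (h2.smul_const _)
  · refine ae_of_all _ fun ω t ht => ?_
    have ht' : ‖t - s‖ ≤ ε / 2 := by
      rw [Metric.mem_ball, dist_eq_norm] at ht; exact ht.le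
    have hx : |(t.1 - s.1).re| ≤ ε / 2 :=
      (Complex.abs_re_le_norm _).trans ((norm_fst_le (t - s)).trans ht')
    have hy : |(t.2 - s.2).re| ≤ ε / 2 :=
      (Complex.abs_re_le_norm _).trans ((norm_snd_le (t - s)).trans ht')
    have hb := laplace_kernel_bound (a := L₁ ω) (b := L₂ ω) (u := s.1.re) (v := s.2.re) hε hx hy
    have hn : ‖((L₁ ω : ℂ)) • ContinuousLinearMap.fst ℂ ℂ ℂ +
        ((L₂ ω : ℂ)) • ContinuousLinearMap.snd ℂ ℂ ℂ‖ ≤ |L₁ ω| + |L₂ ω| := by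
      refine (norm_add_le _ _).trans ?_
      rw [norm_smul, norm_smul, Complex.norm_real, Complex.norm_real]
      refine add_le_add (mul_le_of_le_one_right (norm_nonneg _) ?_)
        (mul_le_of_le_one_right (norm_nonneg _) ?_)
      · exact ContinuousLinearMap.norm_fst_le ℂ ℂ ℂ
      · exact ContinuousLinearMap.norm_snd_le ℂ ℂ ℂ
    simp only [F', norm_smul, norm_mul, Complex.norm_exp]
    have e : (t.1 * (L₁ ω : ℂ) + t.2 * (L₂ ω : ℂ)).re =
        (s.1.re + (t.1 - s.1).re) * L₁ ω + (s.2.re + (t.2 - s.2).re) * L₂ ω := by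
      simp
    rw [e, mul_assoc]
    calc _ ≤ ‖g ω‖ * (Real.exp ((s.1.re + (t.1 - s.1).re) * L₁ ω +
          (s.2.re + (t.2 - s.2).re) * L₂ ω) * (|L₁ ω| + |L₂ ω|)) := by gcongr
      _ ≤ ‖g ω‖ * _ := mul_le_mul_of_nonneg_left hb (norm_nonneg _)
      _ = _ := by simp only [← sub_eq_add_neg]; ring
  · have hε' : |ε| ≤ ε := (abs_of_pos hε).le
    have hε'' : |-ε| ≤ ε := by rw [abs_neg]; exact hε'
    exact ((((hcorner ε ε hε' hε').add (hcorner ε (-ε) hε' hε'')).add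
      (hcorner (-ε) ε hε'' hε')).add (hcorner (-ε) (-ε) hε'' hε'')).const_mul _
  · refine ae_of_all _ fun ω t _ => ?_
    have h1 : HasFDerivAt (fun t : ℂ × ℂ => t.1 * (L₁ ω : ℂ) + t.2 * (L₂ ω : ℂ))
        (((L₁ ω : ℂ)) • ContinuousLinearMap.fst ℂ ℂ ℂ +
          ((L₂ ω : ℂ)) • ContinuousLinearMap.snd ℂ ℂ ℂ) t := by
      have h := (((L₁ ω : ℂ)) • ContinuousLinearMap.fst ℂ ℂ ℂ +
          ((L₂ ω : ℂ)) • ContinuousLinearMap.snd ℂ ℂ ℂ).hasFDerivAt (x := t)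
      refine h.congr_of_eventuallyEq (Eventually.of_forall fun t => ?_)
      simp [mul_comm]
    have h2 := (h1.cexp).const_mul (g ω)
    simpa [F', smul_smul, mul_assoc] using h2

/-! ### Gluing holomorphic functions on an exhaustion of `ℂ²` -/

/-- The tube `Re s₁ > c`, `Re s₂ > c`. -/
def tube (c : ℝ) : Set (ℂ × ℂ) := {s | c < s.1.re ∧ c < s.2.re}

lemma isOpen_tube (c : ℝ) : IsOpen (tube c) :=
  (isOpen_lt continuous_const (Complex.continuous_re.comp continuous_fst)).inter
    (isOpen_lt continuous_const (Complex.continuous_re.comp continuous_snd))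

lemma tube_anti {c c' : ℝ} (h : c ≤ c') : tube c' ⊆ tube c :=
  fun _ hs => ⟨h.trans_lt hs.1, h.trans_lt hs.2⟩

/-- Functions holomorphic on a half-plane which agree far to the right are equal. -/
lemma eqOn_halfPlane {f g : ℂ → ℂ} {c b : ℝ} (hf : DifferentiableOn ℂ f {t | c < t.re})
    (hg : DifferentiableOn ℂ g {t | c < t.re}) (h : ∀ t : ℂ, b < t.re → f t = g t) :
    Set.EqOn f g {t | c < t.re} := by
  have ho : IsOpen {t : ℂ | c < t.re} := isOpen_lt continuous_const Complex.continuous_re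
  have ho' : IsOpen {t : ℂ | b < t.re} := isOpen_lt continuous_const Complex.continuous_re
  have hp : IsPreconnected {t : ℂ | c < t.re} := (convex_halfSpace_re_gt c).isPreconnected
  refine (hf.analyticOnNhd ho).eqOn_of_preconnected_of_eventuallyEq (hg.analyticOnNhd ho) hp
    (z₀ := ((max c b + 1 : ℝ) : ℂ)) ?_ ?_
  · simp only [Set.mem_ofPred_eq, Complex.ofReal_re]
    linarith [le_max_left c b]
  · filter_upwards [ho'.mem_nhds (by
      simp only [Set.mem_ofPred_eq, Complex.ofReal_re]
      linarith [le_max_right c b] : ((max c b + 1 : ℝ) : ℂ) ∈ {t : ℂ | b < t.re})] with t ht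
    exact h t ht

lemma differentiable_diag (s : ℂ × ℂ) : Differentiable ℂ fun t : ℂ => s + (t, t) :=
  (differentiable_const s).add (differentiable_id.prodMk differentiable_id)

/-- Functions which agree far to the right agree on the whole tube: join a point to the region of
agreement by the complex line in the direction `(1, 1)`. -/
lemma eqOn_tube {f g : ℂ × ℂ → ℂ} {c b : ℝ} (hf : DifferentiableOn ℂ f (tube c))
    (hg : DifferentiableOn ℂ g (tube c)) (h : ∀ s ∈ tube b, f s = g s) :
    Set.EqOn f g (tube c) := by
  intro s hs
  set δ := max (c - s.1.re) (c - s.2.re)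
  have hδ : δ < 0 := max_lt (by linarith [hs.1]) (by linarith [hs.2])
  have hmaps : Set.MapsTo (fun t : ℂ => s + (t, t)) {t : ℂ | δ < t.re} (tube c) := by
    intro t ht
    have h1 := (le_max_left (c - s.1.re) (c - s.2.re)).trans_lt ht
    have h2 := (le_max_right (c - s.1.re) (c - s.2.re)).trans_lt ht
    constructor <;> simp only [Prod.fst_add, Prod.snd_add, Complex.add_re] <;> linarith
  have := eqOn_halfPlane (c := δ) (b := max (b - s.1.re) (b - s.2.re))
    (hf.comp (differentiable_diag s).differentiableOn hmaps)
    (hg.comp (differentiable_diag s).differentiableOn hmaps) (fun t ht => h _ (by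
      have h1 := (le_max_left (b - s.1.re) (b - s.2.re)).trans_lt ht
      have h2 := (le_max_right (b - s.1.re) (b - s.2.re)).trans_lt ht
      constructor <;> simp only [Prod.fst_add, Prod.snd_add, Complex.add_re] <;> linarith))
    (show (0 : ℂ) ∈ {t : ℂ | δ < t.re} by simpa using hδ)
  simpa [Prod.mk_zero_zero] using this

/-- A function which extends holomorphically from one tube to arbitrarily large tubes extends to an
entire function. -/
theorem exists_entire_extension {Z : ℂ × ℂ → ℂ} {b : ℝ}
    (h : ∀ N : ℕ, ∃ F : ℂ × ℂ → ℂ, DifferentiableOn ℂ F (tube (-N)) ∧ ∀ s ∈ tube b, F s = Z s) :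
    ∃ E : ℂ × ℂ → ℂ, Differentiable ℂ E ∧ ∀ s ∈ tube b, E s = Z s := by
  choose F hF hFZ using h
  have hagree {M N : ℕ} (hMN : M ≤ N) {s : ℂ × ℂ} (hs : s ∈ tube (-M)) : F N s = F M s := by
    have hsub : tube (-M) ⊆ tube (-N) := tube_anti (neg_le_neg (Nat.cast_le.2 hMN))
    exact eqOn_tube (b := b) ((hF N).mono hsub) (hF M)
      (fun s hs => (hFZ N s hs).trans (hFZ M s hs).symm) hs
  let k : ℂ × ℂ → ℕ := fun s => ⌈‖s‖⌉₊ + 1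
  have hk (s : ℂ × ℂ) : s ∈ tube (-k s) := by
    have h0 := Nat.le_ceil ‖s‖
    have h1 := (abs_le.1 ((Complex.abs_re_le_norm s.1).trans (norm_fst_le s))).1
    have h2 := (abs_le.1 ((Complex.abs_re_le_norm s.2).trans (norm_snd_le s))).1
    simp only [k]
    constructor <;> push_cast <;> linarith
  have hE {N : ℕ} {s : ℂ × ℂ} (hs : s ∈ tube (-N)) : F (k s) s = F N s := by
    rcases le_total N (k s) with h | h
    · exact hagree h hs
    · exact (hagree h (hk s)).symm
  refine ⟨fun s => F (k s) s, fun s => ?_, fun s hs => hFZ _ s hs⟩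
  have hd := (hF (k s)).differentiableAt ((isOpen_tube _).mem_nhds (hk s))
  refine hd.congr_of_eventuallyEq ?_
  filter_upwards [(isOpen_tube _).mem_nhds (hk s)] with t ht using hE ht

/-! ### Averages of Schwartz functions over families of linear maps -/

section Average

variable {Ω E E' F : Type*} [MeasurableSpace Ω] {μ : Measure Ω} [IsFiniteMeasure μ]
  [NormedAddCommGroup E] [NormedSpace ℝ E] [NormedAddCommGroup E'] [NormedSpace ℝ E']
  [NormedAddCommGroup F] [NormedSpace ℝ F]

/-- Differentiation under the integral sign to all orders, with derivatives bounded uniformly in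
the parameter. -/
theorem contDiff_integral_of_bounded {H : Ω → E → F}
    (hs : ∀ ω, ContDiff ℝ (⊤ : ℕ∞) (H ω))
    (hb : ∀ j : ℕ, ∃ C, ∀ ω x, ‖iteratedFDeriv ℝ j (H ω) x‖ ≤ C)
    (hm : ∀ (j : ℕ) x, AEStronglyMeasurable (fun ω => iteratedFDeriv ℝ j (H ω) x) μ) :
    ContDiff ℝ (⊤ : ℕ∞) (fun x => ∫ ω, H ω x ∂μ) ∧ ∀ (j : ℕ) x,
      iteratedFDeriv ℝ j (fun x => ∫ ω, H ω x ∂μ) x = ∫ ω, iteratedFDeriv ℝ j (H ω) x ∂μ := by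
  have hint (j : ℕ) (x : E) : Integrable (fun ω => iteratedFDeriv ℝ j (H ω) x) μ := by
    obtain ⟨C, hC⟩ := hb j
    exact Integrable.of_bound (hm j x) C (ae_of_all _ fun ω => hC ω x)
  have hfd (j : ℕ) (x : E) :
      HasFDerivAt (fun x => ∫ ω, iteratedFDeriv ℝ j (H ω) x ∂μ)
        (∫ ω, fderiv ℝ (iteratedFDeriv ℝ j (H ω)) x ∂μ) x := by
    obtain ⟨C, hC⟩ := hb (j + 1)
    refine hasFDerivAt_integral_of_dominated_of_fderiv_le (𝕜 := ℝ) (s := Set.univ)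
      (F := fun x ω => iteratedFDeriv ℝ j (H ω) x)
      (F' := fun x ω => fderiv ℝ (iteratedFDeriv ℝ j (H ω)) x)
      (bound := fun _ => C) univ_mem (Eventually.of_forall fun x => hm j x) (hint j x) ?_ ?_ ?_ ?_
    · refine ((continuousMultilinearCurryLeftEquiv ℝ
        (fun _ : Fin (j + 1) => E) F).continuous.comp_aestronglyMeasurable (hm (j + 1) x)).congr ?_
      refine ae_of_all _ fun ω => ?_
      simp [iteratedFDeriv_succ_eq_comp_left]
    · refine ae_of_all _ fun ω x _ => ?_
      rw [norm_fderiv_iteratedFDeriv]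
      exact hC ω x
    · exact integrable_const C
    · refine ae_of_all _ fun ω x _ => ?_
      exact (((hs ω).differentiable_iteratedFDeriv
        (by exact_mod_cast WithTop.coe_lt_top _)) x).hasFDerivAt
  have hformula (j : ℕ) : iteratedFDeriv ℝ j (fun x => ∫ ω, H ω x ∂μ) =
      fun x => ∫ ω, iteratedFDeriv ℝ j (H ω) x ∂μ := by
    induction j with
    | zero =>
      ext1 x
      simp only [iteratedFDeriv_zero_eq_comp, Function.comp_apply]
      exact ((continuousMultilinearCurryFin0 ℝ E F).symm.toContinuousLinearEquiv.integral_comp_comm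
        _).symm
    | succ j ih =>
      ext1 x
      simp only [iteratedFDeriv_succ_eq_comp_left, Function.comp_apply]
      rw [ih, (hfd j x).fderiv]
      exact (ContinuousLinearEquiv.integral_comp_comm (𝕜 := ℝ) (μ := μ)
        (E := E →L[ℝ] (E [×j]→L[ℝ] F))
        (F := E [×(j + 1)]→L[ℝ] F) (continuousMultilinearCurryLeftEquiv ℝ
          (fun _ : Fin (j + 1) => E) F).symm.toContinuousLinearEquiv _).symm
  refine ⟨contDiff_of_differentiable_iteratedFDeriv fun j _ => ?_, fun j x => by rw [hformula]⟩
  rw [hformula]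
  exact fun x => (hfd j x).differentiableAt

/-- The average of a Schwartz function over a bounded family of linear maps is smooth, and its
derivatives decay in any quantity `ρ` which is dominated by `‖A ω x‖` for all members `A ω` of the
family. -/
theorem contDiff_average (h : 𝓢(E', F)) {A : Ω → E →L[ℝ] E'} (hA : StronglyMeasurable A)
    {B : ℝ} (hB : ∀ ω, ‖A ω‖ ≤ B) :
    ContDiff ℝ (⊤ : ℕ∞) (fun x => ∫ ω, h (A ω x) ∂μ) ∧ ∀ p j : ℕ, ∃ C, ∀ x (ρ : ℝ), 0 ≤ ρ →
      (∀ ω, ρ ≤ ‖A ω x‖) → ρ ^ p * ‖iteratedFDeriv ℝ j (fun x => ∫ ω, h (A ω x) ∂μ) x‖ ≤ C := by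
  have hB' (ω : Ω) : 0 ≤ B := (norm_nonneg _).trans (hB ω)
  have hsm := h.smooth ⊤
  have hD (ω : Ω) (j : ℕ) (x : E) : iteratedFDeriv ℝ j (fun x => h (A ω x)) x =
      (iteratedFDeriv ℝ j h (A ω x)).compContinuousLinearMap fun _ => A ω :=
    (A ω).iteratedFDeriv_comp_right hsm x (by exact_mod_cast le_top)
  have hn (ω : Ω) (j : ℕ) (x : E) : ‖iteratedFDeriv ℝ j (fun x => h (A ω x)) x‖ ≤
      ‖iteratedFDeriv ℝ j h (A ω x)‖ * B ^ j := by
    rw [hD]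
    refine (ContinuousMultilinearMap.norm_compContinuousLinearMap_le _ _).trans ?_
    gcongr
    rw [Finset.prod_const, Finset.card_univ, Fintype.card_fin]
    gcongr
    exact hB ω
  have hmain := contDiff_integral_of_bounded (μ := μ) (H := fun ω x => h (A ω x))
    (fun ω => hsm.comp (A ω).contDiff)
    (fun j => ⟨SchwartzMap.seminorm ℝ 0 j h * B ^ j, fun ω x => (hn ω j x).trans (by
      have := hB' ω
      gcongr
      exact h.norm_iteratedFDeriv_le_seminorm ℝ j _)⟩)
    (fun j x => by
      simp only [hD]
      have hc : Continuous fun T : E →L[ℝ] E' =>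
          (iteratedFDeriv ℝ j h (T x)).compContinuousLinearMap fun _ : Fin j => T := by
        have h1 : Continuous fun T : E →L[ℝ] E' => iteratedFDeriv ℝ j h (T x) :=
          (hsm.continuous_iteratedFDeriv (by exact_mod_cast le_top)).comp
            (continuous_id.clm_apply continuous_const)
        have h2 : Continuous fun T : E →L[ℝ] E' =>
            ContinuousMultilinearMap.compContinuousLinearMapContinuousMultilinear ℝ
              (fun _ : Fin j => E) (fun _ : Fin j => E') F (fun _ => T) :=
          (ContinuousMultilinearMap.cont _).comp (continuous_pi fun _ => continuous_id)
        exact h2.clm_apply h1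
      exact hc.comp_stronglyMeasurable hA |>.aestronglyMeasurable)
  refine ⟨hmain.1, fun p j => ⟨(SchwartzMap.seminorm ℝ p j h * B ^ j) * μ.real Set.univ,
    fun x ρ hρ hx => ?_⟩⟩
  rw [hmain.2 j x, ← abs_of_nonneg (pow_nonneg hρ p), ← Real.norm_eq_abs, ← norm_smul,
    ← integral_smul]
  refine norm_integral_le_of_norm_le_const (ae_of_all _ fun ω => ?_)
  rw [norm_smul, Real.norm_eq_abs, abs_of_nonneg (pow_nonneg hρ p)]
  have := hB' ω
  calc _ ≤ ‖A ω x‖ ^ p * (‖iteratedFDeriv ℝ j h (A ω x)‖ * B ^ j) := by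
        gcongr
        · exact hx ω
        · exact hn ω j x
    _ = (‖A ω x‖ ^ p * ‖iteratedFDeriv ℝ j h (A ω x)‖) * B ^ j := by ring
    _ ≤ _ := by
        gcongr
        exact h.le_seminorm ℝ p j _

/-- The average of the functions `h ∘ A ω` over a finite measure is a Schwartz function if the
linear maps `A ω` are uniformly bounded and uniformly bounded below. -/
theorem exists_schwartz_average (h : 𝓢(E', F)) {A : Ω → E →L[ℝ] E'} (hA : StronglyMeasurable A)
    {B C : ℝ} (hB : ∀ ω, ‖A ω‖ ≤ B) (hC : 0 < C) (hbelow : ∀ ω x, ‖x‖ ≤ C * ‖A ω x‖) :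
    ∃ f : 𝓢(E, F), ∀ x, f x = ∫ ω, h (A ω x) ∂μ := by
  obtain ⟨h1, h2⟩ := contDiff_average (μ := μ) h hA hB
  refine ⟨⟨fun x => ∫ ω, h (A ω x) ∂μ, h1, fun p j => ?_⟩, fun x => rfl⟩
  obtain ⟨C', hC'⟩ := h2 p j
  refine ⟨C ^ p * C', fun x => ?_⟩
  have := hC' x (‖x‖ / C) (by positivity) (fun ω => by
    rw [div_le_iff₀ hC, mul_comm]; exact hbelow ω x)
  calc _ = C ^ p * ((‖x‖ / C) ^ p *
        ‖iteratedFDeriv ℝ j (fun x => ∫ ω, h (A ω x) ∂μ) x‖) := by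
        rw [div_pow]; field_simp
    _ ≤ _ := by gcongr

end Average

/-! ### Division of Schwartz functions by a coordinate -/

section Division

variable {V : Type*} [NormedAddCommGroup V] [NormedSpace ℝ V]

/-- By the Leibniz rule, `ℓ` times the derivative of `k` of order `j + 1` is that of `ℓ k` up to a
derivative of `k` of order `j`. -/
lemma abs_mul_norm_iteratedFDeriv_le (ℓ : V →L[ℝ] ℝ) {k : V → ℂ}
    (hk : ContDiff ℝ (⊤ : ℕ∞) k) (j : ℕ) (x : V) :
    |ℓ x| * ‖iteratedFDeriv ℝ (j + 1) k x‖ ≤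
      ‖iteratedFDeriv ℝ (j + 1) (fun y => ℓ y • k y) x‖ +
        (j + 1) * ‖ℓ‖ * ‖iteratedFDeriv ℝ j k x‖ := by
  set m : V → ℝ := fun y => ℓ y - ℓ x
  have hm : ContDiff ℝ (⊤ : ℕ∞) m := ℓ.contDiff.sub contDiff_const
  have hle : ((j + 1 : ℕ) : WithTop ℕ∞) ≤ ((⊤ : ℕ∞) : WithTop ℕ∞) := by exact_mod_cast le_top
  have hfd : fderiv ℝ m = fun _ => ℓ := by
    ext1 y
    have : HasFDerivAt m ℓ y := ℓ.hasFDerivAt.sub_const _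
    exact this.fderiv
  have h1 : ‖iteratedFDeriv ℝ (j + 1) (fun y => m y • k y) x‖ ≤
      (j + 1) * ‖ℓ‖ * ‖iteratedFDeriv ℝ j k x‖ := by
    refine (norm_iteratedFDeriv_smul_le hm hk x hle).trans ?_
    rw [Finset.sum_eq_single 1]
    · rw [Nat.choose_one_right, ← norm_iteratedFDeriv_fderiv, hfd, norm_iteratedFDeriv_zero]
      simp
    · intro i _ hi
      rcases i with _ | _ | i
      · simp [m]
      · exact absurd rfl hi
      · rw [← norm_iteratedFDeriv_fderiv, hfd, iteratedFDeriv_const_of_ne (by simp)]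
        simp
    · simp
  have h2 : iteratedFDeriv ℝ (j + 1) (fun y => ℓ y • k y) x =
      iteratedFDeriv ℝ (j + 1) (fun y => m y • k y) x + ℓ x • iteratedFDeriv ℝ (j + 1) k x := by
    have e : (fun y => ℓ y • k y) = (fun y => m y • k y) + ℓ x • k := by
      ext1 y
      simp [m, sub_smul]
    have e2 := iteratedFDeriv_add_apply (i := j + 1) (x := x) (f := fun y => m y • k y)
      (g := ℓ x • k) ((hm.smul hk).of_le hle).contDiffAt
      (ContDiff.of_le (hk.const_smul (ℓ x)) hle).contDiffAt
    rw [e, e2, iteratedFDeriv_const_smul_apply (hk.of_le hle).contDiffAt]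
  have h3 : ‖ℓ x • iteratedFDeriv ℝ (j + 1) k x‖ ≤
      ‖iteratedFDeriv ℝ (j + 1) (fun y => ℓ y • k y) x‖ +
        ‖iteratedFDeriv ℝ (j + 1) (fun y => m y • k y) x‖ := by
    rw [show ℓ x • iteratedFDeriv ℝ (j + 1) k x = iteratedFDeriv ℝ (j + 1) (fun y => ℓ y • k y) x -
      iteratedFDeriv ℝ (j + 1) (fun y => m y • k y) x by rw [h2]; simp]
    exact norm_sub_le _ _
  rw [norm_smul, Real.norm_eq_abs] at h3
  linarith

/-- A Schwartz function that vanishes on the kernel of a linear form is divisible by the form, with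
a Schwartz quotient `∫₀¹ (∂ᵥ h)(x - ℓ(x) v + t ℓ(x) v) dt`, where `ℓ(v) = 1`. -/
theorem exists_schwartz_division (ℓ : V →L[ℝ] ℝ) {v : V} (hv : ℓ v = 1) (h : 𝓢(V, ℂ))
    (h0 : ∀ x, ℓ x = 0 → h x = 0) : ∃ k : 𝓢(V, ℂ), ∀ x, h x = ℓ x • k x := by
  let c : ℝ → ℝ := fun t => max 0 (min t 1)
  have hc : Continuous c := by fun_prop
  have hc0 (t : ℝ) : |c t| ≤ 1 := by
    rw [abs_of_nonneg (le_max_left _ _)]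
    exact max_le zero_le_one (min_le_right _ _)
  let P : V →L[ℝ] V := ContinuousLinearMap.id ℝ V - ℓ.smulRight v
  let A : ℝ → V →L[ℝ] V := fun t => P + c t • ℓ.smulRight v
  have hA : Continuous A := continuous_const.add (hc.smul continuous_const)
  have hAP (t : ℝ) (x : V) : P (A t x) = P x := by
    simp [A, P, hv, map_add, map_sub, map_smul]
  set μ : Measure ℝ := volume.restrict (Set.Icc 0 1)
  set h' : 𝓢(V, ℂ) := SchwartzMap.evalCLM ℝ V ℂ v (SchwartzMap.fderivCLM ℝ V ℂ h) with hh'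
  have hh'x (x : V) : h' x = fderiv ℝ h x v := rfl
  obtain ⟨hk, hdec⟩ := contDiff_average (μ := μ) h' (A := A)
    hA.stronglyMeasurable (B := ‖P‖ + ‖ℓ.smulRight v‖) (fun t => by
      refine (norm_add_le _ _).trans ?_
      gcongr
      rw [norm_smul]
      exact mul_le_of_le_one_left (norm_nonneg _) (hc0 t))
  set k : V → ℂ := fun x => ∫ t, h' (A t x) ∂μ with hkdef
  have hdiv (x : V) : h x = ℓ x • k x := by
    have hd (t : ℝ) : HasDerivAt (fun t : ℝ => h (P x + t • (ℓ x • v)))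
        (ℓ x • h' (P x + t • (ℓ x • v))) t := by
      have h1 : HasDerivAt (fun t : ℝ => P x + t • (ℓ x • v)) (ℓ x • v) t := by
        simpa using ((hasDerivAt_id t).smul_const (ℓ x • v)).const_add (P x)
      have h2 := (h.hasFDerivAt (P x + t • (ℓ x • v))).comp_hasDerivAt t h1
      rw [hh'x, ← map_smul]
      exact h2
    have hcont : Continuous fun t : ℝ => ℓ x • h' (P x + t • (ℓ x • v)) := by
      have := h'.continuous
      fun_prop
    have hftc := intervalIntegral.integral_eq_sub_of_hasDerivAt (a := 0) (b := 1)
      (fun t _ => hd t) (hcont.intervalIntegrable _ _)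
    have e0 : h (P x + (0 : ℝ) • (ℓ x • v)) = 0 := h0 _ (by simp [P, hv])
    have e1 : P x + (1 : ℝ) • (ℓ x • v) = x := by simp [P]
    rw [e0, e1, sub_zero, intervalIntegral.integral_of_le zero_le_one,
      ← integral_Icc_eq_integral_Ioc, integral_smul] at hftc
    rw [← hftc, hkdef]
    congr 1
    refine setIntegral_congr_fun measurableSet_Icc fun t ht => ?_
    have : c t = t := by
      simp only [c]
      rw [min_eq_left ht.2, max_eq_right ht.1]
    simp [A, this]
  have hPdec (p j : ℕ) : ∃ C, ∀ x, ‖P x‖ ^ p * ‖iteratedFDeriv ℝ j k x‖ ≤ C := by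
    obtain ⟨C, hC⟩ := hdec p j
    refine ⟨(‖P‖ + 1) ^ p * C, fun x => ?_⟩
    have hP : 0 < ‖P‖ + 1 := by positivity
    have := hC x (‖P x‖ / (‖P‖ + 1)) (by positivity) (fun t => by
      rw [div_le_iff₀ hP, ← hAP t x, mul_comm]
      exact (P.le_opNorm _).trans (by gcongr; linarith))
    calc _ = (‖P‖ + 1) ^ p * ((‖P x‖ / (‖P‖ + 1)) ^ p * ‖iteratedFDeriv ℝ j k x‖) := by
          rw [div_pow]; field_simp
      _ ≤ _ := by gcongr
  have hℓdec (p : ℕ) : ∀ j, ∃ C, ∀ x, |ℓ x| ^ p * ‖iteratedFDeriv ℝ j k x‖ ≤ C := by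
    induction p with
    | zero => intro j; simpa using hPdec 0 j
    | succ p ih =>
      intro j
      have hℓh (j : ℕ) (x : V) : |ℓ x| ^ p * ‖iteratedFDeriv ℝ j h x‖ ≤
          ‖ℓ‖ ^ p * SchwartzMap.seminorm ℝ p j h := by
        calc _ ≤ (‖ℓ‖ * ‖x‖) ^ p * ‖iteratedFDeriv ℝ j h x‖ := by
              gcongr
              exact ℓ.le_opNorm x
          _ = ‖ℓ‖ ^ p * (‖x‖ ^ p * ‖iteratedFDeriv ℝ j h x‖) := by rw [mul_pow]; ring
          _ ≤ _ := by gcongr; exact h.le_seminorm ℝ p j x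
      cases j with
      | zero =>
        refine ⟨‖ℓ‖ ^ p * SchwartzMap.seminorm ℝ p 0 h, fun x => ?_⟩
        have := hℓh 0 x
        rw [norm_iteratedFDeriv_zero, hdiv x, norm_smul, Real.norm_eq_abs] at this
        rw [norm_iteratedFDeriv_zero, pow_succ, mul_assoc]
        exact this
      | succ j =>
        obtain ⟨C, hC⟩ := ih j
        refine ⟨‖ℓ‖ ^ p * SchwartzMap.seminorm ℝ p (j + 1) h + (j + 1) * ‖ℓ‖ * C, fun x => ?_⟩
        have h1 := abs_mul_norm_iteratedFDeriv_le ℓ hk j x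
        rw [show (fun y => ℓ y • k y) = h from funext fun y => (hdiv y).symm] at h1
        calc _ = |ℓ x| ^ p * (|ℓ x| * ‖iteratedFDeriv ℝ (j + 1) k x‖) := by rw [pow_succ]; ring
          _ ≤ |ℓ x| ^ p * (‖iteratedFDeriv ℝ (j + 1) h x‖ +
              (j + 1) * ‖ℓ‖ * ‖iteratedFDeriv ℝ j k x‖) := by gcongr
          _ = |ℓ x| ^ p * ‖iteratedFDeriv ℝ (j + 1) h x‖ +
              (j + 1) * ‖ℓ‖ * (|ℓ x| ^ p * ‖iteratedFDeriv ℝ j k x‖) := by ring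
          _ ≤ _ := add_le_add (hℓh _ x) (mul_le_mul_of_nonneg_left (hC x) (by positivity))
  refine ⟨⟨k, hk, fun p j => ?_⟩, hdiv⟩
  obtain ⟨C₁, hC₁⟩ := hPdec p j
  obtain ⟨C₂, hC₂⟩ := hℓdec p j
  refine ⟨2 ^ (p - 1) * (C₁ + ‖v‖ ^ p * C₂), fun x => ?_⟩
  have hx : ‖x‖ ≤ ‖P x‖ + |ℓ x| * ‖v‖ := by
    calc ‖x‖ = ‖P x + ℓ x • v‖ := by simp [P]
      _ ≤ _ := (norm_add_le _ _).trans (by rw [norm_smul, Real.norm_eq_abs])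
  calc ‖x‖ ^ p * ‖iteratedFDeriv ℝ j k x‖
      ≤ (‖P x‖ + |ℓ x| * ‖v‖) ^ p * ‖iteratedFDeriv ℝ j k x‖ := by gcongr
    _ ≤ (2 ^ (p - 1) * (‖P x‖ ^ p + (|ℓ x| * ‖v‖) ^ p)) * ‖iteratedFDeriv ℝ j k x‖ := by
        gcongr
        exact add_pow_le (norm_nonneg _) (by positivity) p
    _ = 2 ^ (p - 1) * (‖P x‖ ^ p * ‖iteratedFDeriv ℝ j k x‖ +
        ‖v‖ ^ p * (|ℓ x| ^ p * ‖iteratedFDeriv ℝ j k x‖)) := by rw [mul_pow]; ring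
    _ ≤ _ := by
        gcongr
        · exact hC₁ x
        · exact hC₂ x

end Division

/-! ### Integrals of Schwartz functions against powers of coordinates -/

section Monomial

variable {V : Type*} [NormedAddCommGroup V] [NormedSpace ℝ V] [FiniteDimensional ℝ V]
  [MeasurableSpace V] [BorelSpace V] (μ : Measure V) [μ.IsAddHaarMeasure]

omit [NormedSpace ℝ V] [FiniteDimensional ℝ V] [MeasurableSpace V] [BorelSpace V] in
lemma one_add_norm_pow_le (x : V) (M : ℕ) : (1 + ‖x‖) ^ M ≤ 2 ^ M * (1 + ‖x‖ ^ M) := by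
  have := add_pow_le (zero_le_one (α := ℝ)) (norm_nonneg x) M
  rw [one_pow] at this
  refine this.trans ?_
  gcongr
  · exact one_le_two
  · exact Nat.sub_le _ _

lemma integrable_schwartz_mul {g : V → ℂ} (hg : AEStronglyMeasurable g μ) {C : ℝ} {M : ℕ}
    (h : ∀ x, ‖g x‖ ≤ C * (1 + ‖x‖) ^ M) (f : 𝓢(V, ℂ)) : Integrable (fun x => f x * g x) μ := by
  have hC : 0 ≤ C := by
    have := (norm_nonneg _).trans (h 0)
    simpa using this
  refine Integrable.mono' (g := fun x => C * 2 ^ M * (‖x‖ ^ 0 * ‖f x‖ + ‖x‖ ^ M * ‖f x‖))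
    (((f.integrable_pow_mul μ 0).add (f.integrable_pow_mul μ M)).const_mul _)
    (f.continuous.aestronglyMeasurable.mul hg) (ae_of_all _ fun x => ?_)
  rw [norm_mul, pow_zero, one_mul]
  calc ‖f x‖ * ‖g x‖ ≤ ‖f x‖ * (C * (2 ^ M * (1 + ‖x‖ ^ M))) := by
        gcongr
        exact (h x).trans (by gcongr; exact one_add_norm_pow_le x M)
    _ = _ := by ring

variable {ι : Type*} [Fintype ι] (ℓ : ι → V →L[ℝ] ℝ)

/-- The weight `∏ |ℓᵢ|^(2 aᵢ - 1)`. -/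
noncomputable def weight (a : ι → ℂ) (x : V) : ℂ := ∏ i, ((|ℓ i x| : ℝ) : ℂ) ^ (2 * a i - 1)

/-- The integral of a Schwartz function against the weight `∏ |ℓᵢ|^(2 aᵢ - 1)`. -/
noncomputable def monomialIntegral (f : 𝓢(V, ℂ)) (a : ι → ℂ) : ℂ := ∫ x, f x * weight ℓ a x ∂μ

/-- The integral of a Schwartz function against `∏ |ℓᵢ|^(2 aᵢ - 1) / Γ(aᵢ)`. -/
noncomputable def normalizedIntegral (f : 𝓢(V, ℂ)) (a : ι → ℂ) : ℂ :=
  (∏ i, (Complex.Gamma (a i))⁻¹) * monomialIntegral μ ℓ f a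

omit [FiniteDimensional ℝ V] in
lemma measurable_weight (a : ι → ℂ) : Measurable (weight ℓ a) := by
  unfold weight
  refine Finset.measurable_prod _ fun i _ => Measurable.pow_const ?_ _
  exact Complex.measurable_ofReal.comp (ℓ i).measurable.abs

omit [FiniteDimensional ℝ V] [MeasurableSpace V] [BorelSpace V] in
lemma norm_abs_cpow_le (ℓ : V →L[ℝ] ℝ) {a : ℂ} (ha : 1 / 2 < a.re) (x : V) :
    ‖((|ℓ x| : ℝ) : ℂ) ^ (2 * a - 1)‖ ≤
      (1 + ‖ℓ‖) ^ ⌈2 * a.re⌉₊ * (1 + ‖x‖) ^ ⌈2 * a.re⌉₊ := by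
  have hre : (2 * a - 1).re = 2 * a.re - 1 := by simp
  rw [Complex.norm_cpow_eq_rpow_re_of_nonneg (abs_nonneg _) (by rw [hre]; linarith), hre,
    ← mul_pow]
  have h1 : |ℓ x| ≤ (1 + ‖ℓ‖) * (1 + ‖x‖) := by
    have := ℓ.le_opNorm x
    rw [Real.norm_eq_abs] at this
    nlinarith [norm_nonneg x, norm_nonneg ℓ]
  have h2 : 1 ≤ (1 + ‖ℓ‖) * (1 + ‖x‖) := by nlinarith [norm_nonneg x, norm_nonneg ℓ]
  calc |ℓ x| ^ (2 * a.re - 1) ≤ ((1 + ‖ℓ‖) * (1 + ‖x‖)) ^ (2 * a.re - 1) :=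
        Real.rpow_le_rpow (abs_nonneg _) h1 (by linarith)
    _ ≤ ((1 + ‖ℓ‖) * (1 + ‖x‖)) ^ ((⌈2 * a.re⌉₊ : ℕ) : ℝ) :=
        Real.rpow_le_rpow_of_exponent_le h2 (by linarith [Nat.le_ceil (2 * a.re)])
    _ = _ := Real.rpow_natCast _ _

omit [FiniteDimensional ℝ V] [MeasurableSpace V] [BorelSpace V] in
lemma exists_norm_weight_le {a : ι → ℂ} (ha : ∀ i, 1 / 2 < (a i).re) :
    ∃ (C : ℝ) (M : ℕ), ∀ x, ‖weight ℓ a x‖ ≤ C * (1 + ‖x‖) ^ M := by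
  refine ⟨∏ i, (1 + ‖ℓ i‖) ^ ⌈2 * (a i).re⌉₊, ∑ i, ⌈2 * (a i).re⌉₊, fun x => ?_⟩
  rw [weight, norm_prod, ← Finset.prod_pow_eq_pow_sum, ← Finset.prod_mul_distrib]
  exact Finset.prod_le_prod (fun i _ => norm_nonneg _) fun i _ => norm_abs_cpow_le (ℓ i) (ha i) x

lemma integrable_mul_weight {a : ι → ℂ} (ha : ∀ i, 1 / 2 < (a i).re) (f : 𝓢(V, ℂ)) :
    Integrable (fun x => f x * weight ℓ a x) μ := by
  obtain ⟨C, M, h⟩ := exists_norm_weight_le ℓ ha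
  exact integrable_schwartz_mul μ (measurable_weight ℓ a).aestronglyMeasurable h f

lemma hasDerivAt_mul_abs_cpow {a : ℂ} (ha : 1 < a.re) (t : ℝ) :
    HasDerivAt (fun t : ℝ => (t : ℂ) * ((|t| : ℝ) : ℂ) ^ (2 * a - 1))
      (2 * a * ((|t| : ℝ) : ℂ) ^ (2 * a - 1)) t := by
  have hre : (2 * a - 1).re = 2 * a.re - 1 := by simp
  have ha0 : 2 * a ≠ 0 := by
    intro h
    have := congrArg Complex.re h
    simp at this
    linarith
  have hpos (t : ℝ) (ht : 0 < t) : HasDerivAt (fun t : ℝ => (t : ℂ) ^ (2 * a))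
      (2 * a * (t : ℂ) ^ (2 * a - 1)) t := by
    simpa using hasDerivAt_ofReal_cpow_const ht.ne' ha0
  have hmul (t : ℝ) (ht : 0 < t) : (t : ℂ) ^ (2 * a) = t * (t : ℂ) ^ (2 * a - 1) := by
    rw [Complex.cpow_sub _ _ (by exact_mod_cast ht.ne'), Complex.cpow_one]
    have : (t : ℂ) ≠ 0 := by exact_mod_cast ht.ne'
    field_simp
  rcases lt_trichotomy t 0 with ht | rfl | ht
  · have h1 := ((hpos (-t) (by linarith)).scomp t (hasDerivAt_neg t)).neg
    rw [abs_of_neg ht]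
    have h2 : HasDerivAt (fun t : ℝ => (t : ℂ) * ((|t| : ℝ) : ℂ) ^ (2 * a - 1))
        (-((-1 : ℝ) • (2 * a * ((-t : ℝ) : ℂ) ^ (2 * a - 1)))) t := by
      refine h1.congr_of_eventuallyEq ?_
      filter_upwards [Iio_mem_nhds ht] with y hy
      have hy' : 0 < -y := by simpa using hy
      simp only [Pi.neg_apply, Function.comp_apply, hmul (-y) hy']
      rw [abs_of_neg hy]
      push_cast
      ring
    simpa using h2
  · have hz : ((|(0 : ℝ)| : ℝ) : ℂ) ^ (2 * a - 1) = 0 := by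
      rw [abs_zero, Complex.ofReal_zero, Complex.zero_cpow]
      intro h
      rw [h] at hre
      simp at hre
      linarith
    rw [hz, mul_zero, hasDerivAt_iff_tendsto_slope]
    have hc : ContinuousAt (fun t : ℝ => ((|t| : ℝ) : ℂ) ^ (2 * a - 1)) 0 := by
      have h1 := Complex.continuousAt_ofReal_cpow_const |(0 : ℝ)| (2 * a - 1)
        (Or.inl (by rw [hre]; linarith))
      exact ContinuousAt.comp (f := fun t : ℝ => |t|) h1 continuous_abs.continuousAt
    have h0 : Tendsto (fun t : ℝ => ((|t| : ℝ) : ℂ) ^ (2 * a - 1)) (𝓝[≠] 0) (𝓝 0) := by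
      have := hc.tendsto
      rw [hz] at this
      exact this.mono_left nhdsWithin_le_nhds
    refine h0.congr' ?_
    filter_upwards [self_mem_nhdsWithin] with t ht
    have ht' : (t : ℂ) ≠ 0 := by exact_mod_cast ht
    rw [slope_def_module]
    simp only [sub_zero, Complex.ofReal_zero, zero_mul, Complex.real_smul, Complex.ofReal_inv]
    field_simp
  · have h1 := hpos t ht
    rw [abs_of_pos ht]
    refine h1.congr_of_eventuallyEq ?_
    filter_upwards [Ioi_mem_nhds ht] with y hy
    rw [hmul y hy, abs_of_pos hy]

/-- The reflection `x ↦ x - 2 ℓ(x) v` preserves Haar measure. -/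
lemma exists_reflection (ℓ : V →L[ℝ] ℝ) {v : V} (hv : ℓ v = 1) :
    ∃ R : V ≃L[ℝ] V, (∀ x, R x = x - (2 * ℓ x) • v) ∧ MeasurePreserving R μ μ := by
  let R : V →L[ℝ] V := ContinuousLinearMap.id ℝ V - (2 : ℝ) • ℓ.smulRight v
  have hRx (x : V) : R x = x - (2 * ℓ x) • v := by simp [R, smul_smul]
  have hRR (x : V) : R (R x) = x := by
    rw [hRx (R x), hRx x]
    simp only [map_sub, map_smul, hv, smul_eq_mul, mul_one]
    module
  refine ⟨ContinuousLinearEquiv.equivOfInverse R R hRR hRR, hRx, R.continuous.measurable, ?_⟩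
  have hdet : LinearMap.det (R : V →ₗ[ℝ] V) * LinearMap.det (R : V →ₗ[ℝ] V) = 1 := by
    rw [← LinearMap.det_comp, show (R : V →ₗ[ℝ] V) ∘ₗ (R : V →ₗ[ℝ] V) = LinearMap.id from
      LinearMap.ext hRR, LinearMap.det_id]
  have hd0 : LinearMap.det (R : V →ₗ[ℝ] V) ≠ 0 := fun h => by simp [h] at hdet
  have habs : |(LinearMap.det (R : V →ₗ[ℝ] V))⁻¹| = 1 := by
    rw [abs_inv, inv_eq_one]
    rcases mul_self_eq_one_iff.1 hdet with h | h <;> simp [h]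
  have := Measure.map_linearMap_addHaar_eq_smul_addHaar μ hd0
  rw [habs, ENNReal.ofReal_one, one_smul] at this
  exact this

variable [DecidableEq ι]

/-- Raising one exponent. Integrate `f ∏ |ℓⱼ|^(2aⱼ-1)` by parts in the direction `vᵢ`; only the part
of `∂f` that is odd in `ℓᵢ` contributes, and it is divisible by `ℓᵢ`. -/
theorem exists_shift {v : ι → V} (hdual : ∀ i j, ℓ i (v j) = if i = j then 1 else 0)
    (f : 𝓢(V, ℂ)) (i : ι) : ∃ g : 𝓢(V, ℂ), ∀ a : ι → ℂ, (∀ j, 1 < (a j).re) →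
      a i * monomialIntegral μ ℓ f a = monomialIntegral μ ℓ g (a + Pi.single i 1) := by
  have hi : ℓ i (v i) = 1 := by simp [hdual]
  obtain ⟨R, hR, hRμ⟩ := exists_reflection μ (ℓ i) hi
  have hRi (x : V) : ℓ i (R x) = -ℓ i x := by
    rw [hR, map_sub, map_smul, hi, smul_eq_mul]; ring
  have hRj (x : V) (j : ι) (hj : j ≠ i) : ℓ j (R x) = ℓ j x := by
    rw [hR, map_sub, map_smul, hdual, if_neg hj, smul_zero, sub_zero]
  set f' : 𝓢(V, ℂ) := SchwartzMap.evalCLM ℝ V ℂ (v i) (SchwartzMap.fderivCLM ℝ V ℂ f)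
  have hf' (x : V) : f' x = fderiv ℝ f x (v i) := rfl
  set f'R : 𝓢(V, ℂ) := SchwartzMap.compCLMOfContinuousLinearEquiv ℝ R f'
  have hf'R (x : V) : f'R x = f' (R x) := rfl
  obtain ⟨k, hk⟩ := exists_schwartz_division (ℓ i) hi (f' - f'R) (fun x hx => by
    rw [sub_apply, hf'R, hR, hx]
    simp)
  refine ⟨-(1 / 4 : ℂ) • k, fun a ha => ?_⟩
  have ha' : ∀ j, 1 / 2 < (a j).re := fun j => by linarith [ha j]
  set w := weight ℓ a
  set u : V → ℂ := fun x => (ℓ i x : ℂ) * w x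
  have hw (x : V) : w x = ((|ℓ i x| : ℝ) : ℂ) ^ (2 * a i - 1) *
      ∏ j ∈ Finset.univ.erase i, ((|ℓ j x| : ℝ) : ℂ) ^ (2 * a j - 1) :=
    (Finset.mul_prod_erase _ _ (Finset.mem_univ i)).symm
  have hw1 (x : V) : weight ℓ (a + Pi.single i 1) x = (ℓ i x : ℂ) ^ 2 * w x := by
    rw [hw, weight, ← Finset.mul_prod_erase _ _ (Finset.mem_univ i), ← mul_assoc]
    congr 1
    · rw [Pi.add_apply, Pi.single_eq_same]
      have hexp : (2 : ℂ) * (a i + 1) - 1 = 2 + (2 * a i - 1) := by ring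
      rw [hexp]
      by_cases hx : ℓ i x = 0
      · rw [hx, abs_zero, Complex.ofReal_zero, Complex.zero_cpow]
        · simp
        · intro h
          have := congrArg Complex.re h
          simp at this
          linarith [ha i]
      · rw [Complex.cpow_add _ _ (by simpa using hx)]
        congr 1
        rw [show (2 : ℂ) = ((2 : ℕ) : ℂ) by norm_num, Complex.cpow_natCast]
        rw [← Complex.ofReal_pow, ← Complex.ofReal_pow, sq_abs]
    · refine Finset.prod_congr rfl fun j hj => ?_
      rw [Pi.add_apply, Pi.single_eq_of_ne (Finset.ne_of_mem_erase hj), add_zero]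
  have huR (x : V) : u (R x) = -u x := by
    simp only [u, hw, hRi, abs_neg]
    rw [Finset.prod_congr rfl fun j hj => by rw [hRj x j (Finset.ne_of_mem_erase hj)]]
    push_cast
    ring
  have hu_int (h : 𝓢(V, ℂ)) : Integrable (fun x => h x * u x) μ := by
    obtain ⟨C, M, hCM⟩ := exists_norm_weight_le ℓ ha'
    refine integrable_schwartz_mul μ (C := ‖ℓ i‖ * C) (M := M + 1) ?_ (fun x => ?_) h
    · exact ((Complex.measurable_ofReal.comp (ℓ i).measurable).mul
        (measurable_weight ℓ a)).aestronglyMeasurable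
    · rw [norm_mul, Complex.norm_real]
      calc ‖ℓ i x‖ * ‖w x‖ ≤ (‖ℓ i‖ * (1 + ‖x‖)) * (C * (1 + ‖x‖) ^ M) := by
            gcongr
            · exact ((ℓ i).le_opNorm x).trans (by gcongr; linarith)
            · exact hCM x
        _ = _ := by ring
  have hline (x : V) : HasLineDerivAt ℝ u (2 * a i * w x) x (v i) := by
    rw [HasLineDerivAt]
    have h1 : HasDerivAt (fun t : ℝ => ((ℓ i x + t : ℝ) : ℂ) *
        ((|ℓ i x + t| : ℝ) : ℂ) ^ (2 * a i - 1))
        (2 * a i * ((|ℓ i x| : ℝ) : ℂ) ^ (2 * a i - 1)) 0 := by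
      apply HasDerivAt.comp_const_add (f := fun t : ℝ => (t : ℂ) * ((|t| : ℝ) : ℂ) ^ (2 * a i - 1))
      rw [add_zero]
      exact hasDerivAt_mul_abs_cpow (ha i) (ℓ i x)
    have h2 := h1.mul_const (∏ j ∈ Finset.univ.erase i, ((|ℓ j x| : ℝ) : ℂ) ^ (2 * a j - 1))
    rw [mul_assoc, ← hw] at h2
    refine h2.congr_of_eventuallyEq (Eventually.of_forall fun t => ?_)
    simp only [u, hw, map_add, map_smul, hi, smul_eq_mul, mul_one]
    rw [Finset.prod_congr rfl fun j hj => by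
      rw [hdual, if_neg (Finset.ne_of_mem_erase hj), mul_zero, add_zero], mul_assoc]
  have hparts : ∫ x, u x * f' x ∂μ = -∫ x, 2 * a i * w x * f x ∂μ := by
    refine integral_bilinear_hasLineDerivAt_right_eq_neg_left_of_integrable (μ := μ)
      (f := u) (f' := fun x => 2 * a i * w x) (g := f) (g' := f') (v := v i)
      (B := ContinuousLinearMap.mul ℝ ℂ) ?_ ?_ ?_ (fun x _ => hline x) (fun x _ => ?_)
    · refine ((integrable_mul_weight μ ℓ ha' f).const_mul (2 * a i)).congr (ae_of_all _ fun x => ?_)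
      simp only [ContinuousLinearMap.mul_apply', w]; ring
    · refine (hu_int f').congr (ae_of_all _ fun x => ?_)
      simp only [ContinuousLinearMap.mul_apply']; ring
    · refine (hu_int f).congr (ae_of_all _ fun x => ?_)
      simp only [ContinuousLinearMap.mul_apply']; ring
    · exact (f.hasFDerivAt x).hasLineDerivAt (v i)
  have hrefl : ∫ x, u x * f' x ∂μ = -∫ x, u x * f'R x ∂μ := by
    rw [← hRμ.integral_comp R.toHomeomorph.measurableEmbedding, ← integral_neg]
    refine integral_congr_ae (ae_of_all _ fun x => ?_)
    simp only [huR, hf'R]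
    ring
  have hsum : ∫ x, u x * f' x ∂μ - ∫ x, u x * f'R x ∂μ =
      ∫ x, k x * weight ℓ (a + Pi.single i 1) x ∂μ := by
    rw [← integral_sub ((hu_int f').congr (ae_of_all _ fun x => mul_comm _ _))
      ((hu_int f'R).congr (ae_of_all _ fun x => mul_comm _ _))]
    refine integral_congr_ae (ae_of_all _ fun x => ?_)
    have := hk x
    rw [sub_apply] at this
    simp only [hw1]
    rw [← mul_sub, this, Complex.real_smul]
    simp only [u]
    ring
  have hlhs : ∫ x, 2 * a i * w x * f x ∂μ = 2 * (a i * monomialIntegral μ ℓ f a) := by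
    rw [monomialIntegral, ← mul_assoc, ← integral_const_mul]
    refine integral_congr_ae (ae_of_all _ fun x => ?_)
    simp only [w]; ring
  have hrhs : monomialIntegral μ ℓ (-(1 / 4 : ℂ) • k) (a + Pi.single i 1) =
      -(1 / 4) * ∫ x, k x * weight ℓ (a + Pi.single i 1) x ∂μ := by
    rw [monomialIntegral, ← integral_const_mul]
    refine integral_congr_ae (ae_of_all _ fun x => ?_)
    simp only [smul_apply, smul_eq_mul]; ring
  rw [hrhs, ← hsum]
  linear_combination (-1 / 4 : ℂ) * hrefl - (1 / 2 : ℂ) * hlhs + (1 / 2 : ℂ) * hparts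

theorem exists_normalized_shift_single {v : ι → V}
    (hdual : ∀ i j, ℓ i (v j) = if i = j then 1 else 0) (f : 𝓢(V, ℂ)) (i : ι) :
    ∃ g : 𝓢(V, ℂ), ∀ a : ι → ℂ, (∀ j, 1 < (a j).re) →
      normalizedIntegral μ ℓ f a = normalizedIntegral μ ℓ g (a + Pi.single i 1) := by
  obtain ⟨g, hg⟩ := exists_shift μ ℓ hdual f i
  refine ⟨g, fun a ha => ?_⟩
  have hai : a i ≠ 0 := fun h => by have := ha i; simp [h] at this; linarith
  rw [normalizedIntegral, normalizedIntegral, ← hg a ha,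
    ← Finset.mul_prod_erase Finset.univ (fun j => (Complex.Gamma (a j))⁻¹) (Finset.mem_univ i),
    ← Finset.mul_prod_erase Finset.univ
      (fun j => (Complex.Gamma ((a + (Pi.single i 1 : ι → ℂ)) j))⁻¹) (Finset.mem_univ i)]
  have hrest : ∏ j ∈ Finset.univ.erase i, (Complex.Gamma ((a + (Pi.single i 1 : ι → ℂ)) j))⁻¹ =
      ∏ j ∈ Finset.univ.erase i, (Complex.Gamma (a j))⁻¹ :=
    Finset.prod_congr rfl fun j hj => by
      rw [Pi.add_apply, Pi.single_eq_of_ne (Finset.ne_of_mem_erase hj), add_zero]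
  rw [hrest, Pi.add_apply, Pi.single_eq_same, Complex.Gamma_add_one _ hai]
  field_simp

/-- All the exponents can be raised by `N` at once, one unit and one exponent at a time. -/
theorem exists_normalized_shift {v : ι → V}
    (hdual : ∀ i j, ℓ i (v j) = if i = j then 1 else 0) (f : 𝓢(V, ℂ)) (N : ℕ) :
    ∃ g : 𝓢(V, ℂ), ∀ a : ι → ℂ, (∀ j, 1 < (a j).re) →
      normalizedIntegral μ ℓ f a = normalizedIntegral μ ℓ g (fun i => a i + N) := by
  have hsingle (f : 𝓢(V, ℂ)) (S : Finset ι) : ∃ g : 𝓢(V, ℂ), ∀ a : ι → ℂ, (∀ j, 1 < (a j).re) →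
      normalizedIntegral μ ℓ f a = normalizedIntegral μ ℓ g (a + ∑ i ∈ S, Pi.single i 1) := by
    induction S using Finset.induction_on generalizing f with
    | empty => exact ⟨f, fun a _ => by simp⟩
    | insert i S hi ih =>
      obtain ⟨g, hg⟩ := exists_normalized_shift_single μ ℓ hdual f i
      obtain ⟨k, hk⟩ := ih g
      refine ⟨k, fun a ha => ?_⟩
      rw [hg a ha, hk _ fun j => ?_, Finset.sum_insert hi, add_assoc]
      rw [Pi.add_apply, Complex.add_re]
      have : 0 ≤ (Pi.single (M := fun _ => ℂ) i 1 j).re := by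
        rcases eq_or_ne j i with rfl | h <;> simp [*]
      linarith [ha j]
  induction N generalizing f with
  | zero => exact ⟨f, fun a _ => by simp⟩
  | succ N ih =>
    obtain ⟨g, hg⟩ := hsingle f Finset.univ
    obtain ⟨k, hk⟩ := ih g
    refine ⟨k, fun a ha => ?_⟩
    have he : a + ∑ i, Pi.single i 1 = fun i => a i + 1 := by
      ext i
      rw [Pi.add_apply, Finset.sum_apply, Finset.sum_pi_single, if_pos (Finset.mem_univ i)]
    rw [hg a ha, he, hk _ fun j => ?_]
    · congr 1
      ext i
      push_cast
      ring
    · simp only [Complex.add_re, Complex.one_re]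
      linarith [ha j]

omit [DecidableEq ι] in
lemma differentiableOn_monomialIntegral (hne : ∀ i, ℓ i ≠ 0) (f : 𝓢(V, ℂ)) (α β γ : ι → ℝ)
    {S : Set (ℂ × ℂ)} (hS : IsOpen S)
    (h : ∀ s ∈ S, ∀ i, 1 / 2 < α i * s.1.re + β i * s.2.re + γ i) :
    DifferentiableOn ℂ
      (fun s : ℂ × ℂ => monomialIntegral μ ℓ f (fun i => α i * s.1 + β i * s.2 + γ i)) S := by
  have hae : ∀ᵐ x ∂μ, ∀ i, ℓ i x ≠ 0 := by
    rw [ae_all_iff]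
    intro i
    have h0 := Measure.addHaar_submodule μ (LinearMap.ker (ℓ i : V →ₗ[ℝ] ℝ)) (fun htop => hne i (by
      ext x
      have : x ∈ LinearMap.ker (ℓ i : V →ₗ[ℝ] ℝ) := htop ▸ Submodule.mem_top
      simpa using this))
    rw [ae_iff]
    convert h0 using 2
    ext x
    simp
  let G : V → ℂ := fun x => f x * Complex.exp (∑ i, (Real.log |ℓ i x| : ℂ) * (2 * γ i - 1))
  let L₁ : V → ℝ := fun x => ∑ i, 2 * α i * Real.log |ℓ i x|
  let L₂ : V → ℝ := fun x => ∑ i, 2 * β i * Real.log |ℓ i x|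
  have hlog (i : ι) : Measurable fun x => Real.log |ℓ i x| :=
    Real.measurable_log.comp (ℓ i).measurable.abs
  have hL₁ : Measurable L₁ := Finset.measurable_sum _ fun i _ => (hlog i).const_mul _
  have hL₂ : Measurable L₂ := Finset.measurable_sum _ fun i _ => (hlog i).const_mul _
  have key (s : ℂ × ℂ) : (fun x => f x * weight ℓ (fun i => α i * s.1 + β i * s.2 + γ i) x) =ᵐ[μ]
      fun x => G x * Complex.exp (s.1 * L₁ x + s.2 * L₂ x) := by
    filter_upwards [hae] with x hx
    simp only [G, weight, mul_assoc, ← Complex.exp_add]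
    congr 1
    have hfac (i : ι) : ((|ℓ i x| : ℝ) : ℂ) ^ (2 * (α i * s.1 + β i * s.2 + γ i) - 1) =
        Complex.exp ((Real.log |ℓ i x| : ℂ) * (2 * (α i * s.1 + β i * s.2 + γ i) - 1)) := by
      rw [Complex.cpow_def_of_ne_zero (by simpa using hx i), Complex.ofReal_log (abs_nonneg _)]
    simp only [hfac, ← Complex.exp_sum, L₁, L₂]
    congr 1
    push_cast
    rw [Finset.mul_sum, Finset.mul_sum, ← Finset.sum_add_distrib, ← Finset.sum_add_distrib]
    refine Finset.sum_congr rfl fun i _ => ?_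
    ring
  refine (differentiableOn_laplace (μ := μ) (g := G) hL₁.aemeasurable hL₂.aemeasurable hS
    fun s hs => ?_).congr fun s hs => integral_congr_ae (key s)
  refine (integrable_mul_weight μ ℓ (fun i => ?_) f).congr (key s)
  simpa using h s hs i

/-- The integral of a Schwartz function against `∏ |ℓᵢ|^(2 aᵢ - 1) / Γ(aᵢ)` extends to an entire
function, for exponents `aᵢ` depending affinely on `s`. -/
theorem exists_entire_normalizedIntegral {v : ι → V}
    (hdual : ∀ i j, ℓ i (v j) = if i = j then 1 else 0) (f : 𝓢(V, ℂ)) (α β γ : ι → ℝ)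
    (hα : ∀ i, 0 ≤ α i ∧ α i ≤ 1) (hβ : ∀ i, 0 ≤ β i ∧ β i ≤ 1) (hγ : ∀ i, 1 / 2 ≤ γ i)
    (hαβ : ∀ i, 1 ≤ α i + β i) :
    ∃ E : ℂ × ℂ → ℂ, Differentiable ℂ E ∧ ∀ s ∈ tube 1,
      E s = normalizedIntegral μ ℓ f (fun i => α i * s.1 + β i * s.2 + γ i) := by
  refine exists_entire_extension fun N => ?_
  obtain ⟨g, hg⟩ := exists_normalized_shift μ ℓ hdual f (2 * N)
  refine ⟨fun s => normalizedIntegral μ ℓ g (fun i => α i * s.1 + β i * s.2 + γ i + (2 * N : ℕ)),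
    ?_, fun s hs => (hg _ fun j => ?_).symm⟩
  · refine DifferentiableOn.mul (Differentiable.differentiableOn ?_) ?_
    · refine differentiable_finset_prod Finset.univ fun i _ => ?_
      refine Complex.differentiable_one_div_Gamma.comp ?_
      fun_prop
    · have hne (i : ι) : ℓ i ≠ 0 := fun h => by simpa [h] using hdual i i
      refine (differentiableOn_monomialIntegral μ ℓ hne g α β (fun i => γ i + (2 * N : ℕ))
        (isOpen_tube _) fun s hs i => ?_).congr fun s _ => ?_
      · have h1 : α i * -(N : ℝ) ≤ α i * s.1.re := mul_le_mul_of_nonneg_left hs.1.le (hα i).1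
        have h2 : β i * -(N : ℝ) ≤ β i * s.2.re := mul_le_mul_of_nonneg_left hs.2.le (hβ i).1
        have h3 : α i * (N : ℝ) ≤ 1 * N := mul_le_mul_of_nonneg_right (hα i).2 N.cast_nonneg
        have h4 : β i * (N : ℝ) ≤ 1 * N := mul_le_mul_of_nonneg_right (hβ i).2 N.cast_nonneg
        -- one of `α i`, `β i` is positive, so one of the four inequalities is strict
        rcases (hα i).1.lt_or_eq with h | h
        · have h1 : α i * -(N : ℝ) < α i * s.1.re := mul_lt_mul_of_pos_left hs.1 h
          push_cast
          linarith [hγ i]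
        · have h2 : β i * -(N : ℝ) < β i * s.2.re :=
            mul_lt_mul_of_pos_left hs.2 (by linarith [hαβ i])
          push_cast
          linarith [hγ i]
      · congr 1
        ext i
        push_cast
        ring
  · have h1 : α j * 1 ≤ α j * s.1.re := mul_le_mul_of_nonneg_left hs.1.le (hα j).1
    have h2 : β j * 1 ≤ β j * s.2.re := mul_le_mul_of_nonneg_left hs.2.le (hβ j).1
    simp only [Complex.add_re, Complex.re_ofReal_mul, Complex.ofReal_re]
    linarith [hγ j, hαβ j]

end Monomial

/-! ### Triangular coordinates -/

/-- The positions on and above the diagonal. They index both the coordinates of symmetric matrices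
and those of upper triangular ones. -/
abbrev UpperIndex (n : ℕ) : Type := {p : Fin n × Fin n // p.1 ≤ p.2}

/-- The `i`-th diagonal position. -/
def diagIdx {n : ℕ} (i : Fin n) : UpperIndex n := ⟨(i, i), le_rfl⟩

/-- The upper triangular matrix with prescribed entries. -/
def triMat {n : ℕ} (x : UpperIndex n → ℝ) : Matrix (Fin n) (Fin n) ℝ :=
  Matrix.of fun i j => if h : i ≤ j then x ⟨(i, j), h⟩ else 0

/-- The entries of a matrix on and above the diagonal. -/
def upperPart {n : ℕ} (M : Matrix (Fin n) (Fin n) ℝ) : UpperIndex n → ℝ := fun p => M p.1.1 p.1.2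

lemma symOfCoord_apply {n : ℕ} (x : UpperIndex n → ℝ) (i j : Fin n) :
    (symOfCoord x : Matrix (Fin n) (Fin n) ℝ) i j = x ⟨(min i j, max i j), min_le_max⟩ := rfl

lemma symOfCoord_apply_of_le {n : ℕ} (x : UpperIndex n → ℝ) {i j : Fin n} (h : i ≤ j) :
    (symOfCoord x : Matrix (Fin n) (Fin n) ℝ) i j = x ⟨(i, j), h⟩ := by
  rw [symOfCoord_apply]
  congr 1
  simp [h]

lemma symOfCoord_upperPart {n : ℕ} {M : Matrix (Fin n) (Fin n) ℝ} (hM : M.IsSymm) :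
    (symOfCoord (upperPart M) : Matrix (Fin n) (Fin n) ℝ) = M := by
  ext i j
  rw [symOfCoord_apply, upperPart]
  rcases le_total i j with h | h
  · simp [h]
  · simp [h, hM.apply]

lemma isSymm_symOfCoord {n : ℕ} (x : UpperIndex n → ℝ) :
    (symOfCoord x : Matrix (Fin n) (Fin n) ℝ).IsSymm := (symOfCoord x).2

lemma upperPart_symOfCoord {n : ℕ} (x : UpperIndex n → ℝ) :
    upperPart (symOfCoord x : Matrix (Fin n) (Fin n) ℝ) = x := by
  ext ⟨⟨i, j⟩, h⟩
  exact symOfCoord_apply_of_le x h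

lemma blockTriangular_triMat {n : ℕ} (x : UpperIndex n → ℝ) :
    (triMat x).BlockTriangular id := by
  intro i j h
  simp only [triMat, Matrix.of_apply]
  exact dif_neg (not_le.2 h)

lemma det_triMat {n : ℕ} (x : UpperIndex n → ℝ) : (triMat x).det = ∏ i, x (diagIdx i) := by
  rw [Matrix.det_of_isUpperTriangular (blockTriangular_triMat x)]
  refine Finset.prod_congr rfl fun i _ => ?_
  simp [triMat, diagIdx]

/-- The positions on and above the diagonal are those in the top row and those in the complementary
minor. -/
noncomputable def upperIndexEquiv (n : ℕ) : Fin (n + 1) ⊕ UpperIndex n ≃ UpperIndex (n + 1) :=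
  Equiv.ofBijective
    (Sum.elim (fun j => ⟨(0, j), Fin.zero_le j⟩)
      (fun p => ⟨(p.1.1.succ, p.1.2.succ), Fin.succ_le_succ_iff.2 p.2⟩)) (by
    constructor
    · rintro (i | ⟨⟨i, j⟩, h⟩) (i' | ⟨⟨i', j'⟩, h'⟩) he
      · simpa using he
      · simp at he
        exact absurd he.1.symm (Fin.succ_ne_zero _)
      · simp at he
      · simpa using he
    · rintro ⟨⟨i, j⟩, h⟩
      refine Fin.cases (fun h => ⟨Sum.inl j, rfl⟩) (fun i h => ?_) i h
      obtain ⟨j, rfl⟩ : ∃ j', j = Fin.succ j' :=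
        Fin.exists_succ_eq.2 (fun h0 => by
          rw [h0] at h
          exact absurd (Fin.le_zero_iff.1 h) (Fin.succ_ne_zero _)) |>.imp fun _ h => h.symm
      exact ⟨Sum.inr ⟨(i, j), Fin.succ_le_succ_iff.1 h⟩, rfl⟩)

/-- Upper triangular coordinates of size `n + 1` from the corner entry, the rest of the top row,
and the complementary minor. -/
noncomputable def glue {n : ℕ} (a : ℝ) (u : Fin n → ℝ) (z : UpperIndex n → ℝ) :
    UpperIndex (n + 1) → ℝ :=
  fun p => Sum.elim (Fin.cons a u : Fin (n + 1) → ℝ) z ((upperIndexEquiv n).symm p)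

section Glue

variable {n : ℕ} (a : ℝ) (u : Fin n → ℝ) (z : UpperIndex n → ℝ)

lemma glue_top (j : Fin (n + 1)) (h : (0 : Fin (n + 1)) ≤ j) :
    glue a u z ⟨(0, j), h⟩ = (Fin.cons a u : Fin (n + 1) → ℝ) j := by
  have : (⟨(0, j), h⟩ : UpperIndex (n + 1)) = upperIndexEquiv n (Sum.inl j) := rfl
  rw [glue, this, Equiv.symm_apply_apply]
  rfl

lemma glue_minor (i j : Fin n) (h : i.succ ≤ j.succ) :
    glue a u z ⟨(i.succ, j.succ), h⟩ = z ⟨(i, j), Fin.succ_le_succ_iff.1 h⟩ := by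
  have : (⟨(i.succ, j.succ), h⟩ : UpperIndex (n + 1)) =
    upperIndexEquiv n (Sum.inr ⟨(i, j), Fin.succ_le_succ_iff.1 h⟩) := rfl
  rw [glue, this, Equiv.symm_apply_apply]
  rfl

lemma glue_diagIdx_zero : glue a u z (diagIdx 0) = a := glue_top a u z 0 le_rfl

lemma glue_diagIdx_succ (i : Fin n) : glue a u z (diagIdx i.succ) = z (diagIdx i) :=
  glue_minor a u z i i le_rfl

lemma triMat_glue_zero_zero : triMat (glue a u z) 0 0 = a := by
  simp [triMat, glue_top]

lemma triMat_glue_zero_succ (j : Fin n) : triMat (glue a u z) 0 j.succ = u j := by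
  simp [triMat, glue_top]

lemma triMat_glue_succ_zero (i : Fin n) : triMat (glue a u z) i.succ 0 = 0 := by
  simp [triMat]

lemma triMat_glue_succ_succ (i j : Fin n) :
    triMat (glue a u z) i.succ j.succ = triMat z i j := by
  simp [triMat, glue_minor]

lemma symOfCoord_glue_zero_zero :
    (symOfCoord (glue a u z) : Matrix (Fin (n + 1)) (Fin (n + 1)) ℝ) 0 0 = a := by
  rw [symOfCoord_apply_of_le _ le_rfl, glue_top, Fin.cons_zero]

lemma symOfCoord_glue_zero_succ (j : Fin n) :
    (symOfCoord (glue a u z) : Matrix (Fin (n + 1)) (Fin (n + 1)) ℝ) 0 j.succ = u j := by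
  rw [symOfCoord_apply_of_le _ (Fin.zero_le _), glue_top, Fin.cons_succ]

lemma symOfCoord_glue_succ_zero (j : Fin n) :
    (symOfCoord (glue a u z) : Matrix (Fin (n + 1)) (Fin (n + 1)) ℝ) j.succ 0 = u j := by
  rw [← symOfCoord_glue_zero_succ a u z j]
  exact (isSymm_symOfCoord (glue a u z)).apply _ _

lemma symOfCoord_glue_succ_succ (i j : Fin n) :
    (symOfCoord (glue a u z) : Matrix (Fin (n + 1)) (Fin (n + 1)) ℝ) i.succ j.succ =
      (symOfCoord z : Matrix (Fin n) (Fin n) ℝ) i j := by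
  wlog h : i ≤ j generalizing i j
  · rw [← (isSymm_symOfCoord z).apply, ← (isSymm_symOfCoord (glue a u z)).apply]
    exact this j i (le_of_not_ge h)
  rw [symOfCoord_apply_of_le _ (Fin.succ_le_succ_iff.2 h), glue_minor, symOfCoord_apply_of_le _ h]

end Glue

lemma measurable_glue {n : ℕ} :
    Measurable fun q : (UpperIndex n → ℝ) × (Fin n → ℝ) × ℝ => glue q.2.2 q.2.1 q.1 := by
  refine measurable_pi_lambda _ fun p => ?_
  obtain ⟨p, rfl⟩ := (upperIndexEquiv n).surjective p
  simp only [glue, Equiv.symm_apply_apply]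
  rcases p with j | p
  · refine Fin.cases ?_ (fun j => ?_) j
    · simpa using measurable_snd.snd
    · exact (measurable_pi_apply j).comp measurable_snd.fst
  · exact (measurable_pi_apply p).comp measurable_fst

theorem lintegral_glue {n : ℕ} {f : (UpperIndex (n + 1) → ℝ) → ENNReal} (hf : Measurable f) :
    ∫⁻ x, f x = ∫⁻ z, ∫⁻ u, ∫⁻ a, f (glue a u z) := by
  have h1 := volume_measurePreserving_piCongrLeft (fun _ : UpperIndex (n + 1) => ℝ)
    (upperIndexEquiv n)
  have h2 := volume_measurePreserving_sumPiEquivProdPi_symm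
    (fun _ : Fin (n + 1) ⊕ UpperIndex n => ℝ)
  have h3 := (volume_preserving_piFinSuccAbove (fun _ : Fin (n + 1) => ℝ) 0).symm
  have h12 := h1.comp h2
  refine (h12.lintegral_comp hf).symm.trans ((lintegral_prod_symm (μ := volume) (ν := volume) _
    (hf.comp h12.measurable).aemeasurable).trans ?_)
  refine lintegral_congr fun z => ?_
  have hm : Measurable fun y : Fin (n + 1) → ℝ => f ((MeasurableEquiv.piCongrLeft
      (fun _ : UpperIndex (n + 1) => ℝ) (upperIndexEquiv n) ∘ (MeasurableEquiv.sumPiEquivProdPi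
      fun _ : Fin (n + 1) ⊕ UpperIndex n => ℝ).symm) (y, z)) :=
    (hf.comp h12.measurable).comp (measurable_id.prodMk measurable_const)
  refine (h3.lintegral_comp hm).symm.trans ((lintegral_prod_symm (μ := volume) (ν := volume) _
    (hm.comp h3.measurable).aemeasurable).trans ?_)
  refine lintegral_congr fun u => lintegral_congr fun a => ?_
  refine congrArg f (funext fun p => ?_)
  obtain ⟨p, rfl⟩ := (upperIndexEquiv n).surjective p
  rw [Function.comp_apply, MeasurableEquiv.coe_piCongrLeft, Equiv.piCongrLeft_apply_apply, glue,
    Equiv.symm_apply_apply]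
  rcases p with j | p
  · refine Fin.cases ?_ (fun j => ?_) j
    · rfl
    · rfl
  · rfl

/-! ### Cholesky decomposition -/

/-- Substitution `ζ = c + τ²` on the half-line `ζ > c`, with `τ` of either sign. -/
lemma lintegral_Ioi_eq_lintegral_sq {F : ℝ → ENNReal} (hF : Measurable F) (c : ℝ) :
    ∫⁻ ζ in Set.Ioi c, F ζ = ∫⁻ τ, ENNReal.ofReal |τ| * F (c + τ ^ 2) := by
  have himg : (fun τ : ℝ => c + τ ^ 2) '' Set.Ioi 0 = Set.Ioi c := by
    ext ζ
    constructor
    · rintro ⟨τ, hτ, rfl⟩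
      have : 0 < τ ^ 2 := pow_pos hτ 2
      simpa using this
    · intro hζ
      have : 0 < ζ - c := sub_pos.2 hζ
      exact ⟨Real.sqrt (ζ - c), Real.sqrt_pos.2 this, by
        simp only [Real.sq_sqrt this.le]; ring⟩
  have hinj : Set.InjOn (fun τ : ℝ => c + τ ^ 2) (Set.Ioi 0) := by
    intro a ha b hb h
    have : a ^ 2 = b ^ 2 := by simpa using h
    exact (pow_left_inj₀ (le_of_lt ha) (le_of_lt hb) two_ne_zero).1 this
  have h1 := lintegral_image_eq_lintegral_abs_deriv_mul (f := fun τ : ℝ => c + τ ^ 2)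
    (f' := fun τ => 2 * τ) (measurableSet_Ioi (a := (0 : ℝ)))
    (fun x _ => by
      have := ((hasDerivAt_pow 2 x).const_add c).hasDerivWithinAt (s := Set.Ioi 0)
      simpa using this) hinj F
  rw [himg] at h1
  set G : ℝ → ENNReal := fun τ => ENNReal.ofReal |τ| * F (c + τ ^ 2)
  have hG : Measurable G := by
    refine Measurable.mul (by fun_prop) (hF.comp (by fun_prop))
  have h2 : ∫⁻ ζ in Set.Ioi c, F ζ = 2 * ∫⁻ τ in Set.Ioi 0, G τ := by
    rw [h1, ← lintegral_const_mul _ hG]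
    refine lintegral_congr fun τ => ?_
    rw [abs_mul, ENNReal.ofReal_mul (by positivity), mul_assoc]
    simp [G]
  have h3 : ∫⁻ τ in Set.Iio 0, G τ = ∫⁻ τ in Set.Ioi 0, G τ := by
    have hneg := (Measure.measurePreserving_neg (volume : Measure ℝ)).restrict_preimage
      (measurableSet_Iio (a := (0 : ℝ)))
    have := hneg.lintegral_comp hG
    rw [← this]
    have hs : (Neg.neg ⁻¹' Set.Iio 0 : Set ℝ) = Set.Ioi 0 := by ext; simp
    rw [hs]
    refine lintegral_congr fun τ => ?_
    simp [G]
  have h4 : ∫⁻ τ, G τ = (∫⁻ τ in Set.Iio 0, G τ) + ∫⁻ τ in Set.Ioi 0, G τ := by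
    rw [← lintegral_add_compl G (measurableSet_Iio (a := (0 : ℝ))), Set.compl_Iio,
      setLIntegral_congr Ioi_ae_eq_Ici.symm]
  rw [h2, h4, h3, two_mul]

/-- Substitution by an invertible matrix. -/
lemma lintegral_mulVec {n : ℕ} {M : Matrix (Fin n) (Fin n) ℝ} (hM : M.det ≠ 0)
    {F : (Fin n → ℝ) → ENNReal} (hF : Measurable F) :
    ∫⁻ w, F w = ENNReal.ofReal |M.det| * ∫⁻ x, F (M.mulVec x) := by
  have h := Real.map_matrix_volume_pi_eq_smul_volume_pi hM
  have hm : Measurable (Matrix.toLin' M) :=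
    (Matrix.toLin' M).continuous_of_finiteDimensional.measurable
  have h2 : ∫⁻ x, F (M.mulVec x) = ∫⁻ w, F w ∂(Measure.map (Matrix.toLin' M) volume) := by
    rw [lintegral_map hF hm]
    rfl
  rw [h2, h, lintegral_smul_measure, smul_eq_mul, ← mul_assoc, ← ENNReal.ofReal_mul (abs_nonneg _),
    ← abs_mul, mul_inv_cancel₀ hM]
  simp

lemma measurableSet_posDef (n : ℕ) :
    MeasurableSet {x : UpperIndex n → ℝ | (symOfCoord x : Matrix (Fin n) (Fin n) ℝ).PosDef} := by
  have hc : Continuous fun x : UpperIndex n → ℝ => (symOfCoord x : Matrix (Fin n) (Fin n) ℝ) :=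
    continuous_matrix fun i j => continuous_apply _
  have : {x : UpperIndex n → ℝ | (symOfCoord x : Matrix (Fin n) (Fin n) ℝ).PosDef} =
      {x | ∀ v : Fin n → ℝ, 0 ≤ v ⬝ᵥ (symOfCoord x : Matrix (Fin n) (Fin n) ℝ).mulVec v} ∩
        {x | (symOfCoord x : Matrix (Fin n) (Fin n) ℝ).det ≠ 0} := by
    ext x
    constructor
    · intro h
      exact ⟨fun v => by simpa using h.posSemidef.dotProduct_mulVec_nonneg v, h.det_pos.ne'⟩
    · rintro ⟨h1, h2⟩
      have : (symOfCoord x : Matrix (Fin n) (Fin n) ℝ).PosSemidef :=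
        Matrix.PosSemidef.of_dotProduct_mulVec_nonneg
          (by rw [Matrix.IsHermitian, Matrix.conjTranspose_eq_transpose_of_trivial]
              exact isSymm_symOfCoord x) (by simpa using h1)
      exact this.posDef_iff_det_ne_zero.2 h2
  rw [this]
  refine MeasurableSet.inter (IsClosed.measurableSet ?_) (IsOpen.measurableSet ?_)
  · rw [Set.ofPred_forall]
    exact isClosed_iInter fun v => isClosed_le continuous_const
      (continuous_const.dotProduct (hc.matrix_mulVec continuous_const))
  · exact isOpen_ne_fun hc.matrix_det continuous_const

lemma posDef_of_glue {n : ℕ} {a : ℝ} {u : Fin n → ℝ} {z : UpperIndex n → ℝ}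
    (h : (symOfCoord (glue a u z) : Matrix (Fin (n + 1)) (Fin (n + 1)) ℝ).PosDef) :
    (symOfCoord z : Matrix (Fin n) (Fin n) ℝ).PosDef := by
  have := h.submatrix (Fin.succ_injective n)
  convert this using 1
  ext i j
  exact (symOfCoord_glue_succ_succ a u z i j).symm

/-- Elimination of the last `n` variables from a bordered symmetric matrix whose lower right block
is `t tᵀ`; the number `δ` is the Schur complement of that block. -/
lemma symOfCoord_glue_eq_conj {n : ℕ} (δ : ℝ) (x : Fin n → ℝ) (t : UpperIndex n → ℝ) :
    (symOfCoord (glue (x ⬝ᵥ x + δ) ((triMat t).mulVec x)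
      (upperPart (triMat t * (triMat t).transpose)))
      : Matrix (Fin (n + 1)) (Fin (n + 1)) ℝ) =
      triMat (glue 1 x t) * Matrix.diagonal (Fin.cons δ fun _ => 1 : Fin (n + 1) → ℝ) *
        (triMat (glue 1 x t)).transpose := by
  ext i j
  refine Fin.cases ?_ (fun i => ?_) i <;> refine Fin.cases ?_ (fun j => ?_) j
  · rw [symOfCoord_glue_zero_zero]
    rw [Matrix.mul_apply]
    simp [Matrix.mul_diagonal, Fin.sum_univ_succ, triMat_glue_zero_zero,
      triMat_glue_zero_succ, dotProduct, add_comm]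
  · rw [symOfCoord_glue_zero_succ]
    rw [Matrix.mul_apply]
    simp [Matrix.mul_diagonal, Fin.sum_univ_succ, triMat_glue_zero_zero,
      triMat_glue_zero_succ, triMat_glue_succ_succ, triMat_glue_succ_zero, dotProduct,
      Matrix.mulVec, mul_comm]
  · rw [symOfCoord_glue_succ_zero]
    rw [Matrix.mul_apply]
    simp [Matrix.mul_diagonal, Fin.sum_univ_succ, triMat_glue_zero_zero,
      triMat_glue_zero_succ, triMat_glue_succ_succ, triMat_glue_succ_zero, dotProduct,
      Matrix.mulVec]
  · rw [symOfCoord_glue_succ_succ, symOfCoord_upperPart (Matrix.isSymm_mul_transpose_self _)]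
    rw [Matrix.mul_apply, Matrix.mul_apply]
    simp [Matrix.mul_diagonal, Fin.sum_univ_succ,
      triMat_glue_succ_succ, triMat_glue_succ_zero]

/-- Positive definiteness of a bordered matrix in terms of the Schur complement `δ`. -/
lemma posDef_glue_iff {n : ℕ} (δ : ℝ) (x : Fin n → ℝ) (t : UpperIndex n → ℝ)
    (ht : (triMat t).det ≠ 0) :
    (symOfCoord (glue (x ⬝ᵥ x + δ) ((triMat t).mulVec x)
      (upperPart (triMat t * (triMat t).transpose)))
      : Matrix (Fin (n + 1)) (Fin (n + 1)) ℝ).PosDef ↔ 0 < δ := by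
  have hU : IsUnit (triMat (glue 1 x t)) := by
    rw [Matrix.isUnit_iff_isUnit_det, isUnit_iff_ne_zero, det_triMat, Fin.prod_univ_succ,
      glue_diagIdx_zero, one_mul]
    rw [det_triMat] at ht
    simpa only [glue_diagIdx_succ] using ht
  rw [symOfCoord_glue_eq_conj, ← Matrix.conjTranspose_eq_transpose_of_trivial,
    ← Matrix.star_eq_conjTranspose, Matrix.IsUnit.posDef_star_right_conjugate_iff hU,
    Matrix.posDef_diagonal_iff]
  refine ⟨fun h => h 0, fun h i => ?_⟩
  refine Fin.cases h (fun i => ?_) i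
  simp

lemma upperPart_triMat_glue {n : ℕ} (τ : ℝ) (x : Fin n → ℝ) (t : UpperIndex n → ℝ) :
    upperPart (triMat (glue τ x t) * (triMat (glue τ x t)).transpose) =
      glue (x ⬝ᵥ x + τ ^ 2) ((triMat t).mulVec x)
        (upperPart (triMat t * (triMat t).transpose)) := by
  ext ⟨⟨i, j⟩, h⟩
  revert h
  refine Fin.cases ?_ (fun i => ?_) i <;> refine Fin.cases ?_ (fun j => ?_) j <;> intro h
  · rw [glue_top]
    simp [upperPart, Matrix.mul_apply, Fin.sum_univ_succ, triMat_glue_zero_zero,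
      triMat_glue_zero_succ, dotProduct, add_comm, pow_two]
  · rw [glue_top]
    simp [upperPart, Matrix.mul_apply, Fin.sum_univ_succ, triMat_glue_zero_zero,
      triMat_glue_zero_succ, triMat_glue_succ_succ, triMat_glue_succ_zero, dotProduct,
      Matrix.mulVec, mul_comm]
  · exact absurd (Fin.le_zero_iff.1 h) (Fin.succ_ne_zero _)
  · rw [glue_minor]
    simp [upperPart, Matrix.mul_apply, Fin.sum_univ_succ, triMat_glue_succ_succ,
      triMat_glue_succ_zero]

lemma measurable_triMat {n : ℕ} (i j : Fin n) :
    Measurable fun x : UpperIndex n → ℝ => triMat x i j := by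
  simp only [triMat, Matrix.of_apply]
  split_ifs with h
  · exact measurable_pi_apply _
  · exact measurable_const

lemma measurable_upperPart_triMat {n : ℕ} :
    Measurable fun x : UpperIndex n → ℝ => upperPart (triMat x * (triMat x).transpose) := by
  refine measurable_pi_lambda _ fun p => ?_
  simp only [upperPart, Matrix.mul_apply, Matrix.transpose_apply]
  exact Finset.measurable_sum _ fun k _ => (measurable_triMat _ _).mul (measurable_triMat _ _)

/-- The integral over the positive definite matrices of size `n + 1` with a given lower right block
`t tᵀ`, where `t` is an invertible upper triangular matrix. -/
lemma lintegral_posDef_fiber {n : ℕ} {f : (UpperIndex (n + 1) → ℝ) → ENNReal} (hf : Measurable f)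
    {t : UpperIndex n → ℝ} (hdet : (triMat t).det ≠ 0) :
    ∫⁻ u, ∫⁻ a, Set.indicator
        {x | (symOfCoord x : Matrix (Fin (n + 1)) (Fin (n + 1)) ℝ).PosDef} f
        (glue a u (upperPart (triMat t * (triMat t).transpose))) =
      ENNReal.ofReal |(triMat t).det| * ∫⁻ x, ∫⁻ τ, ENNReal.ofReal |τ| *
        f (glue (x ⬝ᵥ x + τ ^ 2) ((triMat t).mulVec x)
          (upperPart (triMat t * (triMat t).transpose))) := by
  have hpf : Measurable (Set.indicator
      {x | (symOfCoord x : Matrix (Fin (n + 1)) (Fin (n + 1)) ℝ).PosDef} f) :=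
    hf.indicator (measurableSet_posDef (n + 1))
  generalize hS : upperPart (triMat t * (triMat t).transpose) = S
  have hgm : Measurable fun u => ∫⁻ a, Set.indicator
      {x | (symOfCoord x : Matrix (Fin (n + 1)) (Fin (n + 1)) ℝ).PosDef} f (glue a u S) := by
    refine Measurable.lintegral_prod_right' (ν := volume)
      (f := fun q : (Fin n → ℝ) × ℝ => Set.indicator
      {x | (symOfCoord x : Matrix (Fin (n + 1)) (Fin (n + 1)) ℝ).PosDef} f (glue q.2 q.1 S)) ?_
    exact hpf.comp (measurable_glue.comp
      (measurable_const.prodMk (measurable_fst.prodMk measurable_snd)))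
  rw [lintegral_mulVec hdet hgm]
  refine congrArg _ (lintegral_congr fun x => ?_)
  have hfa : Measurable fun a => f (glue a ((triMat t).mulVec x) S) :=
    hf.comp (measurable_glue.comp
      (measurable_const.prodMk (measurable_const.prodMk measurable_id)))
  rw [← lintegral_Ioi_eq_lintegral_sq hfa, ← lintegral_indicator measurableSet_Ioi]
  refine lintegral_congr fun a => ?_
  have hiff : glue a ((triMat t).mulVec x) S ∈
      {x | (symOfCoord x : Matrix (Fin (n + 1)) (Fin (n + 1)) ℝ).PosDef} ↔
      a ∈ Set.Ioi (x ⬝ᵥ x) := by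
    have := posDef_glue_iff (a - x ⬝ᵥ x) x t hdet
    rw [add_sub_cancel, sub_pos, hS] at this
    exact this
  by_cases ha : a ∈ Set.Ioi (x ⬝ᵥ x)
  · rw [Set.indicator_of_mem ha, Set.indicator_of_mem (hiff.2 ha)]
  · rw [Set.indicator_of_notMem ha, Set.indicator_of_notMem (mt hiff.1 ha)]

/-- Integration over the cone of positive definite matrices in Cholesky coordinates `z = t tᵀ`. As
the diagonal entries of `t` run over all nonzero reals, every `z` is attained `2 ^ n` times, which
cancels the powers of `2` in the Jacobian. -/
theorem lintegral_posDef (n : ℕ) {f : (UpperIndex n → ℝ) → ENNReal} (hf : Measurable f) :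
    ∫⁻ x in {x | (symOfCoord x : Matrix (Fin n) (Fin n) ℝ).PosDef}, f x =
      ∫⁻ x, (∏ i, ENNReal.ofReal (|x (diagIdx i)| ^ (i.1 + 1))) *
        f (upperPart (triMat x * (triMat x).transpose)) := by
  induction n with
  | zero =>
    have h1 : {x : UpperIndex 0 → ℝ | (symOfCoord x : Matrix (Fin 0) (Fin 0) ℝ).PosDef} =
        Set.univ := by
      refine Set.eq_univ_of_forall fun x => ?_
      refine Matrix.PosDef.of_dotProduct_mulVec_pos ?_ fun v hv => absurd (Subsingleton.elim v 0) hv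
      ext i
      exact i.elim0
    rw [h1, Measure.restrict_univ]
    refine lintegral_congr fun x => ?_
    rw [Finset.univ_eq_empty, Finset.prod_empty, one_mul]
    congr 1
    exact funext fun p => p.1.1.elim0
  | succ n ih =>
    set P : Set (UpperIndex (n + 1) → ℝ) :=
      {x | (symOfCoord x : Matrix (Fin (n + 1)) (Fin (n + 1)) ℝ).PosDef}
    have hP : MeasurableSet P := measurableSet_posDef (n + 1)
    have hPf : Measurable (P.indicator f) := hf.indicator hP
    set g : (UpperIndex n → ℝ) → ENNReal := fun z => ∫⁻ u, ∫⁻ a, P.indicator f (glue a u z)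
    have hg2 : Measurable fun q : (UpperIndex n → ℝ) × (Fin n → ℝ) =>
        ∫⁻ a, P.indicator f (glue a q.2 q.1) := by
      refine Measurable.lintegral_prod_right'
        (f := fun q : ((UpperIndex n → ℝ) × (Fin n → ℝ)) × ℝ =>
        P.indicator f (glue q.2 q.1.2 q.1.1)) ?_
      exact hPf.comp (measurable_glue.comp
        (measurable_fst.fst.prodMk (measurable_fst.snd.prodMk measurable_snd)))
    have hg : Measurable g := hg2.lintegral_prod_right'
    have hR : Measurable fun x : UpperIndex (n + 1) → ℝ =>
        (∏ i, ENNReal.ofReal (|x (diagIdx i)| ^ (i.1 + 1))) *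
          f (upperPart (triMat x * (triMat x).transpose)) := by
      refine Measurable.mul (Finset.measurable_prod _ fun i _ => ?_)
        (hf.comp measurable_upperPart_triMat)
      have := measurable_pi_apply (X := fun _ : UpperIndex (n + 1) => ℝ) (diagIdx i)
      fun_prop
    rw [← lintegral_indicator hP, lintegral_glue hPf, lintegral_glue hR]
    change ∫⁻ z, g z = _
    set Q : Set (UpperIndex n → ℝ) := {x | (symOfCoord x : Matrix (Fin n) (Fin n) ℝ).PosDef}
    have hg0 : g = Q.indicator g := by
      ext z
      by_cases hz : z ∈ Q
      · rw [Set.indicator_of_mem hz]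
      · rw [Set.indicator_of_notMem hz]
        have (a : ℝ) (u : Fin n → ℝ) : P.indicator f (glue a u z) = 0 := by
          have hn : glue a u z ∉ P := fun h => hz (posDef_of_glue h)
          exact Set.indicator_of_notMem hn f
        simp [g, this]
    rw [hg0, lintegral_indicator (measurableSet_posDef n), ih hg]
    refine lintegral_congr fun t => ?_
    simp only [Fin.prod_univ_succ, glue_diagIdx_zero, glue_diagIdx_succ, Fin.val_zero, zero_add,
      pow_one, Fin.val_succ]
    by_cases ht : ∃ i, t (diagIdx i) = 0
    · obtain ⟨i, hi⟩ := ht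
      have h1 : ∏ i, ENNReal.ofReal (|t (diagIdx i)| ^ (i.1 + 1)) = 0 :=
        Finset.prod_eq_zero (Finset.mem_univ i) (by simp [hi])
      have h2 : ∏ i : Fin n, ENNReal.ofReal (|t (diagIdx i)| ^ (i.1 + 1 + 1)) = 0 :=
        Finset.prod_eq_zero (Finset.mem_univ i) (by simp [hi])
      rw [h1, zero_mul]
      simp only [h2, mul_zero, zero_mul, lintegral_zero]
    push Not at ht
    have hdet : (triMat t).det ≠ 0 := by
      rw [det_triMat]
      exact Finset.prod_ne_zero_iff.2 fun i _ => ht i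
    have hdet' : ENNReal.ofReal |(triMat t).det| = ∏ i, ENNReal.ofReal |t (diagIdx i)| := by
      rw [det_triMat, Finset.abs_prod, ENNReal.ofReal_prod_of_nonneg fun i _ => abs_nonneg _]
    have hprod : (∏ i, ENNReal.ofReal (|t (diagIdx i)| ^ (i.1 + 1))) *
        ENNReal.ofReal |(triMat t).det| =
          ∏ i, ENNReal.ofReal (|t (diagIdx i)| ^ (i.1 + 1 + 1)) := by
      rw [hdet', ← Finset.prod_mul_distrib]
      refine Finset.prod_congr rfl fun i _ => ?_
      rw [pow_succ _ (i.1 + 1), ENNReal.ofReal_mul (by positivity)]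
    set S := upperPart (triMat t * (triMat t).transpose)
    have hgS : g S = ENNReal.ofReal |(triMat t).det| *
        ∫⁻ x, ∫⁻ τ, ENNReal.ofReal |τ| * f (glue (x ⬝ᵥ x + τ ^ 2) ((triMat t).mulVec x) S) :=
      lintegral_posDef_fiber hf hdet
    rw [hgS, ← mul_assoc, hprod]
    have hmf : Measurable fun q : (Fin n → ℝ) × ℝ =>
        ENNReal.ofReal |q.2| * f (glue (q.1 ⬝ᵥ q.1 + q.2 ^ 2) ((triMat t).mulVec q.1) S) := by
      refine Measurable.mul (by fun_prop) (hf.comp (measurable_glue.comp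
        (measurable_const.prodMk (Measurable.prodMk ?_ ?_))))
      · exact ((Matrix.toLin' (triMat t)).continuous_of_finiteDimensional.comp
          continuous_fst).measurable
      · exact ((continuous_fst.dotProduct continuous_fst).add (continuous_snd.pow 2)).measurable
    rw [← lintegral_const_mul _ hmf.lintegral_prod_right']
    refine lintegral_congr fun x => ?_
    have hmx : Measurable fun τ => ENNReal.ofReal |τ| *
        f (glue (x ⬝ᵥ x + τ ^ 2) ((triMat t).mulVec x) S) :=
      hmf.comp (measurable_const.prodMk measurable_id)
    rw [← lintegral_const_mul _ hmx]
    refine lintegral_congr fun τ => ?_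
    rw [upperPart_triMat_glue]
    ring

/-! ### QR decomposition -/

/-- A linear map preserving a positive definite function preserves the volume of a sublevel set of
it, hence has determinant `± 1` and preserves Lebesgue measure. -/
lemma measurePreserving_of_invariant {V : Type*} [NormedAddCommGroup V] [NormedSpace ℝ V]
    [FiniteDimensional ℝ V] [MeasurableSpace V] [BorelSpace V] (μ : Measure V)
    [μ.IsAddHaarMeasure] (L : V →ₗ[ℝ] V) {Q : V → ℝ} (hQ : Continuous Q) (hQ0 : Q 0 = 0)
    (hle : ∀ x, ‖x‖ ≤ √(Q x)) (hinv : ∀ x, Q (L x) = Q x) : MeasurePreserving L μ μ := by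
  have hinj : LinearMap.ker L = ⊥ := by
    refine LinearMap.ker_eq_bot'.2 fun x hx => ?_
    have h := hle x
    rw [← hinv, hx, hQ0, Real.sqrt_zero] at h
    exact norm_le_zero_iff.1 h
  have hdet : LinearMap.det L ≠ 0 := by
    rw [← isUnit_iff_ne_zero, ← LinearMap.isUnit_iff_isUnit_det, LinearMap.isUnit_iff_ker_eq_bot]
    exact hinj
  set U : Set V := {x | Q x < 1}
  have hU : IsOpen U := isOpen_lt hQ continuous_const
  have hU0 : (0 : V) ∈ U := by
    change Q 0 < 1
    rw [hQ0]
    exact one_pos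
  have hUb : U ⊆ Metric.closedBall 0 1 := fun x hx => by
    rw [mem_closedBall_zero_iff]
    exact (hle x).trans (Real.sqrt_le_one.2 (le_of_lt hx))
  have hpre : L ⁻¹' U = U := by
    ext x
    change Q (L x) < 1 ↔ Q x < 1
    rw [hinv]
  have hμ0 : μ U ≠ 0 := (hU.measure_pos μ ⟨0, hU0⟩).ne'
  have hμt : μ U ≠ ⊤ :=
    ((measure_mono hUb).trans_lt (isCompact_closedBall (0 : V) 1).measure_lt_top).ne
  have h1 : ENNReal.ofReal |(LinearMap.det L)⁻¹| = 1 := by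
    have h := Measure.addHaar_preimage_linearMap μ hdet U
    rw [hpre] at h
    exact (ENNReal.mul_eq_right hμ0 hμt).1 h.symm
  refine ⟨L.continuous_of_finiteDimensional.measurable, ?_⟩
  rw [Measure.map_linearMap_addHaar_eq_smul_addHaar μ hdet, h1, one_smul]

lemma norm_le_sqrt_sum_sq {ι : Type*} [Fintype ι] (x : ι → ℝ) : ‖x‖ ≤ √(∑ i, x i ^ 2) := by
  refine (pi_norm_le_iff_of_nonneg (Real.sqrt_nonneg _)).2 fun i => Real.le_sqrt_of_sq_le ?_
  rw [Real.norm_eq_abs, sq_abs]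
  exact Finset.single_le_sum (f := fun i => x i ^ 2) (fun i _ => sq_nonneg _) (Finset.mem_univ i)

lemma trace_transpose_mul_self {m n : Type*} [Fintype m] [Fintype n] (M : Matrix m n ℝ) :
    (M.transpose * M).trace = ∑ j, ∑ i, M i j ^ 2 := by
  simp [Matrix.trace, Matrix.mul_apply, pow_two]

/-- Left multiplication by an orthogonal matrix preserves Lebesgue measure on `n × d`-matrices. -/
lemma measurePreserving_mul_left {n d : ℕ} {k : Matrix (Fin n) (Fin n) ℝ}
    (hk : k.transpose * k = 1) :
    MeasurePreserving (fun (y : Fin n → Fin d → ℝ) (i : Fin n) => (k * Matrix.of y) i) := by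
  let L : (Fin n → Fin d → ℝ) →ₗ[ℝ] (Fin n → Fin d → ℝ) :=
    { toFun := fun y => (k * Matrix.of y : Matrix (Fin n) (Fin d) ℝ)
      map_add' := fun a b => Matrix.mul_add k (Matrix.of a) (Matrix.of b)
      map_smul' := fun c a => Matrix.mul_smul k c (Matrix.of a) }
  refine measurePreserving_of_invariant volume L
    (Q := fun y => ((Matrix.of y).transpose * Matrix.of y).trace) ?_ ?_ (fun y => ?_) fun y => ?_
  · have h : Continuous fun y : Fin n → Fin d → ℝ => Matrix.of y := continuous_id
    exact (h.matrix_transpose.matrix_mul h).matrix_trace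
  · simp
  · refine (pi_norm_le_iff_of_nonneg (Real.sqrt_nonneg _)).2 fun i =>
      (norm_le_sqrt_sum_sq (y i)).trans (Real.sqrt_le_sqrt ?_)
    rw [trace_transpose_mul_self]
    refine Finset.sum_le_sum fun j _ => ?_
    exact Finset.single_le_sum (f := fun i => y i j ^ 2) (fun i _ => sq_nonneg _)
      (Finset.mem_univ i)
  · change ((k * Matrix.of y).transpose * (k * Matrix.of y)).trace = _
    rw [Matrix.transpose_mul, Matrix.mul_assoc, ← Matrix.mul_assoc _ k, hk, Matrix.one_mul]

/-- The action `z ↦ k z kᵀ` of an orthogonal matrix preserves Lebesgue measure on symmetric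
matrices. -/
lemma measurePreserving_conj {n : ℕ} {k : Matrix (Fin n) (Fin n) ℝ} (hk : k.transpose * k = 1) :
    MeasurePreserving (fun x : UpperIndex n → ℝ => upperPart
      (k * (symOfCoord x : Matrix (Fin n) (Fin n) ℝ) * k.transpose)) := by
  let L : (UpperIndex n → ℝ) →ₗ[ℝ] (UpperIndex n → ℝ) :=
    { toFun := fun x => upperPart (k * (symOfCoord x : Matrix (Fin n) (Fin n) ℝ) * k.transpose)
      map_add' := fun a b => by
        have h : (symOfCoord (a + b) : Matrix (Fin n) (Fin n) ℝ) =
          symOfCoord a + symOfCoord b := rfl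
        rw [h, Matrix.mul_add, Matrix.add_mul]
        rfl
      map_smul' := fun c a => by
        have h : (symOfCoord (c • a) : Matrix (Fin n) (Fin n) ℝ) =
          c • (symOfCoord a : Matrix (Fin n) (Fin n) ℝ) := rfl
        rw [h, Matrix.mul_smul, Matrix.smul_mul]
        rfl }
  have hc : Continuous fun x : UpperIndex n → ℝ => (symOfCoord x : Matrix (Fin n) (Fin n) ℝ) :=
    continuous_matrix fun i j => by
      simp only [symOfCoord_apply]
      exact continuous_apply _
  refine measurePreserving_of_invariant volume L
    (Q := fun x => ((symOfCoord x : Matrix (Fin n) (Fin n) ℝ).transpose *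
      (symOfCoord x : Matrix (Fin n) (Fin n) ℝ)).trace) ?_ ?_ (fun x => ?_) fun x => ?_
  · exact (hc.matrix_transpose.matrix_mul hc).matrix_trace
  · have h : (symOfCoord (0 : UpperIndex n → ℝ) : Matrix (Fin n) (Fin n) ℝ) = 0 := rfl
    simp [h]
  · refine (pi_norm_le_iff_of_nonneg (Real.sqrt_nonneg _)).2 fun p => Real.le_sqrt_of_sq_le ?_
    rw [trace_transpose_mul_self, Real.norm_eq_abs, sq_abs]
    have h := symOfCoord_apply_of_le x p.2
    change x p ^ 2 ≤ _
    rw [← show (symOfCoord x : Matrix (Fin n) (Fin n) ℝ) p.1.1 p.1.2 = x p from h]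
    refine le_trans ?_ (Finset.single_le_sum (f := fun j => ∑ i,
      (symOfCoord x : Matrix (Fin n) (Fin n) ℝ) i j ^ 2)
      (fun i _ => Finset.sum_nonneg fun j _ => sq_nonneg _) (Finset.mem_univ p.1.2))
    exact Finset.single_le_sum (f := fun i => (symOfCoord x : Matrix (Fin n) (Fin n) ℝ) i p.1.2 ^ 2)
      (fun i _ => sq_nonneg _) (Finset.mem_univ p.1.1)
  · have hx := isSymm_symOfCoord x
    have hs : (k * (symOfCoord x : Matrix (Fin n) (Fin n) ℝ) * k.transpose).IsSymm := by
      rw [Matrix.IsSymm, Matrix.transpose_mul, Matrix.transpose_mul, Matrix.transpose_transpose,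
        hx.eq, Matrix.mul_assoc]
    change ((symOfCoord (upperPart (k * (symOfCoord x : Matrix (Fin n) (Fin n) ℝ) *
      k.transpose)) : Matrix (Fin n) (Fin n) ℝ).transpose *
      (symOfCoord (upperPart (k * (symOfCoord x : Matrix (Fin n) (Fin n) ℝ) *
      k.transpose)) : Matrix (Fin n) (Fin n) ℝ)).trace = _
    rw [symOfCoord_upperPart hs, hs.eq, hx.eq]
    calc _ = ((k * (symOfCoord x : Matrix (Fin n) (Fin n) ℝ)) * (k.transpose * k) *
          ((symOfCoord x : Matrix (Fin n) (Fin n) ℝ) * k.transpose)).trace := by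
            simp only [Matrix.mul_assoc]
      _ = _ := by
        rw [hk, Matrix.mul_one, Matrix.trace_mul_comm, Matrix.mul_assoc,
          ← Matrix.mul_assoc _ k, hk, Matrix.one_mul]

/-- The matrix of the reflection exchanging the first standard basis vector and the unit vector
`ω`. If `ω` is the first basis vector then, division by `0` giving `0`, this is the identity. -/
noncomputable def householder {n : ℕ} (ω : Fin (n + 1) → ℝ) :
    Matrix (Fin (n + 1)) (Fin (n + 1)) ℝ :=
  1 - (2 / ((ω - Pi.single 0 1) ⬝ᵥ (ω - Pi.single 0 1))) •
    Matrix.vecMulVec (ω - Pi.single 0 1) (ω - Pi.single 0 1)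

lemma transpose_householder {n : ℕ} (ω : Fin (n + 1) → ℝ) :
    (householder ω).transpose = householder ω := by
  simp [householder, Matrix.transpose_vecMulVec]

lemma householder_mul_self {n : ℕ} (ω : Fin (n + 1) → ℝ) :
    householder ω * householder ω = 1 := by
  simp only [householder]
  generalize ω - Pi.single 0 1 = u
  by_cases hu : u ⬝ᵥ u = 0
  · simp [hu]
  · rw [Matrix.sub_mul, Matrix.mul_sub, Matrix.mul_sub, Matrix.one_mul, Matrix.mul_one,
      Matrix.one_mul, Matrix.smul_mul, Matrix.mul_smul, Matrix.vecMulVec_mul_vecMulVec,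
      Matrix.vecMulVec_smul, smul_smul, smul_smul]
    have h : 2 / (u ⬝ᵥ u) * (2 / (u ⬝ᵥ u) * (u ⬝ᵥ u)) = 2 * (2 / (u ⬝ᵥ u)) := by
      field_simp
    rw [mul_assoc, h]
    module

lemma householder_apply_zero {n : ℕ} {ω : Fin (n + 1) → ℝ} (hω : ω ⬝ᵥ ω = 1) (i : Fin (n + 1)) :
    householder ω i 0 = ω i := by
  have h1 : (ω - Pi.single 0 1) ⬝ᵥ (ω - Pi.single 0 1) = 2 * (1 - ω 0) := by
    simp only [sub_dotProduct, dotProduct_sub, hω, dotProduct_single, single_dotProduct,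
      Pi.sub_apply, Pi.single_eq_same]
    ring
  simp only [householder, h1, Matrix.sub_apply, Matrix.smul_apply, Matrix.vecMulVec_apply,
    Pi.sub_apply, Pi.single_eq_same, smul_eq_mul]
  by_cases h0 : ω 0 = 1
  · have h2 : ω - Pi.single 0 1 = 0 := by
      rw [← dotProduct_self_eq_zero, h1, h0]; ring
    have h3 := congrFun h2 i
    simp only [Pi.sub_apply, Pi.zero_apply] at h3
    rw [h0]
    simp [Matrix.one_apply, Pi.single_apply] at h3 ⊢
    linarith
  · have : 1 - ω 0 ≠ 0 := sub_ne_zero.2 (Ne.symm h0)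
    rw [Matrix.one_apply, Pi.single_apply]
    field_simp
    ring

lemma lintegral_euclidean_polar {n : ℕ} {F : EuclideanSpace ℝ (Fin (n + 1)) → ENNReal}
    (hF : Measurable F) :
    ∫⁻ x, F x = ∫⁻ ω, (∫⁻ r in Set.Ioi (0 : ℝ), ENNReal.ofReal (r ^ n) * F (r • ω.1))
      ∂(volume : Measure (EuclideanSpace ℝ (Fin (n + 1)))).toSphere := by
  have hmp := Measure.measurePreserving_homeomorphUnitSphereProd
    (volume : Measure (EuclideanSpace ℝ (Fin (n + 1))))
  rw [finrank_euclideanSpace_fin, Nat.add_sub_cancel] at hmp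
  have hs : Measurable fun p : Metric.sphere (0 : EuclideanSpace ℝ (Fin (n + 1))) 1 ×
      Set.Ioi (0 : ℝ) => p.2.1 • p.1.1 := by
    have h1 : Measurable fun p : Metric.sphere (0 : EuclideanSpace ℝ (Fin (n + 1))) 1 ×
      Set.Ioi (0 : ℝ) => p.2.1 := measurable_subtype_coe.comp measurable_snd
    have h2 : Measurable fun p : Metric.sphere (0 : EuclideanSpace ℝ (Fin (n + 1))) 1 ×
      Set.Ioi (0 : ℝ) => p.1.1 := measurable_subtype_coe.comp measurable_fst
    exact h1.smul h2
  have hG := hF.comp hs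
  calc ∫⁻ x, F x = ∫⁻ x in ({0}ᶜ : Set (EuclideanSpace ℝ (Fin (n + 1)))), F x := by
        rw [MeasureTheory.restrict_compl_singleton]
    _ = ∫⁻ x : ({0}ᶜ : Set (EuclideanSpace ℝ (Fin (n + 1)))), F x
          ∂(volume.comap Subtype.val) :=
        (lintegral_subtype_comap (measurableSet_singleton _).compl F).symm
    _ = ∫⁻ p, (F ∘ fun p : Metric.sphere (0 : EuclideanSpace ℝ (Fin (n + 1))) 1 ×
          Set.Ioi (0 : ℝ) => p.2.1 • p.1.1) p
          ∂(volume.toSphere.prod (Measure.volumeIoiPow n)) := by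
        rw [← hmp.lintegral_comp hG]
        refine lintegral_congr fun x => ?_
        have hx : ‖x.1‖ ≠ 0 := norm_ne_zero_iff.2 x.2
        simp only [Function.comp, homeomorphUnitSphereProd_apply_fst_coe,
          homeomorphUnitSphereProd_apply_snd_coe, smul_smul, mul_inv_cancel₀ hx, one_smul]
    _ = _ := by
        rw [lintegral_prod _ hG.aemeasurable]
        refine lintegral_congr fun ω => ?_
        have hm : Measurable fun r : ℝ => F (r • ω.1) :=
          hF.comp (measurable_id.smul measurable_const)
        have hm' : Measurable fun r : Set.Ioi (0 : ℝ) => F (r.1 • ω.1) :=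
          hm.comp measurable_subtype_coe
        have hw : Measurable fun r : Set.Ioi (0 : ℝ) => ENNReal.ofReal (r.1 ^ n) :=
          (measurable_subtype_coe.pow_const n).ennreal_ofReal
        refine (lintegral_withDensity_eq_lintegral_mul _ hw hm').trans ?_
        exact lintegral_subtype_comap measurableSet_Ioi
          (fun r : ℝ => ENNReal.ofReal (r ^ n) * F (r • ω.1))

/-- The integral of a function over the real line as an integral over a half-line. -/
lemma lintegral_eq_lintegral_Ioi_add {F : ℝ → ENNReal} (hF : Measurable F) :
    ∫⁻ r, F r = ∫⁻ r in Set.Ioi (0 : ℝ), (F r + F (-r)) := by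
  have h1 := lintegral_add_compl (μ := volume) F (measurableSet_Ioi (a := (0 : ℝ)))
  rw [lintegral_add_left hF, ← h1, Set.compl_Ioi]
  congr 1
  have h2 := (Measure.measurePreserving_neg (volume : Measure ℝ)).setLIntegral_comp_preimage
    (measurableSet_Iic (a := (0 : ℝ))) hF
  rw [← h2]
  have h3 : Neg.neg ⁻¹' Set.Iic (0 : ℝ) = Set.Ici 0 := by ext; simp
  rw [h3]
  exact setLIntegral_congr Ioi_ae_eq_Ici.symm

/-- Polar coordinates `c = r ω` in `ℝ ^ (n + 1)`, with a radius `r` of either sign. The unit vector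
`ω` is given as the first column of an orthogonal matrix. -/
theorem exists_lintegral_polar (n : ℕ) : ∃ (Ω : Type) (_ : MeasurableSpace Ω) (ν : Measure Ω)
    (_ : IsFiniteMeasure ν) (H : Ω → Matrix (Fin (n + 1)) (Fin (n + 1)) ℝ),
    (∀ i j, Measurable fun ω => H ω i j) ∧ (∀ ω, (H ω).transpose * H ω = 1) ∧
    ∀ f : (Fin (n + 1) → ℝ) → ENNReal, Measurable f → ∫⁻ c, f c =
      ∫⁻ ω, (∫⁻ r : ℝ, ENNReal.ofReal (|r| ^ n) * f (fun i => r * H ω i 0)) ∂ν := by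
  -- Radii of both signs cover every point twice, which the factor `2⁻¹` compensates.
  refine ⟨Metric.sphere (0 : EuclideanSpace ℝ (Fin (n + 1))) 1, inferInstance,
    (2⁻¹ : NNReal) • (volume : Measure (EuclideanSpace ℝ (Fin (n + 1)))).toSphere, inferInstance,
    fun ω => householder (WithLp.ofLp ω.1), fun i j => ?_, fun ω => ?_, fun f hf => ?_⟩
  · have h : Measurable fun ω : Metric.sphere (0 : EuclideanSpace ℝ (Fin (n + 1))) 1 =>
        WithLp.ofLp ω.1 := (PiLp.continuous_ofLp 2 _).measurable.comp measurable_subtype_coe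
    have h' : ∀ l, Measurable fun ω : Metric.sphere (0 : EuclideanSpace ℝ (Fin (n + 1))) 1 =>
        WithLp.ofLp ω.1 l := fun l => (measurable_pi_apply l).comp h
    simp only [householder, Matrix.sub_apply, Matrix.smul_apply, Matrix.vecMulVec_apply,
      Pi.sub_apply, dotProduct, smul_eq_mul]
    refine measurable_const.sub ((measurable_const.div (Finset.measurable_sum _ fun l _ => ?_)).mul
      ?_)
    · exact ((h' l).sub_const _).mul ((h' l).sub_const _)
    · exact ((h' i).sub_const _).mul ((h' j).sub_const _)
  · rw [transpose_householder, householder_mul_self]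
  · have hω (ω : Metric.sphere (0 : EuclideanSpace ℝ (Fin (n + 1))) 1) :
        WithLp.ofLp ω.1 ⬝ᵥ WithLp.ofLp ω.1 = 1 := by
      have h := EuclideanSpace.real_norm_sq_eq ω.1
      rw [norm_eq_of_mem_sphere ω, one_pow] at h
      simp only [dotProduct, ← pow_two]
      exact h.symm
    simp only [householder_apply_zero (hω _)]
    set σ := (volume : Measure (EuclideanSpace ℝ (Fin (n + 1)))).toSphere
    set F : EuclideanSpace ℝ (Fin (n + 1)) → ENNReal := fun x => f (WithLp.ofLp x)
    have hF : Measurable F := hf.comp (PiLp.continuous_ofLp 2 _).measurable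
    have h1 : ∫⁻ c, f c = ∫⁻ x, F x :=
      ((PiLp.volume_preserving_ofLp (Fin (n + 1))).lintegral_comp hf).symm
    have h2 : ∫⁻ x, F x = ∫⁻ x, F (-x) :=
      ((Measure.measurePreserving_neg
        (volume : Measure (EuclideanSpace ℝ (Fin (n + 1))))).lintegral_comp hF).symm
    have hFn : Measurable fun x => F (-x) := hF.comp measurable_neg
    have hm (ω : EuclideanSpace ℝ (Fin (n + 1))) : Measurable fun r : ℝ => F (r • ω) :=
      hF.comp (measurable_id.smul measurable_const)
    have h3 : (∫⁻ x, F x) + ∫⁻ x, F x =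
        ∫⁻ ω, (∫⁻ r : ℝ, ENNReal.ofReal (|r| ^ n) * F (r • ω.1)) ∂σ := by
      nth_rewrite 2 [h2]
      have hFF : Measurable fun x => F x + F (-x) := hF.add hFn
      rw [← lintegral_add_left hF, lintegral_euclidean_polar hFF]
      refine lintegral_congr fun ω => ?_
      have hm' : Measurable fun r : ℝ => ENNReal.ofReal (|r| ^ n) * F (r • ω.1) :=
        Measurable.mul (by fun_prop) (hm ω.1)
      rw [lintegral_eq_lintegral_Ioi_add hm']
      refine setLIntegral_congr_fun measurableSet_Ioi fun r hr => ?_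
      have hr : (0 : ℝ) < r := hr
      simp only [abs_neg, abs_of_pos hr, neg_smul]
      rw [mul_add]
    change _ = ∫⁻ ω : Metric.sphere (0 : EuclideanSpace ℝ (Fin (n + 1))) 1,
      (∫⁻ r : ℝ, ENNReal.ofReal (|r| ^ n) * F (r • ω.1)) ∂_
    rw [h1, lintegral_smul_measure, ← h3, ← two_mul, ENNReal.smul_def, smul_eq_mul, ← mul_assoc]
    norm_num
    rw [ENNReal.inv_mul_cancel (by norm_num) (by norm_num), one_mul]

lemma lintegral_column {m d : ℕ} {f : (Fin m → Fin (d + 1) → ℝ) → ENNReal} (hf : Measurable f) :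
    ∫⁻ y, f y = ∫⁻ y : Fin m → Fin d → ℝ, ∫⁻ c : Fin m → ℝ,
      f fun i => Fin.cons (c i) (y i) := by
  have h1 := (volume_preserving_pi fun _ : Fin m =>
    (volume_preserving_piFinSuccAbove (fun _ : Fin (d + 1) => ℝ) 0).symm)
  have h2 := (volume_measurePreserving_arrowProdEquivProdArrow ℝ (Fin d → ℝ) (Fin m)).symm
  have h12 := h1.comp h2
  refine (h12.lintegral_comp hf).symm.trans ((lintegral_prod_symm (μ := volume) (ν := volume) _
    (hf.comp h12.measurable).aemeasurable).trans ?_)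
  refine lintegral_congr fun y => lintegral_congr fun c => congrArg f (funext fun i => ?_)
  exact Fin.insertNth_zero' (c i) (y i)

lemma lintegral_row {n d : ℕ} {f : (Fin (n + 1) → Fin d → ℝ) → ENNReal} (hf : Measurable f) :
    ∫⁻ y, f y = ∫⁻ y : Fin n → Fin d → ℝ, ∫⁻ ρ : Fin d → ℝ, f (Fin.cons ρ y) := by
  have h := (volume_preserving_piFinSuccAbove (fun _ : Fin (n + 1) => Fin d → ℝ) 0).symm
  refine (h.lintegral_comp hf).symm.trans ((lintegral_prod_symm (μ := volume) (ν := volume) _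
    (hf.comp h.measurable).aemeasurable).trans ?_)
  exact lintegral_congr fun y => lintegral_congr fun ρ =>
    congrArg f (Fin.insertNth_zero' ρ y)

/-- The upper triangular matrix with given entries, padded by zeros to an `n × d`-matrix. -/
def padMat (n : ℕ) {d : ℕ} (x : UpperIndex d → ℝ) : Matrix (Fin n) (Fin d) ℝ :=
  Matrix.of fun i j => if h : i.1 ≤ j.1 then x ⟨(⟨i.1, h.trans_lt j.2⟩, j), h⟩ else 0

lemma padMat_glue_zero {n d : ℕ} (r : ℝ) (ρ : Fin d → ℝ) (x : UpperIndex d → ℝ) :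
    padMat (n + 1) (glue r ρ x) 0 = (Fin.cons r ρ : Fin (d + 1) → ℝ) := by
  ext j
  simp only [padMat, Matrix.of_apply]
  exact glue_top r ρ x j (Fin.zero_le j)

lemma padMat_glue_succ {n d : ℕ} (r : ℝ) (ρ : Fin d → ℝ) (x : UpperIndex d → ℝ) (i : Fin n) :
    padMat (n + 1) (glue r ρ x) i.succ = (Fin.cons 0 (padMat n x i) : Fin (d + 1) → ℝ) := by
  ext j
  refine Fin.cases ?_ (fun j => ?_) j
  · simp [padMat]
  · simp only [padMat, Matrix.of_apply, Fin.cons_succ, Fin.val_succ, Nat.add_le_add_iff_right]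
    split_ifs with h
    · exact glue_minor r ρ x ⟨i.1, h.trans_lt j.2⟩ j (by simpa [Fin.le_def] using h)
    · rfl

lemma measurable_padMat (n : ℕ) {d : ℕ} (i : Fin n) (j : Fin d) :
    Measurable fun x : UpperIndex d → ℝ => padMat n x i j := by
  simp only [padMat, Matrix.of_apply]
  split_ifs with h
  · exact measurable_pi_apply _
  · exact measurable_const

/-- The block diagonal matrix `1 ⊕ k`. -/
def extendOne {n : ℕ} (k : Matrix (Fin n) (Fin n) ℝ) : Matrix (Fin (n + 1)) (Fin (n + 1)) ℝ :=
  Matrix.of (Fin.cons (Fin.cons 1 0) fun i => Fin.cons 0 (k i))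

lemma extendOne_zero_zero {n : ℕ} (k : Matrix (Fin n) (Fin n) ℝ) : extendOne k 0 0 = 1 := rfl
lemma extendOne_zero_succ {n : ℕ} (k : Matrix (Fin n) (Fin n) ℝ) (j : Fin n) :
    extendOne k 0 j.succ = 0 := rfl
lemma extendOne_succ_zero {n : ℕ} (k : Matrix (Fin n) (Fin n) ℝ) (i : Fin n) :
    extendOne k i.succ 0 = 0 := rfl
lemma extendOne_succ_succ {n : ℕ} (k : Matrix (Fin n) (Fin n) ℝ) (i j : Fin n) :
    extendOne k i.succ j.succ = k i j := rfl

lemma extendOne_transpose_mul_self {n : ℕ} {k : Matrix (Fin n) (Fin n) ℝ}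
    (hk : k.transpose * k = 1) : (extendOne k).transpose * extendOne k = 1 := by
  ext i j
  refine Fin.cases ?_ (fun i => ?_) i <;> refine Fin.cases ?_ (fun j => ?_) j
  · simp [Matrix.mul_apply, Fin.sum_univ_succ, extendOne_zero_zero, extendOne_succ_zero]
  · simp [Matrix.mul_apply, Fin.sum_univ_succ, extendOne_zero_succ, extendOne_succ_zero,
      (Fin.succ_ne_zero j).symm]
  · simp [Matrix.mul_apply, Fin.sum_univ_succ, extendOne_zero_succ, extendOne_succ_zero]
  · have h := congrFun (congrFun hk i) j
    simp only [Matrix.mul_apply, Matrix.transpose_apply, Matrix.one_apply] at h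
    simp [Matrix.mul_apply, Fin.sum_univ_succ, extendOne_zero_succ, extendOne_succ_succ, h,
      Matrix.one_apply]

/-- The inductive step of the QR decomposition: `H` carries the first basis vector to the direction
of the first column of `y`, and `k` is the orthogonal factor of the remaining columns of `Hᵀ y`
without their first row `ρ`. -/
lemma mul_extendOne_mul_padMat {n d : ℕ} (H : Matrix (Fin (n + 1)) (Fin (n + 1)) ℝ)
    (k : Matrix (Fin n) (Fin n) ℝ) (r : ℝ) (ρ : Fin d → ℝ) (x : UpperIndex d → ℝ)
    (i : Fin (n + 1)) :
    (H * extendOne k * padMat (n + 1) (glue r ρ x)) i =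
      (Fin.cons (r * H i 0) ((H * Matrix.of (Fin.cons ρ fun i => (k * padMat n x) i)) i) :
        Fin (d + 1) → ℝ) := by
  rw [Matrix.mul_assoc]
  ext j
  refine Fin.cases ?_ (fun j => ?_) j
  · simp [Matrix.mul_apply, Fin.sum_univ_succ, padMat_glue_zero, padMat_glue_succ,
      extendOne_zero_zero, extendOne_succ_zero, mul_comm]
  · simp [Matrix.mul_apply, Fin.sum_univ_succ, padMat_glue_zero, padMat_glue_succ,
      extendOne_zero_zero, extendOne_succ_zero, extendOne_zero_succ, extendOne_succ_succ]

/-- Integration over `n × d`-matrices in QR coordinates `y = k r`, where `k` runs over a finite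
measure space of orthogonal matrices and `r` is upper triangular. -/
theorem exists_lintegral_qr (d : ℕ) : ∀ n, d ≤ n → ∃ (Ω : Type) (_ : MeasurableSpace Ω)
    (ν : Measure Ω) (_ : IsFiniteMeasure ν) (κ : Ω → Matrix (Fin n) (Fin n) ℝ),
    (∀ i j, Measurable fun ω => κ ω i j) ∧ (∀ ω, (κ ω).transpose * κ ω = 1) ∧
    ∀ f : (Fin n → Fin d → ℝ) → ENNReal, Measurable f → ∫⁻ y, f y =
      ∫⁻ ω, (∫⁻ x : UpperIndex d → ℝ,
        (∏ i : Fin d, ENNReal.ofReal (|x (diagIdx i)| ^ (n - 1 - i.1))) *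
          f fun i => (κ ω * padMat n x) i) ∂ν := by
  induction d with
  | zero =>
    refine fun n _ => ⟨Unit, inferInstance, Measure.dirac (), inferInstance, fun _ => 1,
      fun i j => measurable_const, fun _ => by simp, fun f hf => ?_⟩
    have h1 : ∀ y : Fin n → Fin 0 → ℝ, f y = f 0 := fun y => congrArg f (Subsingleton.elim _ _)
    rw [lintegral_dirac]
    simp only [h1, lintegral_const, Finset.univ_eq_empty, Finset.prod_empty, one_mul]
    rw [volume_pi, volume_pi, Measure.pi_univ, Measure.pi_univ]
    simp [volume_pi]
  | succ d ih =>
    intro n hn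
    obtain ⟨n, rfl⟩ : ∃ m, n = m + 1 := ⟨n - 1, by omega⟩
    obtain ⟨Ω, _, ν, _, κ, hκm, hκ, hκf⟩ := ih n (by omega)
    obtain ⟨S, _, σ, _, H, hHm, hH, hHf⟩ := exists_lintegral_polar n
    have hm : ∀ i j, Measurable fun ω : S × Ω => (H ω.1 * extendOne (κ ω.2)) i j := fun i j => by
      simp only [Matrix.mul_apply]
      refine Finset.measurable_sum _ fun l _ => ((hHm i l).comp measurable_fst).mul ?_
      refine Fin.cases ?_ (fun l => ?_) l <;> refine Fin.cases ?_ (fun j => ?_) j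
      · exact measurable_const
      · exact measurable_const
      · exact measurable_const
      · exact (hκm l j).comp measurable_snd
    refine ⟨S × Ω, inferInstance, σ.prod ν, inferInstance, fun ω => H ω.1 * extendOne (κ ω.2), hm,
      fun ω => ?_, fun f hf => ?_⟩
    · rw [Matrix.transpose_mul, Matrix.mul_assoc, ← Matrix.mul_assoc _ (H ω.1), hH,
        Matrix.one_mul, extendOne_transpose_mul_self (hκ ω.2)]
    set A : S → (Fin (n + 1) → Fin d → ℝ) → ℝ → ENNReal := fun ω y r =>
      ENNReal.ofReal (|r| ^ n) * f fun i => Fin.cons (r * H ω i 0) (y i) with hAdef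
    set G : S → (Fin (n + 1) → Fin d → ℝ) → ℝ → ENNReal := fun ω y r =>
      A ω (fun i => (H ω * Matrix.of y) i) r with hGdef
    have hA : Measurable fun q : (S × (Fin (n + 1) → Fin d → ℝ)) × ℝ => A q.1.1 q.1.2 q.2 := by
      refine Measurable.mul (by fun_prop) (hf.comp (measurable_pi_lambda _ fun i =>
        measurable_pi_lambda _ fun j => ?_))
      refine Fin.cases ?_ (fun j => ?_) j
      · exact measurable_snd.mul ((hHm i 0).comp measurable_fst.fst)
      · exact (measurable_pi_apply j).comp ((measurable_pi_apply i).comp measurable_fst.snd)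
    have hmul : Measurable fun q : S × (Fin (n + 1) → Fin d → ℝ) =>
        (fun i => (H q.1 * Matrix.of q.2) i : Fin (n + 1) → Fin d → ℝ) := by
      refine measurable_pi_lambda _ fun i => measurable_pi_lambda _ fun j => ?_
      simp only [Matrix.mul_apply, Matrix.of_apply]
      refine Finset.measurable_sum _ fun l _ => ((hHm i l).comp measurable_fst).mul ?_
      exact (measurable_pi_apply j).comp ((measurable_pi_apply l).comp measurable_snd)
    have hG : Measurable fun q : (S × (Fin (n + 1) → Fin d → ℝ)) × ℝ => G q.1.1 q.1.2 q.2 :=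
      hA.comp ((measurable_fst.fst.prodMk (hmul.comp measurable_fst)).prodMk measurable_snd)
    have hA1 (ω : S) : Measurable fun y => ∫⁻ r, A ω y r :=
      Measurable.lintegral_prod_right' (ν := (volume : Measure ℝ))
        (f := fun q : (Fin (n + 1) → Fin d → ℝ) × ℝ => A ω q.1 q.2)
        (hA.comp ((measurable_const.prodMk measurable_fst).prodMk measurable_snd))
    have hG1 (ω : S) : Measurable fun y => ∫⁻ r, G ω y r :=
      Measurable.lintegral_prod_right' (ν := (volume : Measure ℝ))
        (f := fun q : (Fin (n + 1) → Fin d → ℝ) × ℝ => G ω q.1 q.2)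
        (hG.comp ((measurable_const.prodMk measurable_fst).prodMk measurable_snd))
    have hcons : Measurable fun q : (Fin n → Fin d → ℝ) × (Fin d → ℝ) =>
        (Fin.cons q.2 q.1 : Fin (n + 1) → Fin d → ℝ) := by
      refine measurable_pi_lambda _ fun i => ?_
      refine Fin.cases ?_ (fun i => ?_) i
      · exact measurable_snd
      · exact (measurable_pi_apply i).comp measurable_fst
    have hG2 (ω : S) : Measurable fun y : Fin n → Fin d → ℝ =>
        ∫⁻ ρ : Fin d → ℝ, ∫⁻ r, G ω (Fin.cons ρ y) r :=
      Measurable.lintegral_prod_right' (ν := (volume : Measure (Fin d → ℝ)))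
        (f := fun q : (Fin n → Fin d → ℝ) × (Fin d → ℝ) => ∫⁻ r, G ω (Fin.cons q.2 q.1) r)
        ((hG1 ω).comp hcons)
    have hR : Measurable fun q : (S × Ω) × (UpperIndex (d + 1) → ℝ) =>
        (∏ i : Fin (d + 1), ENNReal.ofReal (|q.2 (diagIdx i)| ^ (n + 1 - 1 - i.1))) *
          f fun i => (H q.1.1 * extendOne (κ q.1.2) * padMat (n + 1) q.2) i := by
      refine Measurable.mul (Finset.measurable_prod _ fun i _ => ?_)
        (hf.comp (measurable_pi_lambda _ fun i => measurable_pi_lambda _ fun j => ?_))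
      · have : Measurable fun q : (S × Ω) × (UpperIndex (d + 1) → ℝ) => q.2 (diagIdx i) :=
          (measurable_pi_apply _).comp measurable_snd
        exact ((measurable_norm.comp this).pow_const _).ennreal_ofReal
      · change Measurable fun q : (S × Ω) × (UpperIndex (d + 1) → ℝ) =>
          ∑ l, (H q.1.1 * extendOne (κ q.1.2)) i l * padMat (n + 1) q.2 l j
        refine Finset.measurable_sum _ fun l _ => ((hm i l).comp measurable_fst).mul ?_
        exact (measurable_padMat (n + 1) l j).comp measurable_snd
    have hfib (ω : S) : ∫⁻ y, ∫⁻ r, A ω y r = ∫⁻ k, (∫⁻ x : UpperIndex (d + 1) → ℝ,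
        (∏ i : Fin (d + 1), ENNReal.ofReal (|x (diagIdx i)| ^ (n + 1 - 1 - i.1))) *
          f fun i => (H ω * extendOne (κ k) * padMat (n + 1) x) i) ∂ν := by
      calc ∫⁻ y, ∫⁻ r, A ω y r = ∫⁻ y, ∫⁻ r, G ω y r :=
            ((measurePreserving_mul_left (hH ω)).lintegral_comp (hA1 ω)).symm
        _ = ∫⁻ y : Fin n → Fin d → ℝ, ∫⁻ ρ : Fin d → ℝ, ∫⁻ r, G ω (Fin.cons ρ y) r :=
            lintegral_row (hG1 ω)
        _ = ∫⁻ k, (∫⁻ x : UpperIndex d → ℝ,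
              (∏ i : Fin d, ENNReal.ofReal (|x (diagIdx i)| ^ (n - 1 - i.1))) *
              ∫⁻ ρ : Fin d → ℝ, ∫⁻ r, G ω (Fin.cons ρ fun i => (κ k * padMat n x) i) r) ∂ν :=
            hκf _ (hG2 ω)
        _ = _ := by
            refine lintegral_congr fun k => ?_
            have hRk := hR.comp ((measurable_const (a := (ω, k))).prodMk
              (measurable_id (α := UpperIndex (d + 1) → ℝ)))
            refine Eq.trans (lintegral_congr fun x => ?_) (lintegral_glue hRk).symm
            have hGx : Measurable fun q : (Fin d → ℝ) × ℝ =>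
                G ω (Fin.cons q.1 fun i => (κ k * padMat n x) i) q.2 :=
              hG.comp ((measurable_const.prodMk (hcons.comp
                (measurable_const.prodMk measurable_fst))).prodMk measurable_snd)
            rw [← lintegral_const_mul _ hGx.lintegral_prod_right']
            refine lintegral_congr fun ρ => ?_
            have hGr : Measurable fun r =>
                G ω (Fin.cons ρ fun i => (κ k * padMat n x) i) r :=
              hGx.comp (measurable_const.prodMk measurable_id)
            rw [← lintegral_const_mul _ hGr]
            refine lintegral_congr fun r => ?_
            simp only [Function.comp, id, hGdef, hAdef, Fin.prod_univ_succ, glue_diagIdx_zero,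
              glue_diagIdx_succ, mul_extendOne_mul_padMat, Fin.val_zero, Fin.val_succ,
              Nat.add_sub_cancel, Nat.sub_zero]
            have h (i : Fin d) : n - (i.1 + 1) = n - 1 - i.1 := by omega
            simp only [h]
            rw [← mul_assoc, mul_comm (∏ i : Fin d, _)]
    rw [lintegral_column hf, lintegral_prod _ hR.lintegral_prod_right'.aemeasurable,
      ← lintegral_congr hfib]
    refine Eq.trans (lintegral_congr fun y => ?_) (lintegral_lintegral_swap (μ := volume)
      (f := fun y ω => ∫⁻ r, A ω y r) ?_)
    · refine hHf _ (hf.comp (measurable_pi_lambda _ fun i => measurable_pi_lambda _ fun j => ?_))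
      refine Fin.cases ?_ (fun j => ?_) j
      · exact measurable_pi_apply i
      · exact measurable_const
    · exact (hA.lintegral_prod_right'.comp measurable_swap).aemeasurable

/-! ### The relative invariants in triangular coordinates -/

/-- The first `d` columns of the identity matrix of size `n`. -/
def firstColumns {n d : ℕ} (hd : d ≤ n) : Matrix (Fin n) (Fin d) ℝ :=
  (1 : Matrix (Fin n) (Fin n) ℝ).submatrix id (Fin.castLE hd)

lemma firstColumns_transpose_mul_self {n d : ℕ} (hd : d ≤ n) :
    (firstColumns hd).transpose * firstColumns hd = 1 := by
  ext i j
  simp [firstColumns, Matrix.mul_apply, Matrix.one_apply]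

lemma padMat_eq_firstColumns_mul {n d : ℕ} (hd : d ≤ n) (x : UpperIndex d → ℝ) :
    padMat n x = firstColumns hd * triMat x := by
  ext i j
  simp only [firstColumns, Matrix.mul_apply, Matrix.submatrix_apply, id, Matrix.one_apply,
    ite_mul, one_mul, zero_mul]
  by_cases hi : i.1 < d
  · rw [Finset.sum_eq_single ⟨i.1, hi⟩]
    · exact (if_pos (show i = Fin.castLE hd ⟨i.1, hi⟩ from rfl)).symm
    · intro l _ hl
      refine if_neg fun h => ?_
      exact hl (Fin.ext (congrArg Fin.val h).symm)
    · simp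
  · rw [Finset.sum_eq_zero]
    · simp only [padMat, Matrix.of_apply]
      exact dif_neg (by omega)
    · intro l _
      refine if_neg fun h => hi ?_
      rw [h]
      exact l.2

/-- An upper triangular matrix preserves the span of the first `d` basis vectors. -/
lemma triMat_mul_firstColumns {n d : ℕ} (hd : d ≤ n) (t : UpperIndex n → ℝ) :
    triMat t * firstColumns hd =
      firstColumns hd * (triMat t).submatrix (Fin.castLE hd) (Fin.castLE hd) := by
  ext i j
  simp only [firstColumns, Matrix.mul_apply, Matrix.submatrix_apply, id, Matrix.one_apply,
    ite_mul, one_mul, zero_mul, mul_ite, mul_one, mul_zero, Finset.sum_ite_eq',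
    Finset.mem_univ, if_true]
  by_cases hi : i.1 < d
  · rw [Finset.sum_eq_single ⟨i.1, hi⟩]
    · simp
    · intro l _ hl
      refine if_neg fun h => ?_
      exact hl (Fin.ext (congrArg Fin.val h).symm)
    · simp
  · rw [Finset.sum_eq_zero]
    · simp only [triMat, Matrix.of_apply]
      exact dif_neg (by rw [Fin.le_def, Fin.val_castLE]; omega)
    · intro l _
      refine if_neg fun h => hi ?_
      rw [h]
      exact l.2

lemma det_triMat_submatrix {n d : ℕ} (hd : d ≤ n) (t : UpperIndex n → ℝ) :
    ((triMat t).submatrix (Fin.castLE hd) (Fin.castLE hd)).det =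
      ∏ j : Fin d, t (diagIdx (Fin.castLE hd j)) := by
  rw [Matrix.det_of_isUpperTriangular]
  · simp [triMat, diagIdx]
  · intro i j h
    have h' : (Fin.castLE hd j) < Fin.castLE hd i := h
    exact dif_neg (not_le.2 h')

lemma P₁_eq_sq {n d : ℕ} {w : W n d} {A : Matrix (Fin n) (Fin n) ℝ}
    (hz : (w.1 : Matrix (Fin n) (Fin n) ℝ) = A * A.transpose) : P₁ w = A.det ^ 2 := by
  rw [P₁, hz, Matrix.det_mul, Matrix.det_transpose, pow_two]

lemma P₂_eq_of_eq_mul {n d : ℕ} {w : W n d} {A : Matrix (Fin n) (Fin n) ℝ}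
    {B : Matrix (Fin n) (Fin d) ℝ} (hz : (w.1 : Matrix (Fin n) (Fin n) ℝ) = A * A.transpose)
    (hy : w.2 = A * B) : P₂ w = A.det ^ 2 * (B.transpose * B).det := by
  have h : Matrix.fromBlocks (w.1 : Matrix (Fin n) (Fin n) ℝ) w.2 w.2.transpose 0 =
      Matrix.fromBlocks A 0 0 1 * Matrix.fromBlocks 1 B B.transpose 0 *
        Matrix.fromBlocks A.transpose 0 0 1 := by
    simp [Matrix.fromBlocks_multiply, hz, hy]
  rw [P₂, h, Matrix.det_mul, Matrix.det_mul, Matrix.det_fromBlocks_zero₂₁,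
    Matrix.det_fromBlocks_zero₂₁, Matrix.det_fromBlocks_one₁₁, zero_sub, Matrix.det_neg,
    Matrix.det_one, Matrix.det_transpose, Fintype.card_fin]
  have h2 : (-1 : ℝ) ^ d * (-1) ^ d = 1 := by rw [← mul_pow]; simp
  linear_combination (A.det ^ 2 * (B.transpose * B).det) * h2

lemma det_sq_of_orthogonal {n : ℕ} {k : Matrix (Fin n) (Fin n) ℝ} (hk : k.transpose * k = 1) :
    k.det ^ 2 = 1 := by
  have h := congrArg Matrix.det hk
  rwa [Matrix.det_mul, Matrix.det_transpose, Matrix.det_one, ← pow_two] at h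

lemma P₁_coords {n d : ℕ} {k : Matrix (Fin n) (Fin n) ℝ} (hk : k.transpose * k = 1)
    (t : UpperIndex n → ℝ) {w : W n d} (hz : (w.1 : Matrix (Fin n) (Fin n) ℝ) =
      k * (triMat t * (triMat t).transpose) * k.transpose) :
    P₁ w = ∏ i, t (diagIdx i) ^ 2 := by
  have hz' : (w.1 : Matrix (Fin n) (Fin n) ℝ) = (k * triMat t) * (k * triMat t).transpose := by
    rw [hz, Matrix.transpose_mul]
    simp only [Matrix.mul_assoc]
  rw [P₁_eq_sq hz', Matrix.det_mul, mul_pow, det_sq_of_orthogonal hk, one_mul, det_triMat,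
    Finset.prod_pow]

lemma prod_ite_lt {n d : ℕ} (hd : d ≤ n) {R : Type*} [CommMonoid R] (g : Fin n → R) :
    ∏ i, g i = (∏ j : Fin d, g (Fin.castLE hd j)) * ∏ i : Fin n, if i.1 < d then 1 else g i := by
  have h : ∏ j : Fin d, g (Fin.castLE hd j) = ∏ i : Fin n, if i.1 < d then g i else 1 := by
    rw [← Finset.prod_filter]
    refine Finset.prod_bij (fun j _ => Fin.castLE hd j) (fun j _ => ?_) (fun i _ j _ h => ?_)
      (fun i hi => ?_) fun j _ => rfl
    · simp
    · exact Fin.castLE_injective hd h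
    · exact ⟨⟨i.1, (Finset.mem_filter.1 hi).2⟩, Finset.mem_univ _, rfl⟩
  rw [h, ← Finset.prod_mul_distrib]
  refine Finset.prod_congr rfl fun i _ => ?_
  split_ifs <;> simp

lemma P₂_coords {n d : ℕ} (hd : d ≤ n) {k : Matrix (Fin n) (Fin n) ℝ} (hk : k.transpose * k = 1)
    {t : UpperIndex n → ℝ} (ht : ∀ i, t (diagIdx i) ≠ 0) (r : UpperIndex d → ℝ) {w : W n d}
    (hz : (w.1 : Matrix (Fin n) (Fin n) ℝ) =
      k * (triMat t * (triMat t).transpose) * k.transpose) (hy : w.2 = k * padMat n r) :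
    P₂ w = (∏ i : Fin n, if i.1 < d then 1 else t (diagIdx i) ^ 2) *
      ∏ j, r (diagIdx j) ^ 2 := by
  set U := (triMat t).submatrix (Fin.castLE hd) (Fin.castLE hd) with hU
  have hUd : U.det ≠ 0 := by
    rw [hU, det_triMat_submatrix]
    exact Finset.prod_ne_zero_iff.2 fun j _ => ht _
  have hUu : IsUnit U.det := isUnit_iff_ne_zero.2 hUd
  have hz' : (w.1 : Matrix (Fin n) (Fin n) ℝ) = (k * triMat t) * (k * triMat t).transpose := by
    rw [hz, Matrix.transpose_mul]
    simp only [Matrix.mul_assoc]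
  have hy' : w.2 = (k * triMat t) * (firstColumns hd * (U⁻¹ * triMat r)) := by
    rw [hy, Matrix.mul_assoc, ← Matrix.mul_assoc (triMat t), triMat_mul_firstColumns, ← hU,
      Matrix.mul_assoc (firstColumns hd), ← Matrix.mul_assoc U, Matrix.mul_nonsing_inv _ hUu,
      Matrix.one_mul, padMat_eq_firstColumns_mul hd]
  have hq : (firstColumns hd * (U⁻¹ * triMat r)).transpose * (firstColumns hd * (U⁻¹ * triMat r)) =
      (U⁻¹ * triMat r).transpose * (U⁻¹ * triMat r) := by
    rw [Matrix.transpose_mul, Matrix.mul_assoc, ← Matrix.mul_assoc _ (firstColumns hd),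
      firstColumns_transpose_mul_self, Matrix.one_mul]
  have hdq : (U⁻¹ * triMat r).det * U.det = (triMat r).det := by
    rw [mul_comm, ← Matrix.det_mul, ← Matrix.mul_assoc, Matrix.mul_nonsing_inv _ hUu,
      Matrix.one_mul]
  have hT : (triMat t).det ^ 2 = U.det ^ 2 *
      ∏ i : Fin n, if i.1 < d then 1 else t (diagIdx i) ^ 2 := by
    rw [det_triMat, ← Finset.prod_pow, prod_ite_lt hd, hU, det_triMat_submatrix, Finset.prod_pow]
  rw [P₂_eq_of_eq_mul hz' hy', hq, Matrix.det_mul, mul_pow, det_sq_of_orthogonal hk, one_mul,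
    Matrix.det_mul, Matrix.det_transpose, hT, Finset.prod_pow Finset.univ 2 fun j => r (diagIdx j),
    ← det_triMat, ← hdq]
  ring

/-! ### The cone in triangular coordinates -/

lemma ae_diag_ne_zero (n : ℕ) : ∀ᵐ x : UpperIndex n → ℝ, ∀ i, x (diagIdx i) ≠ 0 :=
  ae_all_iff.2 fun i => Measure.ae_eval_ne (fun _ => volume) (diagIdx i) 0

/-- By QR decomposition, almost every `n × d`-matrix has full rank. -/
lemma ae_rank_eq {n d : ℕ} (hd : d ≤ n) :
    ∀ᵐ y : Fin n → Fin d → ℝ, (Matrix.of y).rank = d := by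
  obtain ⟨Ω, _, ν, _, κ, hκm, hκ, hκf⟩ := exists_lintegral_qr d n hd
  set D : (Fin n → Fin d → ℝ) → ℝ := fun y => ((Matrix.of y).transpose * Matrix.of y).det
  have hD : Continuous D := by
    have h : Continuous fun y : Fin n → Fin d → ℝ => Matrix.of y := continuous_id
    exact (h.matrix_transpose.matrix_mul h).matrix_det
  have hm : MeasurableSet {y | D y = 0} := hD.measurable (measurableSet_singleton 0)
  have h0 : volume {y | D y = 0} = 0 := by
    rw [← lintegral_indicator_one hm, hκf _ (measurable_one.indicator hm)]
    refine (lintegral_congr fun ω => ?_).trans lintegral_zero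
    refine lintegral_eq_zero_of_ae_eq_zero ?_
    filter_upwards [ae_diag_ne_zero d] with x hx
    have h1 : D (fun i => (κ ω * padMat n x) i) = (∏ i, x (diagIdx i)) ^ 2 := by
      change ((κ ω * padMat n x).transpose * (κ ω * padMat n x)).det = _
      rw [Matrix.transpose_mul, Matrix.mul_assoc, ← Matrix.mul_assoc _ (κ ω), hκ,
        Matrix.one_mul, padMat_eq_firstColumns_mul hd, Matrix.transpose_mul, Matrix.mul_assoc,
        ← Matrix.mul_assoc _ (firstColumns hd), firstColumns_transpose_mul_self, Matrix.one_mul,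
        Matrix.det_mul, Matrix.det_transpose, det_triMat, pow_two]
    have h2 : (fun i => (κ ω * padMat n x) i) ∉ {y | D y = 0} := by
      rw [Set.mem_ofPred_eq, h1]
      exact pow_ne_zero 2 (Finset.prod_ne_zero_iff.2 fun i _ => hx i)
    rw [Set.indicator_of_notMem h2, mul_zero]
    rfl
  have h1 : ∀ᵐ y, D y ≠ 0 := measure_eq_zero_iff_ae_notMem.1 h0
  filter_upwards [h1] with y hy
  rw [← Matrix.rank_transpose_mul_self, Matrix.rank_of_isUnit _
    ((Matrix.isUnit_iff_isUnit_det _).2 (isUnit_iff_ne_zero.2 hy)), Fintype.card_fin]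

lemma preimage_cone_ae_eq {n d : ℕ} (hd : d ≤ n) :
    (ofCoord ⁻¹' cone n d : Set (Coord n d)) =ᵐ[volume]
      {x : UpperIndex n → ℝ | (symOfCoord x : Matrix (Fin n) (Fin n) ℝ).PosDef} ×ˢ Set.univ := by
  have h : ∀ᵐ c : Coord n d, (Matrix.of c.2).rank = d :=
    Measure.quasiMeasurePreserving_snd.ae (ae_rank_eq hd)
  filter_upwards [h] with c hc
  refine propext ?_
  change (_ ∧ _) ↔ (_ ∧ _)
  simp only [ofCoord, hc, and_true, Set.mem_univ]
  rfl

/-- The point of `W`, in coordinates, obtained by letting the orthogonal matrix `k` act on the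
pair `(t tᵀ, r)` given by two triangular matrices. -/
def polarCoord (n d : ℕ) (k : Matrix (Fin n) (Fin n) ℝ)
    (v : (UpperIndex n → ℝ) × (UpperIndex d → ℝ)) : Coord n d :=
  (upperPart (k * (triMat v.1 * (triMat v.1).transpose) * k.transpose),
    fun i => (k * padMat n v.2) i)

/-- The Jacobian of the coordinates given by two triangular matrices. -/
noncomputable def jacobian (n d : ℕ) (v : (UpperIndex n → ℝ) × (UpperIndex d → ℝ)) : ENNReal :=
  (∏ i : Fin n, ENNReal.ofReal (|v.1 (diagIdx i)| ^ (i.1 + 1))) *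
    ∏ j : Fin d, ENNReal.ofReal (|v.2 (diagIdx j)| ^ (n - 1 - j.1))

lemma measurable_jacobian (n d : ℕ) : Measurable (jacobian n d) := by
  refine Measurable.mul (Finset.measurable_prod _ fun i _ => ?_)
    (Finset.measurable_prod _ fun j _ => ?_)
  · have h : Measurable fun v : (UpperIndex n → ℝ) × (UpperIndex d → ℝ) => v.1 (diagIdx i) :=
      (measurable_pi_apply _).comp measurable_fst
    exact ((measurable_norm.comp h).pow_const _).ennreal_ofReal
  · have h : Measurable fun v : (UpperIndex n → ℝ) × (UpperIndex d → ℝ) => v.2 (diagIdx j) :=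
      (measurable_pi_apply _).comp measurable_snd
    exact ((measurable_norm.comp h).pow_const _).ennreal_ofReal

lemma measurable_polarCoord {n d : ℕ} {Ω : Type*} [MeasurableSpace Ω]
    {κ : Ω → Matrix (Fin n) (Fin n) ℝ} (hκ : ∀ i j, Measurable fun ω => κ ω i j) :
    Measurable fun p : Ω × ((UpperIndex n → ℝ) × (UpperIndex d → ℝ)) =>
      polarCoord n d (κ p.1) p.2 := by
  refine Measurable.prodMk (measurable_pi_lambda _ fun q => ?_)
    (measurable_pi_lambda _ fun i => measurable_pi_lambda _ fun j => ?_)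
  · change Measurable fun p : Ω × ((UpperIndex n → ℝ) × (UpperIndex d → ℝ)) =>
      ∑ l, (∑ m, κ p.1 q.1.1 m * ∑ m', triMat p.2.1 m m' * triMat p.2.1 l m') * κ p.1 q.1.2 l
    refine Finset.measurable_sum _ fun l _ => Measurable.mul (Finset.measurable_sum _ fun m _ =>
      Measurable.mul ((hκ _ _).comp measurable_fst) (Finset.measurable_sum _ fun m' _ => ?_))
      ((hκ _ _).comp measurable_fst)
    exact ((measurable_triMat _ _).comp measurable_snd.fst).mul
      ((measurable_triMat _ _).comp measurable_snd.fst)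
  · change Measurable fun p : Ω × ((UpperIndex n → ℝ) × (UpperIndex d → ℝ)) =>
      ∑ l, κ p.1 i l * padMat n p.2.2 l j
    exact Finset.measurable_sum _ fun l _ => ((hκ _ _).comp measurable_fst).mul
      ((measurable_padMat n l j).comp measurable_snd.snd)

/-- Conjugation by an orthogonal matrix preserves positive definiteness. -/
lemma posDef_conj_iff {n : ℕ} {k z : Matrix (Fin n) (Fin n) ℝ} (hk : k.transpose * k = 1) :
    (k * z * k.transpose).PosDef ↔ z.PosDef := by
  have hu : IsUnit k := IsUnit.of_mul_eq_one_right _ hk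
  rw [← Matrix.conjTranspose_eq_transpose_of_trivial, ← Matrix.star_eq_conjTranspose,
    Matrix.IsUnit.posDef_star_right_conjugate_iff hu]

lemma isSymm_conj {n : ℕ} (k : Matrix (Fin n) (Fin n) ℝ) {z : Matrix (Fin n) (Fin n) ℝ}
    (hz : z.IsSymm) : (k * z * k.transpose).IsSymm := by
  rw [Matrix.IsSymm, Matrix.transpose_mul, Matrix.transpose_mul, Matrix.transpose_transpose,
    hz.eq, Matrix.mul_assoc]

lemma isSymm_triMat_mul_transpose {n : ℕ} (t : UpperIndex n → ℝ) :
    (triMat t * (triMat t).transpose).IsSymm := by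
  rw [Matrix.IsSymm, Matrix.transpose_mul, Matrix.transpose_transpose]

lemma measurable_upperPart_conj {n : ℕ} (k : Matrix (Fin n) (Fin n) ℝ) :
    Measurable fun t : UpperIndex n → ℝ =>
      upperPart (k * (triMat t * (triMat t).transpose) * k.transpose) := by
  refine measurable_pi_lambda _ fun q => ?_
  simp only [upperPart, Matrix.mul_apply, Matrix.transpose_apply]
  exact Finset.measurable_sum _ fun l _ => Measurable.mul_const (Finset.measurable_sum _ fun m _ =>
    Measurable.const_mul (Finset.measurable_sum _ fun m' _ =>
      (measurable_triMat _ _).mul (measurable_triMat _ _)) _) _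

lemma lintegral_posDef_conj {n : ℕ} {k : Matrix (Fin n) (Fin n) ℝ} (hk : k.transpose * k = 1)
    {g : (UpperIndex n → ℝ) → ENNReal} (hg : Measurable g) :
    ∫⁻ x in {x | (symOfCoord x : Matrix (Fin n) (Fin n) ℝ).PosDef}, g x =
      ∫⁻ t, (∏ i, ENNReal.ofReal (|t (diagIdx i)| ^ (i.1 + 1))) *
        g (upperPart (k * (triMat t * (triMat t).transpose) * k.transpose)) := by
  have hconj := measurePreserving_conj hk
  have hpre : (fun x : UpperIndex n → ℝ => upperPart
      (k * (symOfCoord x : Matrix (Fin n) (Fin n) ℝ) * k.transpose)) ⁻¹'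
      {x | (symOfCoord x : Matrix (Fin n) (Fin n) ℝ).PosDef} =
      {x | (symOfCoord x : Matrix (Fin n) (Fin n) ℝ).PosDef} := by
    ext x
    rw [Set.mem_preimage, Set.mem_ofPred_eq, Set.mem_ofPred_eq,
      symOfCoord_upperPart (isSymm_conj k (isSymm_symOfCoord x)), posDef_conj_iff hk]
  have h := hconj.setLIntegral_comp_preimage (measurableSet_posDef n) hg
  rw [hpre] at h
  refine h.symm.trans ((lintegral_posDef n (hg.comp hconj.measurable)).trans ?_)
  simp only [Function.comp, symOfCoord_upperPart (isSymm_triMat_mul_transpose _)]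

lemma lintegral_cone_eq {n d : ℕ} (hd : d ≤ n) {f : Coord n d → ENNReal} (hf : Measurable f) :
    ∫⁻ c in ofCoord ⁻¹' cone n d, f c = ∫⁻ y : Fin n → Fin d → ℝ,
      ∫⁻ x in {x | (symOfCoord x : Matrix (Fin n) (Fin n) ℝ).PosDef}, f (x, y) := by
  have hrestr : (volume : Measure (Coord n d)).restrict
      ({x | (symOfCoord x : Matrix (Fin n) (Fin n) ℝ).PosDef} ×ˢ Set.univ) =
      (volume.restrict {x | (symOfCoord x : Matrix (Fin n) (Fin n) ℝ).PosDef}).prod volume := by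
    rw [Measure.volume_eq_prod, ← Measure.prod_restrict, Measure.restrict_univ]
  rw [setLIntegral_congr (preimage_cone_ae_eq hd), hrestr,
    lintegral_prod_symm _ hf.aemeasurable]

lemma lintegral_posDef_polarCoord {n d : ℕ} {k : Matrix (Fin n) (Fin n) ℝ}
    (hk : k.transpose * k = 1) {f : Coord n d → ENNReal} (hf : Measurable f)
    (r : UpperIndex d → ℝ) :
    (∏ i : Fin d, ENNReal.ofReal (|r (diagIdx i)| ^ (n - 1 - i.1))) *
        ∫⁻ x in {x | (symOfCoord x : Matrix (Fin n) (Fin n) ℝ).PosDef},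
          f (x, fun i => (k * padMat n r) i) =
      ∫⁻ t, jacobian n d (t, r) * f (polarCoord n d k (t, r)) := by
  have hfy : Measurable fun x : UpperIndex n → ℝ => f (x, fun i => (k * padMat n r) i) :=
    hf.comp (measurable_id.prodMk measurable_const)
  have hm : Measurable fun t : UpperIndex n → ℝ =>
      (∏ i, ENNReal.ofReal (|t (diagIdx i)| ^ (i.1 + 1))) * f (upperPart
        (k * (triMat t * (triMat t).transpose) * k.transpose), fun i => (k * padMat n r) i) := by
    refine Measurable.mul (Finset.measurable_prod _ fun i _ => ?_)
      (hfy.comp (measurable_upperPart_conj k))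
    have h : Measurable fun v : UpperIndex n → ℝ => v (diagIdx i) := measurable_pi_apply _
    exact ((measurable_norm.comp h).pow_const _).ennreal_ofReal
  rw [lintegral_posDef_conj hk hfy, ← lintegral_const_mul _ hm]
  refine lintegral_congr fun t => ?_
  simp only [jacobian, polarCoord]
  ring

lemma lintegral_fiber {n d : ℕ} {k : Matrix (Fin n) (Fin n) ℝ}
    (hk : k.transpose * k = 1) {f : Coord n d → ENNReal} (hf : Measurable f) :
    (∫⁻ r : UpperIndex d → ℝ, (∏ i : Fin d, ENNReal.ofReal (|r (diagIdx i)| ^ (n - 1 - i.1))) *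
        ∫⁻ x in {x | (symOfCoord x : Matrix (Fin n) (Fin n) ℝ).PosDef},
          f (x, fun i => (k * padMat n r) i)) =
      ∫⁻ v, jacobian n d v * f (polarCoord n d k v) := by
  have hp : Measurable (polarCoord n d k) := Measurable.of_uncurry_left
    (f := fun _ : Unit => polarCoord n d k) (x := ())
    (measurable_polarCoord (κ := fun _ : Unit => k) fun _ _ => measurable_const)
  have hm := (measurable_jacobian n d).mul (hf.comp hp)
  have h := lintegral_prod_symm (μ := (volume : Measure (UpperIndex n → ℝ)))
    (ν := (volume : Measure (UpperIndex d → ℝ))) _ hm.aemeasurable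
  refine Eq.trans (lintegral_congr fun r => ?_) h.symm
  exact lintegral_posDef_polarCoord hk hf r

/-- Integration over the enhanced cone in coordinates given by two triangular matrices and an
orthogonal matrix: the QR decomposition `y = k r`, followed by the Cholesky decomposition
`kᵀ z k = t tᵀ`. -/
theorem exists_lintegral_cone {n d : ℕ} (hd : d ≤ n) : ∃ (Ω : Type) (_ : MeasurableSpace Ω)
    (ν : Measure Ω) (_ : IsFiniteMeasure ν) (κ : Ω → Matrix (Fin n) (Fin n) ℝ),
    (∀ i j, Measurable fun ω => κ ω i j) ∧ (∀ ω, (κ ω).transpose * κ ω = 1) ∧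
    ∀ f : Coord n d → ENNReal, Measurable f → ∫⁻ c in ofCoord ⁻¹' cone n d, f c =
      ∫⁻ p, jacobian n d p.2 * f (polarCoord n d (κ p.1) p.2) ∂(ν.prod volume) := by
  obtain ⟨Ω, _, ν, _, κ, hκm, hκ, hκf⟩ := exists_lintegral_qr d n hd
  refine ⟨Ω, inferInstance, ν, inferInstance, κ, hκm, hκ, fun f hf => ?_⟩
  have hy : Measurable fun y : Fin n → Fin d → ℝ =>
      ∫⁻ x in {x | (symOfCoord x : Matrix (Fin n) (Fin n) ℝ).PosDef}, f (x, y) :=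
    Measurable.lintegral_prod_left' hf
  have hm : Measurable fun p : Ω × ((UpperIndex n → ℝ) × (UpperIndex d → ℝ)) =>
      jacobian n d p.2 * f (polarCoord n d (κ p.1) p.2) :=
    ((measurable_jacobian n d).comp measurable_snd).mul (hf.comp (measurable_polarCoord hκm))
  rw [lintegral_cone_eq hd hf, hκf _ hy, lintegral_prod _ hm.aemeasurable]
  refine lintegral_congr fun ω => ?_
  exact lintegral_fiber (hκ ω) hf

/-- The Bochner integral over the enhanced cone, in the same coordinates. -/
theorem integral_cone_eq {n d : ℕ} {Ω : Type} [MeasurableSpace Ω] {ν : Measure Ω}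
    [IsFiniteMeasure ν] {κ : Ω → Matrix (Fin n) (Fin n) ℝ}
    (hκ : ∀ i j, Measurable fun ω => κ ω i j)
    (h : ∀ f : Coord n d → ENNReal, Measurable f → ∫⁻ c in ofCoord ⁻¹' cone n d, f c =
      ∫⁻ p, jacobian n d p.2 * f (polarCoord n d (κ p.1) p.2) ∂(ν.prod volume))
    {G : Coord n d → ℂ} (hG : IntegrableOn G (ofCoord ⁻¹' cone n d)) :
    ∫ c in ofCoord ⁻¹' cone n d, G c =
      ∫ v, (jacobian n d v).toReal • ∫ ω, G (polarCoord n d (κ ω) v) ∂ν := by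
  set Φ : Ω × ((UpperIndex n → ℝ) × (UpperIndex d → ℝ)) → Coord n d :=
    fun p => polarCoord n d (κ p.1) p.2
  have hΦ : Measurable Φ := measurable_polarCoord hκ
  set J : Ω × ((UpperIndex n → ℝ) × (UpperIndex d → ℝ)) → ENNReal := fun p => jacobian n d p.2
  have hJ : Measurable J := (measurable_jacobian n d).comp measurable_snd
  have hJt : ∀ᵐ p ∂(ν.prod volume), J p < ⊤ := Eventually.of_forall fun p =>
    ENNReal.mul_lt_top (ENNReal.prod_lt_top fun i _ => ENNReal.ofReal_lt_top)
      (ENNReal.prod_lt_top fun i _ => ENNReal.ofReal_lt_top)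
  have hμ : (volume : Measure (Coord n d)).restrict (ofCoord ⁻¹' cone n d) =
      ((ν.prod volume).withDensity J).map Φ := by
    refine Measure.ext_of_lintegral _ fun f hf => ?_
    rw [h f hf, lintegral_map hf hΦ]
    exact (lintegral_withDensity_eq_lintegral_mul _ hJ (hf.comp hΦ)).symm
  have hG' : Integrable G (((ν.prod volume).withDensity J).map Φ) := hμ ▸ hG
  have hG2 : Integrable (fun p => (J p).toReal • G (Φ p)) (ν.prod volume) :=
    (integrable_withDensity_iff_integrable_smul' hJ hJt).1 (hG'.comp_measurable hΦ)
  rw [hμ, integral_map hΦ.aemeasurable hG'.aestronglyMeasurable,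
    integral_withDensity_eq_integral_toReal_smul hJ hJt, integral_prod_symm _ hG2]
  refine integral_congr_ae (Eventually.of_forall fun v => ?_)
  exact integral_smul (jacobian n d v).toReal fun ω => G (polarCoord n d (κ ω) v)

/-! ### Schwartz functions on the coordinate space -/

lemma exists_schwartz_coord {n d : ℕ} (φ : 𝓢(W n d, ℂ)) :
    ∃ h : 𝓢(Coord n d, ℂ), ∀ c, h c = φ (ofCoord c) := by
  let L : Coord n d ≃ₗ[ℝ] W n d :=
    { toFun := ofCoord
      map_add' := fun _ _ => rfl
      map_smul' := fun _ _ => rfl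
      invFun := fun w => (upperPart w.1.1, w.2)
      left_inv := fun c => Prod.ext (upperPart_symOfCoord c.1) rfl
      right_inv := fun w => Prod.ext (Subtype.ext (symOfCoord_upperPart w.1.2)) rfl }
  exact ⟨SchwartzMap.compCLMOfContinuousLinearEquiv ℝ L.toContinuousLinearEquiv φ, fun c => rfl⟩

/-- The action `(z, y) ↦ (k z kᵀ, k y)` of `n × n`-matrices, in coordinates. -/
noncomputable def actCoord (n d : ℕ) (k : Matrix (Fin n) (Fin n) ℝ) :
    Coord n d →L[ℝ] Coord n d :=
  LinearMap.toContinuousLinearMap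
    { toFun := fun c => (upperPart (k * (symOfCoord c.1 : Matrix (Fin n) (Fin n) ℝ) * k.transpose),
        fun i => (k * Matrix.of c.2) i)
      map_add' := fun a b => by
        have h : (symOfCoord (a + b).1 : Matrix (Fin n) (Fin n) ℝ) =
          symOfCoord a.1 + symOfCoord b.1 := rfl
        have h' : Matrix.of (a + b).2 = Matrix.of a.2 + Matrix.of b.2 := rfl
        rw [h, h', Matrix.mul_add, Matrix.add_mul, Matrix.mul_add]
        rfl
      map_smul' := fun c a => by
        have h : (symOfCoord (c • a).1 : Matrix (Fin n) (Fin n) ℝ) =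
          c • (symOfCoord a.1 : Matrix (Fin n) (Fin n) ℝ) := rfl
        have h' : Matrix.of (c • a).2 = c • Matrix.of a.2 := rfl
        rw [h, h', Matrix.mul_smul, Matrix.smul_mul, Matrix.mul_smul]
        rfl }

lemma actCoord_apply {n d : ℕ} (k : Matrix (Fin n) (Fin n) ℝ) (c : Coord n d) :
    actCoord n d k c = (upperPart (k * (symOfCoord c.1 : Matrix (Fin n) (Fin n) ℝ) * k.transpose),
        fun i => (k * Matrix.of c.2) i) := rfl

lemma actCoord_transpose_actCoord {n d : ℕ} {k : Matrix (Fin n) (Fin n) ℝ}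
    (hk : k.transpose * k = 1) (c : Coord n d) :
    actCoord n d k.transpose (actCoord n d k c) = c := by
  rw [actCoord_apply, actCoord_apply]
  refine Prod.ext ?_ ?_
  · simp only []
    rw [symOfCoord_upperPart (isSymm_conj k (isSymm_symOfCoord c.1)), Matrix.transpose_transpose]
    have h : k.transpose * (k * (symOfCoord c.1 : Matrix (Fin n) (Fin n) ℝ) * k.transpose) * k =
        (k.transpose * k) * (symOfCoord c.1 : Matrix (Fin n) (Fin n) ℝ) * (k.transpose * k) := by
      simp only [Matrix.mul_assoc]
    rw [h, hk, Matrix.one_mul, Matrix.mul_one, upperPart_symOfCoord]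
  · change k.transpose * (k * Matrix.of c.2) = c.2
    rw [← Matrix.mul_assoc, hk, Matrix.one_mul]
    rfl

lemma continuous_actCoord (n d : ℕ) :
    Continuous fun k : Fin n → Fin n → ℝ => actCoord n d (Matrix.of k) := by
  refine continuous_clm_apply.2 fun c => ?_
  refine Continuous.prodMk (continuous_pi fun q => ?_)
    (continuous_pi fun i => continuous_pi fun j => ?_)
  · change Continuous fun k : Fin n → Fin n → ℝ => ∑ l, (∑ m, k q.1.1 m *
      (symOfCoord c.1 : Matrix (Fin n) (Fin n) ℝ) m l) * k q.1.2 l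
    fun_prop
  · change Continuous fun k : Fin n → Fin n → ℝ => ∑ l, k i l * c.2 l j
    fun_prop

lemma abs_apply_le_one_of_orthogonal {n : ℕ} {k : Matrix (Fin n) (Fin n) ℝ}
    (hk : k.transpose * k = 1) (i j : Fin n) : |k i j| ≤ 1 := by
  have h := congrFun (congrFun hk j) j
  rw [Matrix.mul_apply, Matrix.one_apply_eq] at h
  have h2 : k i j ^ 2 ≤ 1 := by
    rw [← h, pow_two]
    exact Finset.single_le_sum (f := fun l => k.transpose j l * k l j)
      (fun l _ => mul_self_nonneg (k l j)) (Finset.mem_univ i)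
  exact (sq_le_one_iff_abs_le_one _).1 h2

lemma exists_norm_actCoord_le (n d : ℕ) : ∃ B : ℝ, 0 < B ∧
    ∀ k : Matrix (Fin n) (Fin n) ℝ, (∀ i j, |k i j| ≤ 1) → ‖actCoord n d k‖ ≤ B := by
  obtain ⟨B, hB⟩ := (isCompact_closedBall (0 : Fin n → Fin n → ℝ) 1).exists_bound_of_continuousOn
    (continuous_actCoord n d).continuousOn
  refine ⟨max B 1, by positivity, fun k hk => (hB k ?_).trans (le_max_left _ _)⟩
  refine mem_closedBall_zero_iff.2 ?_
  exact (pi_norm_le_iff_of_nonneg zero_le_one).2 fun i =>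
    (pi_norm_le_iff_of_nonneg zero_le_one).2 fun j => hk i j

/-- The average of a Schwartz function over a family of orthogonal matrices is a Schwartz
function. -/
lemma exists_schwartz_orthogonal_average {n d : ℕ} {Ω : Type} [MeasurableSpace Ω] (ν : Measure Ω)
    [IsFiniteMeasure ν] {κ : Ω → Matrix (Fin n) (Fin n) ℝ}
    (hκm : ∀ i j, Measurable fun ω => κ ω i j) (hκ : ∀ ω, (κ ω).transpose * κ ω = 1)
    (h : 𝓢(Coord n d, ℂ)) :
    ∃ F : 𝓢(Coord n d, ℂ), ∀ c, F c = ∫ ω, h (actCoord n d (κ ω) c) ∂ν := by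
  obtain ⟨B, hB0, hB⟩ := exists_norm_actCoord_le n d
  have hm : Measurable fun (ω : Ω) (i j : Fin n) => κ ω i j :=
    measurable_pi_lambda _ fun i => measurable_pi_lambda _ fun j => hκm i j
  have hκ' (ω : Ω) : ((κ ω).transpose).transpose * (κ ω).transpose = 1 := by
    rw [Matrix.transpose_transpose]
    exact mul_eq_one_comm.1 (hκ ω)
  refine exists_schwartz_average (A := fun ω => actCoord n d (κ ω)) h
    ((continuous_actCoord n d).comp_stronglyMeasurable hm.stronglyMeasurable)
    (fun ω => hB _ (abs_apply_le_one_of_orthogonal (hκ ω))) hB0 fun ω x => ?_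
  have h1 := (actCoord n d (κ ω).transpose).le_of_opNorm_le
    (hB _ (abs_apply_le_one_of_orthogonal (hκ' ω))) (actCoord n d (κ ω) x)
  rwa [actCoord_transpose_actCoord (hκ ω)] at h1

lemma polarCoord_eq_actCoord {n d : ℕ} (k : Matrix (Fin n) (Fin n) ℝ)
    (v : (UpperIndex n → ℝ) × (UpperIndex d → ℝ)) :
    polarCoord n d k v = actCoord n d k (polarCoord n d 1 v) := by
  rw [actCoord_apply, polarCoord, polarCoord]
  simp only [Matrix.one_mul, Matrix.transpose_one, Matrix.mul_one]
  rw [symOfCoord_upperPart (isSymm_triMat_mul_transpose v.1)]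
  rfl

lemma hasTemperateGrowth_coord {V : Type*} [NormedAddCommGroup V] [NormedSpace ℝ V] {n d : ℕ}
    {g : V → Coord n d} (h1 : ∀ p, (fun v => (g v).1 p).HasTemperateGrowth)
    (h2 : ∀ i j, (fun v => (g v).2 i j).HasTemperateGrowth) : g.HasTemperateGrowth := by
  have he : g = fun v => (∑ p, (g v).1 p • ((Pi.single p 1, 0) : Coord n d)) +
      ∑ i, ∑ j, (g v).2 i j • ((0, Pi.single i (Pi.single j 1)) : Coord n d) := by
    ext v p
    · simp [Prod.fst_sum, Pi.single_apply, Finset.sum_apply]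
    · simp [Prod.snd_sum, Pi.single_apply, Finset.sum_apply]
  rw [he]
  have hsm {f : V → ℝ} (hf : f.HasTemperateGrowth) (e : Coord n d) :
      (fun v => f v • e).HasTemperateGrowth := by
    exact ((ContinuousLinearMap.toSpanSingleton ℝ e).hasTemperateGrowth).comp hf
  exact (Function.HasTemperateGrowth.sum fun p _ => hsm (h1 p) _).add
    (Function.HasTemperateGrowth.sum fun i _ =>
      Function.HasTemperateGrowth.sum fun j _ => hsm (h2 i j) _)

lemma polarCoord_one {n d : ℕ} (v : (UpperIndex n → ℝ) × (UpperIndex d → ℝ)) :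
    polarCoord n d 1 v =
      (upperPart (triMat v.1 * (triMat v.1).transpose), fun i => padMat n v.2 i) := by
  rw [polarCoord, Matrix.transpose_one, Matrix.one_mul, Matrix.mul_one, Matrix.one_mul]

lemma hasTemperateGrowth_polarCoord_one (n d : ℕ) : (polarCoord n d 1).HasTemperateGrowth := by
  refine hasTemperateGrowth_coord (fun p => ?_) fun i j => ?_
  · simp only [polarCoord_one, upperPart, Matrix.mul_apply, Matrix.transpose_apply]
    have h (i j : Fin n) : (fun v : (UpperIndex n → ℝ) × (UpperIndex d → ℝ) =>
        triMat v.1 i j).HasTemperateGrowth := by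
      by_cases hij : i ≤ j
      · have h1 := ((ContinuousLinearMap.proj (R := ℝ) (φ := fun _ : UpperIndex n => ℝ)
          ⟨(i, j), hij⟩).comp (ContinuousLinearMap.fst ℝ (UpperIndex n → ℝ)
          (UpperIndex d → ℝ))).hasTemperateGrowth
        convert! h1 using 1
        ext v
        exact dif_pos hij
      · convert! Function.HasTemperateGrowth.zero using 1
        ext v
        exact dif_neg hij
    exact Function.HasTemperateGrowth.sum fun l _ => (h _ _).mul (h _ _)
  · simp only [polarCoord_one]
    by_cases hij : i.1 ≤ j.1
    · have h1 := ((ContinuousLinearMap.proj (R := ℝ) (φ := fun _ : UpperIndex d => ℝ)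
          ⟨(⟨i.1, hij.trans_lt j.2⟩, j), hij⟩).comp (ContinuousLinearMap.snd ℝ (UpperIndex n → ℝ)
          (UpperIndex d → ℝ))).hasTemperateGrowth
      convert! h1 using 1
      ext v
      exact dif_pos hij
    · convert! Function.HasTemperateGrowth.zero using 1
      ext v
      exact dif_neg hij

/-- The map sending a triangular matrix `t` to `t tᵀ` is proper, since the diagonal entries of
`t tᵀ` are the squared norms of the rows of `t`. -/
lemma norm_le_one_add_norm_polarCoord_one {n d : ℕ} (hd : d ≤ n)
    (v : (UpperIndex n → ℝ) × (UpperIndex d → ℝ)) : ‖v‖ ≤ 1 + ‖polarCoord n d 1 v‖ := by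
  have h0 : 0 ≤ ‖polarCoord n d 1 v‖ := norm_nonneg _
  refine max_le ?_ ?_
  · refine (pi_norm_le_iff_of_nonneg (by positivity)).2 fun p => ?_
    have h1 : ‖(polarCoord n d 1 v).1 (diagIdx p.1.1)‖ ≤ ‖polarCoord n d 1 v‖ :=
      (norm_le_pi_norm _ _).trans (norm_fst_le _)
    have h2 : (polarCoord n d 1 v).1 (diagIdx p.1.1) = ∑ l, triMat v.1 p.1.1 l ^ 2 := by
      rw [polarCoord_one]
      simp only [upperPart, diagIdx, Matrix.mul_apply, Matrix.transpose_apply, pow_two]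
    have h3 : v.1 p ^ 2 ≤ ∑ l, triMat v.1 p.1.1 l ^ 2 := by
      have h4 : triMat v.1 p.1.1 p.1.2 = v.1 p := dif_pos p.2
      rw [← h4]
      exact Finset.single_le_sum (f := fun l => triMat v.1 p.1.1 l ^ 2)
        (fun l _ => sq_nonneg _) (Finset.mem_univ p.1.2)
    rw [h2] at h1
    have h5 := (Real.le_norm_self _).trans h1
    rw [Real.norm_eq_abs]
    nlinarith [sq_abs (v.1 p), sq_nonneg (|v.1 p| - 1), abs_nonneg (v.1 p)]
  · refine (pi_norm_le_iff_of_nonneg (by positivity)).2 fun p => ?_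
    have h1 : ‖(polarCoord n d 1 v).2 (Fin.castLE hd p.1.1) p.1.2‖ ≤ ‖polarCoord n d 1 v‖ :=
      (norm_le_pi_norm _ _).trans ((norm_le_pi_norm _ _).trans (norm_snd_le _))
    have h2 : (polarCoord n d 1 v).2 (Fin.castLE hd p.1.1) p.1.2 = v.2 p := by
      rw [polarCoord_one]
      exact dif_pos (show p.1.1.1 ≤ p.1.2.1 from p.2)
    rw [h2] at h1
    linarith

lemma exists_schwartz_comp_polarCoord {n d : ℕ} (hd : d ≤ n) (F : 𝓢(Coord n d, ℂ)) :
    ∃ f : 𝓢((UpperIndex n → ℝ) × (UpperIndex d → ℝ), ℂ), ∀ v, f v = F (polarCoord n d 1 v) :=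
  ⟨SchwartzMap.compCLM ℝ (hasTemperateGrowth_polarCoord_one n d) ⟨1, 1, fun v => by
    rw [one_mul, pow_one]
    exact norm_le_one_add_norm_polarCoord_one hd v⟩ F, fun v => rfl⟩

/-! ### The zeta integral as a monomial integral -/

/-- The diagonal entries of two triangular matrices, as linear forms. -/
noncomputable def diagForm (n d : ℕ) :
    Fin n ⊕ Fin d → ((UpperIndex n → ℝ) × (UpperIndex d → ℝ)) →L[ℝ] ℝ :=
  Sum.elim
    (fun i => (ContinuousLinearMap.proj (R := ℝ) (φ := fun _ : UpperIndex n => ℝ)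
      (diagIdx i)).comp (ContinuousLinearMap.fst ℝ _ _))
    (fun j => (ContinuousLinearMap.proj (R := ℝ) (φ := fun _ : UpperIndex d => ℝ)
      (diagIdx j)).comp (ContinuousLinearMap.snd ℝ _ _))

lemma diagForm_inl {n d : ℕ} (i : Fin n) (v : (UpperIndex n → ℝ) × (UpperIndex d → ℝ)) :
    diagForm n d (Sum.inl i) v = v.1 (diagIdx i) := rfl

lemma diagForm_inr {n d : ℕ} (j : Fin d) (v : (UpperIndex n → ℝ) × (UpperIndex d → ℝ)) :
    diagForm n d (Sum.inr j) v = v.2 (diagIdx j) := rfl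

/-- The elementary diagonal matrices, dual to the forms `diagForm`. -/
noncomputable def diagVec (n d : ℕ) : Fin n ⊕ Fin d → (UpperIndex n → ℝ) × (UpperIndex d → ℝ) :=
  Sum.elim (fun i => (Pi.single (diagIdx i) 1, 0)) fun j => (0, Pi.single (diagIdx j) 1)

lemma diagIdx_injective (n : ℕ) : Function.Injective (diagIdx : Fin n → UpperIndex n) :=
  fun _ _ h => congrArg (fun p : UpperIndex n => p.1.1) h

lemma diagForm_diagVec (n d : ℕ) (i j : Fin n ⊕ Fin d) :
    diagForm n d i (diagVec n d j) = if i = j then 1 else 0 := by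
  rcases i with i | i <;> rcases j with j | j <;>
    simp [diagForm_inl, diagForm_inr, diagVec, Pi.single_apply, (diagIdx_injective _).eq_iff]

/-- The coefficients of `s₁` in the exponents of the monomial integral. -/
noncomputable def coeffFst (n d : ℕ) : Fin n ⊕ Fin d → ℝ := Sum.elim (fun _ => 1) fun _ => 0

/-- The coefficients of `s₂` in the exponents of the monomial integral. -/
noncomputable def coeffSnd (n d : ℕ) : Fin n ⊕ Fin d → ℝ :=
  Sum.elim (fun i => if i.1 < d then 0 else 1) fun _ => 1

/-- The constant terms of the exponents of the monomial integral. -/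
noncomputable def coeffConst (n d : ℕ) : Fin n ⊕ Fin d → ℝ :=
  Sum.elim (fun i => (i.1 + 2) / 2) fun j => (n - j.1) / 2

/-- The exponents of the monomial integral. -/
noncomputable def exponent (n d : ℕ) (s : ℂ × ℂ) (i : Fin n ⊕ Fin d) : ℂ :=
  coeffFst n d i * s.1 + coeffSnd n d i * s.2 + coeffConst n d i

lemma cpow_finset_prod {ι : Type*} (S : Finset ι) {b : ι → ℝ} (hb : ∀ i, 0 ≤ b i) (s : ℂ) :
    ((∏ i ∈ S, b i : ℝ) : ℂ) ^ s = ∏ i ∈ S, ((b i : ℝ) : ℂ) ^ s := by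
  classical
  induction S using Finset.induction_on with
  | empty => simp
  | insert i S hi ih =>
    rw [Finset.prod_insert hi, Finset.prod_insert hi, Complex.ofReal_mul,
      Complex.mul_cpow_ofReal_nonneg (hb i) (Finset.prod_nonneg fun j _ => hb j), ih]

lemma sq_cpow {x : ℝ} (hx : x ≠ 0) (s : ℂ) :
    ((x ^ 2 : ℝ) : ℂ) ^ s = ((|x| : ℝ) : ℂ) ^ (2 * s) := by
  rw [← sq_abs, pow_two, Complex.ofReal_mul, Complex.mul_cpow_ofReal_nonneg (abs_nonneg _)
    (abs_nonneg _), ← Complex.cpow_add _ _ (Complex.ofReal_ne_zero.2 (abs_ne_zero.2 hx)), two_mul]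

lemma jacobian_toReal {n d : ℕ} (v : (UpperIndex n → ℝ) × (UpperIndex d → ℝ)) :
    (jacobian n d v).toReal = (∏ i : Fin n, |v.1 (diagIdx i)| ^ (i.1 + 1)) *
      ∏ j : Fin d, |v.2 (diagIdx j)| ^ (n - 1 - j.1) := by
  rw [jacobian, ENNReal.toReal_mul, ENNReal.toReal_prod, ENNReal.toReal_prod]
  congr 1 <;> refine Finset.prod_congr rfl fun i _ => ENNReal.toReal_ofReal (by positivity)

/-- In triangular coordinates the zeta integrand is a monomial in the diagonal entries. -/
lemma weight_exponent {n d : ℕ} (hd : d ≤ n) {k : Matrix (Fin n) (Fin n) ℝ}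
    (hk : k.transpose * k = 1) {v : (UpperIndex n → ℝ) × (UpperIndex d → ℝ)}
    (ht : ∀ i, v.1 (diagIdx i) ≠ 0) (hr : ∀ i, v.2 (diagIdx i) ≠ 0) (s : ℂ × ℂ) :
    (((jacobian n d v).toReal : ℝ) : ℂ) * ((P₁ (ofCoord (polarCoord n d k v)) : ℂ) ^ s.1 *
      (P₂ (ofCoord (polarCoord n d k v)) : ℂ) ^ s.2) =
      weight (diagForm n d) (exponent n d s) v := by
  have hz : ((ofCoord (polarCoord n d k v)).1 : Matrix (Fin n) (Fin n) ℝ) =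
      k * (triMat v.1 * (triMat v.1).transpose) * k.transpose :=
    symOfCoord_upperPart (isSymm_conj k (isSymm_triMat_mul_transpose v.1))
  have hy : (ofCoord (polarCoord n d k v)).2 = k * padMat n v.2 := rfl
  rw [P₁_coords hk v.1 hz, P₂_coords hd hk ht v.2 hz hy, jacobian_toReal]
  have hmul {a b : ℝ} (ha : 0 ≤ a) (hb : 0 ≤ b) :
      ((a * b : ℝ) : ℂ) ^ s.2 = (a : ℂ) ^ s.2 * (b : ℂ) ^ s.2 := by
    rw [Complex.ofReal_mul, Complex.mul_cpow_ofReal_nonneg ha hb]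
  rw [cpow_finset_prod _ (fun i => sq_nonneg _),
    hmul (Finset.prod_nonneg fun i _ => by split_ifs <;> positivity)
      (Finset.prod_nonneg fun i _ => sq_nonneg _),
    cpow_finset_prod _ (fun i => sq_nonneg _),
    cpow_finset_prod _ (fun i => by split_ifs <;> positivity), weight, Fintype.prod_sum_type,
    Complex.ofReal_mul, Complex.ofReal_prod, Complex.ofReal_prod]
  have h1 : ∀ i : Fin n, ((|v.1 (diagIdx i)| ^ (i.1 + 1) : ℝ) : ℂ) *
      (((v.1 (diagIdx i) ^ 2 : ℝ) : ℂ) ^ s.1 *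
        ((if i.1 < d then 1 else v.1 (diagIdx i) ^ 2 : ℝ) : ℂ) ^ s.2) =
      ((|diagForm n d (Sum.inl i) v| : ℝ) : ℂ) ^ (2 * exponent n d s (Sum.inl i) - 1) := by
    intro i
    have h0 : ((|v.1 (diagIdx i)| : ℝ) : ℂ) ≠ 0 := Complex.ofReal_ne_zero.2 (abs_ne_zero.2 (ht i))
    rw [diagForm_inl, sq_cpow (ht i), Complex.ofReal_pow, ← Complex.cpow_natCast]
    split_ifs with hi
    · rw [Complex.ofReal_one, Complex.one_cpow, mul_one, ← Complex.cpow_add _ _ h0]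
      congr 1
      simp [exponent, coeffFst, coeffSnd, coeffConst, hi]
      ring
    · rw [sq_cpow (ht i), ← Complex.cpow_add _ _ h0, ← Complex.cpow_add _ _ h0]
      congr 1
      simp [exponent, coeffFst, coeffSnd, coeffConst, hi]
      ring
  have h2 : ∀ j : Fin d, ((|v.2 (diagIdx j)| ^ (n - 1 - j.1) : ℝ) : ℂ) *
      ((v.2 (diagIdx j) ^ 2 : ℝ) : ℂ) ^ s.2 =
      ((|diagForm n d (Sum.inr j) v| : ℝ) : ℂ) ^ (2 * exponent n d s (Sum.inr j) - 1) := by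
    intro j
    have h0 : ((|v.2 (diagIdx j)| : ℝ) : ℂ) ≠ 0 := Complex.ofReal_ne_zero.2 (abs_ne_zero.2 (hr j))
    have h3 : ((n - 1 - j.1 : ℕ) : ℂ) = n - 1 - j.1 := by
      have := j.2
      rw [Nat.cast_sub (by omega), Nat.cast_sub (by omega), Nat.cast_one]
    rw [diagForm_inr, sq_cpow (hr j), Complex.ofReal_pow, ← Complex.cpow_natCast,
      ← Complex.cpow_add _ _ h0, h3]
    congr 1
    simp [exponent, coeffFst, coeffSnd, coeffConst]
    ring
  rw [← Finset.prod_congr rfl fun i _ => h1 i, ← Finset.prod_congr rfl fun j _ => h2 j,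
    Finset.prod_mul_distrib, Finset.prod_mul_distrib, Finset.prod_mul_distrib]
  ring

/-- The zeta integral is a monomial integral of a Schwartz function on the space of pairs of
triangular matrices, namely of the average of `φ` over orthogonal matrices. -/
theorem exists_zetaIntegral_eq_monomialIntegral {n d : ℕ} (hd : d ≤ n) (φ : 𝓢(W n d, ℂ)) :
    ∃ f : 𝓢((UpperIndex n → ℝ) × (UpperIndex d → ℝ), ℂ), ∀ s, Converges φ s →
      zetaIntegral φ s = monomialIntegral volume (diagForm n d) f (exponent n d s) := by
  obtain ⟨Ω, _, ν, _, κ, hκm, hκ, hκf⟩ := exists_lintegral_cone hd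
  obtain ⟨h, hh⟩ := exists_schwartz_coord φ
  obtain ⟨F, hF⟩ := exists_schwartz_orthogonal_average ν hκm hκ h
  obtain ⟨f, hf⟩ := exists_schwartz_comp_polarCoord hd F
  refine ⟨f, fun s hs => ?_⟩
  rw [zetaIntegral, integral_cone_eq hκm hκf hs, monomialIntegral]
  have h1 : ∀ᵐ v : (UpperIndex n → ℝ) × (UpperIndex d → ℝ), ∀ i, v.1 (diagIdx i) ≠ 0 :=
    Measure.quasiMeasurePreserving_fst.ae (ae_diag_ne_zero n)
  have h2 : ∀ᵐ v : (UpperIndex n → ℝ) × (UpperIndex d → ℝ), ∀ i, v.2 (diagIdx i) ≠ 0 :=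
    Measure.quasiMeasurePreserving_snd.ae (ae_diag_ne_zero d)
  refine integral_congr_ae ?_
  filter_upwards [h1, h2] with v hv1 hv2
  rw [hf, hF, ← integral_mul_const, ← integral_smul]
  refine integral_congr_ae (Eventually.of_forall fun ω => ?_)
  simp only []
  rw [← weight_exponent hd (hκ ω) hv1 hv2, ← polarCoord_eq_actCoord, hh, integrand,
    Complex.real_smul]
  ring

lemma prod_inv_Gamma_exponent {n d : ℕ} (hd : d ≤ n) (s : ℂ × ℂ) :
    ∏ i, (Complex.Gamma (exponent n d s i))⁻¹ = (multiGamma d (s.1 + (d + 1) / 2) *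
      multiGamma d (s.2 + n / 2) * multiGamma (n - d) (s.1 + s.2 + (n + 1) / 2))⁻¹ := by
  obtain ⟨m, rfl⟩ := Nat.exists_eq_add_of_le hd
  rw [Finset.prod_inv_distrib, inv_inj, Fintype.prod_sum_type, Nat.add_sub_cancel_left]
  have h1 : ∏ j : Fin d, Complex.Gamma (exponent (d + m) d s (Sum.inr j)) =
      multiGamma d (s.2 + (d + m : ℕ) / 2) := by
    rw [multiGamma, ← Fin.prod_univ_eq_prod_range
      (fun j : ℕ => Complex.Gamma (s.2 + (d + m : ℕ) / 2 - j / 2))]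
    refine Finset.prod_congr rfl fun j _ => congrArg _ ?_
    simp [exponent, coeffFst, coeffSnd, coeffConst]
    ring
  have h2 : ∏ i : Fin (d + m), Complex.Gamma (exponent (d + m) d s (Sum.inl i)) =
      multiGamma d (s.1 + (d + 1) / 2) *
        multiGamma m (s.1 + s.2 + ((d + m : ℕ) + 1) / 2) := by
    rw [Fin.prod_univ_add, multiGamma, multiGamma, ← Finset.prod_range_reflect,
      ← Finset.prod_range_reflect _ m, ← Fin.prod_univ_eq_prod_range, ← Fin.prod_univ_eq_prod_range]
    congr 1
    · refine Finset.prod_congr rfl fun j _ => congrArg _ ?_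
      have h3 : ((d - 1 - j.1 : ℕ) : ℂ) = d - 1 - j.1 := by
        have := j.2
        rw [Nat.cast_sub (by omega), Nat.cast_sub (by omega), Nat.cast_one]
      simp [exponent, coeffFst, coeffSnd, coeffConst, h3]
      ring
    · refine Finset.prod_congr rfl fun j _ => congrArg _ ?_
      have h3 : ((m - 1 - j.1 : ℕ) : ℂ) = m - 1 - j.1 := by
        have := j.2
        rw [Nat.cast_sub (by omega), Nat.cast_sub (by omega), Nat.cast_one]
      simp [exponent, coeffFst, coeffSnd, coeffConst, h3]
      ring
  rw [h1, h2]
  ring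

/-! ### Convergence of the zeta integral -/

lemma exists_norm_cpow_le {V : Type*} [NormedAddCommGroup V] {p : V → ℝ} {C : ℝ} {M : ℕ}
    (hp : ∀ x, |p x| ≤ C * (1 + ‖x‖) ^ M) {s : ℂ} (hs : 0 ≤ s.re) :
    ∃ (C' : ℝ) (M' : ℕ), ∀ x, ‖(p x : ℂ) ^ s‖ ≤ C' * (1 + ‖x‖) ^ M' := by
  have hC : 0 ≤ C := by
    have h := (abs_nonneg _).trans (hp 0)
    simpa using h
  refine ⟨(1 + C) ^ ⌈s.re⌉₊ * Real.exp (Real.pi * |s.im|), M * ⌈s.re⌉₊, fun x => ?_⟩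
  have h1 : |p x| ≤ (1 + C) * (1 + ‖x‖) ^ M := by
    refine (hp x).trans ?_
    gcongr
    linarith
  have h2 : 1 ≤ (1 + C) * (1 + ‖x‖) ^ M :=
    one_le_mul_of_one_le_of_one_le (by linarith) (one_le_pow₀ (by linarith [norm_nonneg x]))
  have h3 : ‖(p x : ℂ)‖ ^ s.re ≤ ((1 + C) * (1 + ‖x‖) ^ M) ^ ⌈s.re⌉₊ := by
    rw [Complex.norm_real, Real.norm_eq_abs, ← Real.rpow_natCast]
    exact (Real.rpow_le_rpow (abs_nonneg _) h1 hs).trans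
      (Real.rpow_le_rpow_of_exponent_le h2 (Nat.le_ceil _))
  have h4 : -(Complex.arg (p x) * s.im) ≤ Real.pi * |s.im| := by
    refine (neg_le_abs _).trans ?_
    rw [abs_mul]
    exact mul_le_mul_of_nonneg_right (Complex.abs_arg_le_pi _) (abs_nonneg _)
  refine (Complex.norm_cpow_le _ _).trans ?_
  rw [div_eq_mul_inv, ← Real.exp_neg]
  calc _ ≤ ((1 + C) * (1 + ‖x‖) ^ M) ^ ⌈s.re⌉₊ * Real.exp (Real.pi * |s.im|) := by
        gcongr
    _ = _ := by
        rw [mul_pow, ← pow_mul]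
        ring

lemma abs_det_le_of_abs_le {m : Type*} [Fintype m] [DecidableEq m] {A : Matrix m m ℝ} {x : ℝ}
    (h : ∀ i j, |A i j| ≤ x) : |A.det| ≤ (Fintype.card m).factorial * x ^ Fintype.card m := by
  have := Matrix.det_le (abv := AbsoluteValue.abs) h
  simpa [nsmul_eq_mul] using this

lemma abs_symOfCoord_apply_le {n d : ℕ} (c : Coord n d) (i j : Fin n) :
    |(symOfCoord c.1 : Matrix (Fin n) (Fin n) ℝ) i j| ≤ 1 + ‖c‖ := by
  rw [symOfCoord_apply, ← Real.norm_eq_abs]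
  exact ((norm_le_pi_norm c.1 _).trans (norm_fst_le c)).trans (by linarith)

lemma abs_snd_apply_le {n d : ℕ} (c : Coord n d) (i : Fin n) (j : Fin d) :
    |c.2 i j| ≤ 1 + ‖c‖ := by
  rw [← Real.norm_eq_abs]
  exact ((norm_le_pi_norm (c.2 i) j).trans ((norm_le_pi_norm c.2 i).trans (norm_snd_le c))).trans
    (by linarith)

lemma abs_P₁_le {n d : ℕ} (c : Coord n d) :
    |P₁ (ofCoord c)| ≤ n.factorial * (1 + ‖c‖) ^ n := by
  have h := abs_det_le_of_abs_le (abs_symOfCoord_apply_le c)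
  rwa [Fintype.card_fin] at h

lemma abs_P₂_le {n d : ℕ} (c : Coord n d) :
    |P₂ (ofCoord c)| ≤ (n + d).factorial * (1 + ‖c‖) ^ (n + d) := by
  rw [P₂, abs_mul, abs_pow, abs_neg, abs_one, one_pow, one_mul]
  refine (abs_det_le_of_abs_le (x := 1 + ‖c‖) fun i j => ?_).trans (by simp)
  rcases i with i | i <;> rcases j with j | j
  · exact abs_symOfCoord_apply_le c i j
  · exact abs_snd_apply_le c i j
  · exact abs_snd_apply_le c j i
  · simp only [Matrix.fromBlocks_apply₂₂, Matrix.zero_apply, abs_zero]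
    positivity

lemma continuous_symOfCoord (n : ℕ) :
    Continuous fun x : UpperIndex n → ℝ => (symOfCoord x : Matrix (Fin n) (Fin n) ℝ) :=
  continuous_matrix fun i j => by
    simp only [symOfCoord_apply]
    exact continuous_apply _

lemma continuous_P₁ (n d : ℕ) : Continuous fun c : Coord n d => P₁ (ofCoord c) :=
  ((continuous_symOfCoord n).comp continuous_fst).matrix_det

lemma continuous_P₂ (n d : ℕ) : Continuous fun c : Coord n d => P₂ (ofCoord c) := by
  have h1 : Continuous fun c : Coord n d => (symOfCoord c.1 : Matrix (Fin n) (Fin n) ℝ) :=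
    (continuous_symOfCoord n).comp continuous_fst
  have h2 : Continuous fun c : Coord n d => Matrix.of c.2 := continuous_snd
  exact ((h1.matrix_fromBlocks h2 h2.matrix_transpose continuous_const).matrix_det).const_mul _

theorem converges_of_nonneg {n d : ℕ} (φ : 𝓢(W n d, ℂ)) {s : ℂ × ℂ} (h1 : 0 ≤ s.1.re)
    (h2 : 0 ≤ s.2.re) : Converges φ s := by
  obtain ⟨h, hh⟩ := exists_schwartz_coord φ
  obtain ⟨C₁, M₁, hC₁⟩ := exists_norm_cpow_le (abs_P₁_le (n := n) (d := d)) h1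
  obtain ⟨C₂, M₂, hC₂⟩ := exists_norm_cpow_le (abs_P₂_le (n := n) (d := d)) h2
  have hm : Measurable fun c : Coord n d =>
      (P₁ (ofCoord c) : ℂ) ^ s.1 * (P₂ (ofCoord c) : ℂ) ^ s.2 :=
    ((Complex.measurable_ofReal.comp (continuous_P₁ n d).measurable).pow_const _).mul
      ((Complex.measurable_ofReal.comp (continuous_P₂ n d).measurable).pow_const _)
  have : (volume : Measure (Fin n → Fin d → ℝ)).IsAddHaarMeasure :=
    Measure.pi.isAddHaarMeasure fun _ => volume
  have : (volume : Measure (Coord n d)).IsAddHaarMeasure :=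
    Measure.prod.instIsAddHaarMeasure volume volume
  have hint := integrable_schwartz_mul (volume : Measure (Coord n d)) hm.aestronglyMeasurable
    (C := C₁ * C₂) (M := M₁ + M₂) (fun c => by
      rw [norm_mul, pow_add]
      calc _ ≤ (C₁ * (1 + ‖c‖) ^ M₁) * (C₂ * (1 + ‖c‖) ^ M₂) :=
            mul_le_mul (hC₁ c) (hC₂ c) (norm_nonneg _) ((norm_nonneg _).trans (hC₁ c))
        _ = _ := by ring) h
  refine (hint.congr (Eventually.of_forall fun c => ?_)).integrableOn
  simp only [integrand, hh, mul_assoc]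

lemma P₁_pos {n d : ℕ} {w : W n d} (hw : w ∈ cone n d) : 0 < P₁ w := hw.1.det_pos

lemma P₂_pos {n d : ℕ} {w : W n d} (hw : w ∈ cone n d) : 0 < P₂ w := by
  obtain ⟨hz, hy⟩ := hw
  have hu : IsUnit (w.1 : Matrix (Fin n) (Fin n) ℝ).det := isUnit_iff_ne_zero.2 hz.det_pos.ne'
  let _ := (w.1 : Matrix (Fin n) (Fin n) ℝ).invertibleOfIsUnitDet hu
  have hinj : Function.Injective w.2.mulVec := by
    have h := LinearMap.finrank_range_add_finrank_ker w.2.mulVecLin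
    change w.2.rank + _ = _ at h
    rw [hy, Module.finrank_fin_fun, Nat.add_eq_left] at h
    exact LinearMap.ker_eq_bot.1 (Submodule.finrank_eq_zero.1 h)
  have hp := (hz.inv.conjTranspose_mul_mul_same hinj).det_pos
  rw [Matrix.conjTranspose_eq_transpose_of_trivial] at hp
  rw [P₂, Matrix.det_fromBlocks₁₁, Matrix.invOf_eq_nonsing_inv, zero_sub, Matrix.det_neg,
    Fintype.card_fin]
  have h2 : (-1 : ℝ) ^ d * (-1) ^ d = 1 := by rw [← mul_pow]; simp
  have h3 := mul_pos hz.det_pos hp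
  calc _ < _ := h3
    _ = _ := by linear_combination -((w.1 : Matrix (Fin n) (Fin n) ℝ).det *
        (w.2.transpose * (w.1 : Matrix (Fin n) (Fin n) ℝ)⁻¹ * w.2).det) * h2

/-! ### The gamma factor -/

lemma differentiable_inv_multiGamma (k : ℕ) {g : ℂ × ℂ → ℂ} (hg : Differentiable ℂ g) :
    Differentiable ℂ fun s => (multiGamma k (g s))⁻¹ := by
  simp only [multiGamma, ← Finset.prod_inv_distrib]
  refine differentiable_finset_prod _ fun j _ => ?_
  have h := Complex.differentiable_one_div_Gamma.comp (hg.sub_const ((j : ℂ) / 2))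
  simpa only [Function.comp_def, one_div] using h

lemma differentiable_inv_gammaFactor (n d : ℕ) :
    Differentiable ℂ fun s => (gammaFactor n d s)⁻¹ := by
  simp only [gammaFactor, mul_inv]
  have h1 := differentiable_inv_multiGamma d (g := fun s : ℂ × ℂ => s.1 + (d + 1) / 2) (by fun_prop)
  have h2 := differentiable_inv_multiGamma d (g := fun s : ℂ × ℂ => s.2 + (d + 1) / 2) (by fun_prop)
  have h3 := differentiable_inv_multiGamma d (g := fun s : ℂ × ℂ => s.2 + n / 2) (by fun_prop)
  have h4 := differentiable_inv_multiGamma (n - d)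
    (g := fun s : ℂ × ℂ => s.1 + s.2 + (n + 1) / 2) (by fun_prop)
  exact ((h1.mul h2).mul h3).mul h4

lemma multiGamma_ne_zero {k : ℕ} {α : ℂ} (h : ¬ IsMultiGammaPole k α) : multiGamma k α ≠ 0 :=
  Finset.prod_ne_zero_iff.2 fun j hj => Complex.Gamma_ne_zero fun m hm =>
    h ⟨j, Finset.mem_range.1 hj, m, hm⟩

lemma gammaFactor_ne_zero {n d : ℕ} {s : ℂ × ℂ} (hs : s ∉ gammaPoles n d) :
    gammaFactor n d s ≠ 0 := by
  simp only [gammaPoles, Set.mem_ofPred_eq, not_or] at hs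
  exact mul_ne_zero (mul_ne_zero (mul_ne_zero (multiGamma_ne_zero hs.1)
    (multiGamma_ne_zero hs.2.1)) (multiGamma_ne_zero hs.2.2.1)) (multiGamma_ne_zero hs.2.2.2)

lemma not_isMultiGammaPole {k : ℕ} {α : ℂ} (h : (k : ℝ) / 2 ≤ α.re) : ¬ IsMultiGammaPole k α := by
  rintro ⟨j, hj, m, hm⟩
  have h1 := congrArg Complex.re hm
  simp at h1
  have h2 : (j : ℝ) < k := Nat.cast_lt.2 hj
  have h3 : (0 : ℝ) ≤ m := Nat.cast_nonneg m
  linarith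

lemma not_eventually_inv_gammaFactor_eq_zero {n d : ℕ} (hd : d ≤ n) (s : ℂ × ℂ) :
    ¬ ((fun t => (gammaFactor n d t)⁻¹) =ᶠ[𝓝 s] 0) := by
  intro h
  have han : AnalyticOnNhd ℂ (fun t => (gammaFactor n d t)⁻¹) Set.univ := fun t _ =>
    analyticAt_of_differentiable (differentiable_inv_gammaFactor n d) t
  have h0 := han.eqOn_zero_of_preconnected_of_eventuallyEq_zero isPreconnected_univ
    (Set.mem_univ s) h (Set.mem_univ ((n : ℂ), (n : ℂ)))
  have hdn : (d : ℝ) ≤ n := Nat.cast_le.2 hd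
  have hd0 : (0 : ℝ) ≤ d := Nat.cast_nonneg d
  refine inv_ne_zero (gammaFactor_ne_zero ?_) h0
  simp only [gammaPoles, Set.mem_ofPred_eq, not_or]
  refine ⟨not_isMultiGammaPole ?_, not_isMultiGammaPole ?_, not_isMultiGammaPole ?_,
    not_isMultiGammaPole ?_⟩ <;> simp [Nat.cast_sub hd] <;> linarith

/-! ### The normalized zeta integral is entire -/

/-- The entire function of the theorem, up to its characterization: it is given by the normalized
zeta integral far to the right. -/
lemma exists_entire_eq_zetaIntegral {n d : ℕ} (hd : d ≤ n) (φ : 𝓢(W n d, ℂ)) :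
    ∃ E : ℂ × ℂ → ℂ, Differentiable ℂ E ∧
      ∀ s ∈ tube 1, E s = (gammaFactor n d s)⁻¹ * zetaIntegral φ s := by
  obtain ⟨f, hf⟩ := exists_zetaIntegral_eq_monomialIntegral hd φ
  have : (volume : Measure ((UpperIndex n → ℝ) × (UpperIndex d → ℝ))).IsAddHaarMeasure :=
    Measure.prod.instIsAddHaarMeasure volume volume
  have hdn : (d : ℝ) ≤ n := Nat.cast_le.2 hd
  obtain ⟨E, hE, hEs⟩ := exists_entire_normalizedIntegral volume (diagForm n d)
    (diagForm_diagVec n d) f (coeffFst n d) (coeffSnd n d) (coeffConst n d)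
    (fun i => by rcases i with i | i <;> simp [coeffFst])
    (fun i => by
      rcases i with i | i
      · simp only [coeffSnd, Sum.elim_inl]
        split_ifs <;> norm_num
      · simp [coeffSnd])
    (fun i => by
      rcases i with i | i
      · have : (0 : ℝ) ≤ i.1 := Nat.cast_nonneg _
        simp only [coeffConst, Sum.elim_inl]
        linarith
      · have : ((i.1 + 1 : ℕ) : ℝ) ≤ d := Nat.cast_le.2 i.2
        push_cast at this
        simp only [coeffConst, Sum.elim_inr]
        linarith)
    (fun i => by
      rcases i with i | i
      · simp only [coeffFst, coeffSnd, Sum.elim_inl]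
        split_ifs <;> norm_num
      · simp [coeffFst, coeffSnd])
  have hm := differentiable_inv_multiGamma d (g := fun s : ℂ × ℂ => s.2 + (d + 1) / 2) (by fun_prop)
  refine ⟨fun s => (multiGamma d (s.2 + (d + 1) / 2))⁻¹ * E s, hm.mul hE, fun s hs => ?_⟩
  have hc : Converges φ s :=
    converges_of_nonneg φ (zero_le_one.trans hs.1.le) (zero_le_one.trans hs.2.le)
  have h1 : E s = normalizedIntegral volume (diagForm n d) f (exponent n d s) := hEs s hs
  simp only []
  rw [h1, normalizedIntegral, prod_inv_Gamma_exponent hd, hf s hc, gammaFactor]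
  simp only [mul_inv]
  ring

lemma integrand_eq_mul_exp {n d : ℕ} (φ : 𝓢(W n d, ℂ)) (s : ℂ × ℂ) {w : W n d}
    (hw : w ∈ cone n d) : integrand φ s w =
      φ w * Complex.exp (s.1 * (Real.log (P₁ w) : ℝ) + s.2 * (Real.log (P₂ w) : ℝ)) := by
  have h1 : (P₁ w : ℂ) ≠ 0 := Complex.ofReal_ne_zero.2 (P₁_pos hw).ne'
  have h2 : (P₂ w : ℂ) ≠ 0 := Complex.ofReal_ne_zero.2 (P₂_pos hw).ne'
  rw [integrand, Complex.cpow_def_of_ne_zero h1, Complex.cpow_def_of_ne_zero h2, mul_assoc,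
    ← Complex.exp_add, Complex.ofReal_log (P₁_pos hw).le, Complex.ofReal_log (P₂_pos hw).le,
    mul_comm (Complex.log _), mul_comm (Complex.log _)]

lemma nullMeasurableSet_preimage_cone {n d : ℕ} (hd : d ≤ n) :
    NullMeasurableSet (ofCoord ⁻¹' cone n d : Set (Coord n d)) :=
  (((measurableSet_posDef n).prod MeasurableSet.univ).nullMeasurableSet).congr
    (preimage_cone_ae_eq hd).symm

/-- A bound for `G exp (t L)` which does not depend on `t` in the strip `0 ≤ Re t ≤ T`. -/
lemma norm_mul_exp_le {G : ℂ} {L T : ℝ} {t : ℂ} (h0 : 0 ≤ t.re) (hT : t.re ≤ T) :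
    ‖G * Complex.exp (t * L)‖ ≤ ‖G‖ + ‖G * Complex.exp ((T : ℂ) * L)‖ := by
  have h1 : Real.exp (t.re * L) ≤ 1 + Real.exp (T * L) := by
    rcases le_total L 0 with h | h
    · have : Real.exp (t.re * L) ≤ 1 := Real.exp_le_one_iff.2 (mul_nonpos_of_nonneg_of_nonpos h0 h)
      linarith [Real.exp_pos (T * L)]
    · have := Real.exp_le_exp.2 (mul_le_mul_of_nonneg_right hT h)
      linarith
  rw [norm_mul, norm_mul, Complex.norm_exp, Complex.norm_exp]
  simp only [Complex.mul_re, Complex.ofReal_re, Complex.ofReal_im, mul_zero, sub_zero]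
  calc _ ≤ ‖G‖ * (1 + Real.exp (T * L)) := by gcongr
    _ = _ := by ring

/-- A function which is holomorphic near the closed right half-plane and equals `R t` times the
Laplace integral of `G exp (t L)` for large `Re t` does so at `t = 0` too, if the integral
converges there. -/
lemma eq_mul_integral_of_eq_right {Ω : Type*} [MeasurableSpace Ω] {μ : Measure Ω} {G : Ω → ℂ}
    {L : Ω → ℝ} (hL : AEMeasurable L μ) {b : ℝ} (hG : Integrable G μ)
    (hint : ∀ T : ℝ, b < T → Integrable (fun ω => G ω * Complex.exp ((T : ℂ) * L ω)) μ)
    {e R : ℂ → ℂ} (he : Differentiable ℂ e) (hR : Differentiable ℂ R)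
    (heq : ∀ t : ℂ, b < t.re → e t = R t * ∫ ω, G ω * Complex.exp (t * L ω) ∂μ) :
    e 0 = R 0 * ∫ ω, G ω ∂μ := by
  have hmeas (t : ℂ) : AEStronglyMeasurable (fun ω => G ω * Complex.exp (t * L ω)) μ :=
    hG.aestronglyMeasurable.mul ((Complex.measurable_exp.comp_aemeasurable
      ((Complex.measurable_ofReal.comp_aemeasurable hL).const_mul t)).aestronglyMeasurable)
  have hbound {T : ℝ} (hT : b < T) : Integrable
      (fun ω => ‖G ω‖ + ‖G ω * Complex.exp ((T : ℂ) * L ω)‖) μ := hG.norm.add (hint T hT).norm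
  have hconv (t : ℂ) (ht : 0 ≤ t.re) : Integrable (fun ω => G ω * Complex.exp (t * L ω)) μ :=
    (hbound (T := max t.re (b + 1)) ((lt_add_one b).trans_le (le_max_right _ _))).mono' (hmeas t)
      (Eventually.of_forall fun ω => norm_mul_exp_le ht (le_max_left _ _))
  have hZ : DifferentiableOn ℂ (fun t : ℂ => ∫ ω, G ω * Complex.exp (t * L ω) ∂μ)
      {t | 0 < t.re} := by
    have h := differentiableOn_laplace (μ := μ) (g := G) hL (aemeasurable_const (b := (0 : ℝ)))
      (S := {p : ℂ × ℂ | 0 < p.1.re})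
      (isOpen_lt continuous_const (Complex.continuous_re.comp continuous_fst)) fun p hp => by
        simpa using hconv p.1 (le_of_lt hp)
    have h2 := h.comp (f := fun t : ℂ => (t, (0 : ℂ))) (s := {t : ℂ | 0 < t.re})
      (by fun_prop) fun t ht => ht
    simpa [Function.comp_def] using h2
  have hpos := eqOn_halfPlane (c := 0) (b := b) he.differentiableOn (hR.differentiableOn.mul hZ) heq
  set u : ℕ → ℝ := fun m => 1 / ((m : ℝ) + 1)
  have hu : Tendsto u atTop (𝓝 0) := tendsto_one_div_add_atTop_nhds_zero_nat
  have hu0 (m : ℕ) : 0 < u m := Nat.one_div_pos_of_nat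
  have hu1 (m : ℕ) : u m ≤ 1 := by
    refine (div_le_one (by positivity)).2 ?_
    have : (0 : ℝ) ≤ m := Nat.cast_nonneg m
    linarith
  have huc : Tendsto (fun m => (u m : ℂ)) atTop (𝓝 0) := by
    have := (Complex.continuous_ofReal.tendsto 0).comp hu
    simpa [Function.comp_def] using this
  have h1 : Tendsto (fun m => e (u m)) atTop (𝓝 (e 0)) := (he.continuous.tendsto 0).comp huc
  have h2 : Tendsto (fun m => R (u m)) atTop (𝓝 (R 0)) := (hR.continuous.tendsto 0).comp huc
  have h3 : Tendsto (fun m => ∫ ω, G ω * Complex.exp ((u m : ℂ) * L ω) ∂μ) atTop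
      (𝓝 (∫ ω, G ω ∂μ)) := by
    refine tendsto_integral_of_dominated_convergence _ (fun m => hmeas _)
      (hbound (T := max 1 (b + 1)) ((lt_add_one b).trans_le (le_max_right _ _)))
      (fun m => Eventually.of_forall fun ω => norm_mul_exp_le (by simpa using (hu0 m).le)
        (by simpa using (Or.inl (hu1 m)))) (Eventually.of_forall fun ω => ?_)
    have h4 : Continuous fun t : ℂ => G ω * Complex.exp (t * L ω) := by fun_prop
    have h5 := (h4.tendsto 0).comp huc
    simpa [Function.comp_def] using h5
  refine tendsto_nhds_unique h1 ((h2.mul h3).congr fun m => (hpos ?_).symm)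
  change 0 < ((u m : ℝ) : ℂ).re
  simpa using hu0 m

/-- The normalized zeta integral coincides with the entire function wherever it converges: a point
of convergence is joined to the region where this is known by a half-line along which both
exponents increase. -/
lemma eq_zetaIntegral_of_converges {n d : ℕ} (hd : d ≤ n) {φ : 𝓢(W n d, ℂ)} {E : ℂ × ℂ → ℂ}
    (hE : Differentiable ℂ E)
    (hEs : ∀ s ∈ tube 1, E s = (gammaFactor n d s)⁻¹ * zetaIntegral φ s)
    {s : ℂ × ℂ} (hs : Converges φ s) : E s = (gammaFactor n d s)⁻¹ * zetaIntegral φ s := by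
  set S : Set (Coord n d) := ofCoord ⁻¹' cone n d
  set L : Coord n d → ℝ := fun c => Real.log (P₁ (ofCoord c)) + Real.log (P₂ (ofCoord c))
  have hL : AEMeasurable L (volume.restrict S) :=
    ((continuous_P₁ n d).measurable.log.add (continuous_P₂ n d).measurable.log).aemeasurable
  have hmem : ∀ᵐ c ∂(volume.restrict S), c ∈ S :=
    ae_restrict_mem₀ (nullMeasurableSet_preimage_cone hd)
  have hshift (t : ℂ) : (fun c => integrand φ (s + (t, t)) (ofCoord c)) =ᵐ[volume.restrict S]
      fun c => integrand φ s (ofCoord c) * Complex.exp (t * L c) := by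
    filter_upwards [hmem] with c hc
    rw [integrand_eq_mul_exp φ _ hc, integrand_eq_mul_exp φ _ hc, mul_assoc, ← Complex.exp_add]
    congr 2
    simp only [L, Prod.fst_add, Prod.snd_add, Complex.ofReal_add]
    ring
  set b : ℝ := max (1 - s.1.re) (1 - s.2.re)
  have hb {t : ℂ} (ht : b < t.re) : s + (t, t) ∈ tube 1 := by
    have h1 := (le_max_left (1 - s.1.re) (1 - s.2.re)).trans_lt ht
    have h2 := (le_max_right (1 - s.1.re) (1 - s.2.re)).trans_lt ht
    refine ⟨?_, ?_⟩ <;> simp only [Prod.fst_add, Prod.snd_add, Complex.add_re] <;> linarith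
  have hconv {t : ℂ} (ht : b < t.re) : Converges φ (s + (t, t)) :=
    converges_of_nonneg φ (zero_le_one.trans (hb ht).1.le) (zero_le_one.trans (hb ht).2.le)
  have h := eq_mul_integral_of_eq_right (μ := volume.restrict S)
    (G := fun c => integrand φ s (ofCoord c)) hL (b := b) hs
    (fun T hT => (hconv (t := (T : ℂ)) hT).congr (hshift T))
    (e := fun t => E (s + (t, t))) (R := fun t => (gammaFactor n d (s + (t, t)))⁻¹)
    (hE.comp (differentiable_diag s))
    ((differentiable_inv_gammaFactor n d).comp (differentiable_diag s)) fun t ht => by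
      rw [hEs _ (hb ht), zetaIntegral, integral_congr_ae (hshift t)]
  have h0 : s + ((0 : ℂ), (0 : ℂ)) = s := add_zero s
  simp only [h0] at h
  exact h

end EnhancedZeta

theorem theorem2p2 (n d : ℕ) (hd : d ≤ n) (φ : 𝓢(EnhancedZeta.W n d, ℂ)) :
    -- the integral converges in the quadrant `Re s₁ ≥ 0`, `Re s₂ ≥ 0`
    (∀ s : ℂ × ℂ, 0 ≤ s.1.re → 0 ≤ s.2.re → EnhancedZeta.Converges φ s) ∧
    -- the normalized integral extends to an entire function `E`
    ∃ E : ℂ × ℂ → ℂ, Differentiable ℂ E ∧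
      (∀ s, EnhancedZeta.Converges φ s →
        E s = EnhancedZeta.zetaIntegral φ s / EnhancedZeta.gammaFactor n d s) ∧
      -- the integral extends to a meromorphic function `M`, whose poles are among those of the
      -- gamma factor
      ∃ M : ℂ × ℂ → ℂ, EnhancedZeta.IsMeromorphic M ∧
        ∀ s ∉ EnhancedZeta.gammaPoles n d, AnalyticAt ℂ M s ∧
          M s = EnhancedZeta.gammaFactor n d s * E s ∧
          (EnhancedZeta.Converges φ s → M s = EnhancedZeta.zetaIntegral φ s) := by
  refine ⟨fun s h1 h2 => EnhancedZeta.converges_of_nonneg φ h1 h2, ?_⟩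
  obtain ⟨E, hE, hEs⟩ := EnhancedZeta.exists_entire_eq_zetaIntegral hd φ
  have hEc (s : ℂ × ℂ) (hs : EnhancedZeta.Converges φ s) :
      E s = EnhancedZeta.zetaIntegral φ s / EnhancedZeta.gammaFactor n d s := by
    rw [EnhancedZeta.eq_zetaIntegral_of_converges hd hE hEs hs, div_eq_mul_inv, mul_comm]
  have hEa (s : ℂ × ℂ) : AnalyticAt ℂ E s := EnhancedZeta.analyticAt_of_differentiable hE s
  have hΓa (s : ℂ × ℂ) : AnalyticAt ℂ (fun t => (EnhancedZeta.gammaFactor n d t)⁻¹) s :=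
    EnhancedZeta.analyticAt_of_differentiable (EnhancedZeta.differentiable_inv_gammaFactor n d) s
  have hM (t : ℂ × ℂ) : EnhancedZeta.gammaFactor n d t * E t =
      E t / (EnhancedZeta.gammaFactor n d t)⁻¹ := by rw [div_inv_eq_mul, mul_comm]
  -- Lean's inverse vanishes at the poles of the gamma factor, as does the entire function
  -- `1 / Γ_Ω̃`, so that `M = E / (1 / Γ_Ω̃)` is a quotient of entire functions.
  refine ⟨E, hE, hEc, fun s => EnhancedZeta.gammaFactor n d s * E s, fun s => ?_, fun s hs => ?_⟩
  · exact ⟨E, _, hEa s, hΓa s, EnhancedZeta.not_eventually_inv_gammaFactor_eq_zero hd s,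
      Eventually.of_forall fun t _ => hM t⟩
  · have h0 := EnhancedZeta.gammaFactor_ne_zero hs
    refine ⟨?_, rfl, fun hc => ?_⟩
    · simp only [hM]
      exact (hEa s).div (hΓa s) (inv_ne_zero h0)
    · simp only []
      rw [hEc s hc, mul_div_cancel₀ _ h0]
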